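/- Let $\Lambda\subset\mathbb Z^2$ be a box of side-length $L\ge 2$ (a translate of $\{1,\dots,L\}^2$), let $\beta\ge 1$, and let $n^+$ be an integer with $\log L\le n^+\le L$. Let $\partial\Lambda$ be the set of sites of $\mathbb Z^2\setminus\Lambda$ at distance $1$ from $\Lambda$. Let $\pi^0_\Lambda$ be the Solid-On-Solid Gibbs measure on $\Lambda$ at inverse temperature $\beta$ with floor at $0$, ceiling at $n^+$ and zero boundary condition, that is, the probability measure on $\{0,1,\dots,n^+\}^\Lambda$ with $$\pi^0_\Lambda(\eta)\ \propto\ \exp\Big(-\beta\Big[\tfrac12\sum_{\substack{x,y\in\Lambda\\ |x-y|=1}}|\eta_x-\eta_y|+\sum_{\substack{x\in\Lambda,\ y\in\partial\Lambda\\ |x-y|=1}}|\eta_x|\Big]\Big).$$ Set $H=\lfloor\frac1{4\beta}\log L\rfloor$. There exist absolute constants $C,K>0$, with $K$ an integer (independent of $\beta$, $L$, $n^+$, $\Lambda$ and $k$), such that for every integer $k\ge K$, $$\pi^0_\Lambda\big(\#\{v\in\Lambda:\eta_v\le H-k\}>e^{-2\beta k}L^2\big)\le\exp\big(-e^{\beta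 k}L\big),$$ $$\pi^0_\Lambda\big(\#\{v\in\Lambda:\eta_v\ge H+k\}>e^{-2\beta k}L^2\big)\le\exp\Big(-C\,e^{-2\beta k}L\,\min\big\{1,\ e^{-2\beta k}L\,(\log L)^{-8}\big\}\Big).$$ -/

import Mathlib

open scoped Classical

noncomputable section

namespace SOS

/-- Sites of the square lattice. -/
abbrev Site : Type := ℤ × ℤ

/-- Nearest neighbours: lattice sites at distance `1`. -/
def Adj (x y : Site) : Prop := |x.1 - y.1| + |x.2 - y.2| = 1

/-- The four nearest neighbours of a site. -/
def nbrs (x : Site) : Finset Site :=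
  {(x.1 + 1, x.2), (x.1 - 1, x.2), (x.1, x.2 + 1), (x.1, x.2 - 1)}

/-- The external boundary: the sites outside `Λ` at distance `1` from `Λ`. -/
def extBoundary (Λ : Finset Site) : Finset Site := Λ.biUnion nbrs \ Λ

theorem mem_nbrs (x y : Site) : y ∈ nbrs x ↔ Adj x y := by
  obtain ⟨a, b⟩ := x
  obtain ⟨c, d⟩ := y
  simp only [nbrs, Adj, Finset.mem_insert, Finset.mem_singleton, Prod.mk.injEq]
  rcases abs_cases (a - c) with h | h <;> rcases abs_cases (b - d) with h' | h' <;> omega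

theorem mem_extBoundary (Λ : Finset Site) (y : Site) :
    y ∈ extBoundary Λ ↔ y ∉ Λ ∧ ∃ x ∈ Λ, Adj x y := by
  simp [extBoundary, mem_nbrs, and_comm]

/-- The box of side-length `L` consisting of the sites `a + (i, j)`, `1 ≤ i, j ≤ L`. -/
def box (a : Site) (L : ℕ) : Finset Site :=
  Finset.Icc (a.1 + 1) (a.1 + L) ×ˢ Finset.Icc (a.2 + 1) (a.2 + L)

/-- Height functions on `Λ` with floor at `0` and ceiling at `n`. -/
abbrev Config (Λ : Finset Site) (n : ℕ) : Type := Λ → Fin (n + 1)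

/-- The height of `η` at `v`, as an integer. -/
def height {Λ : Finset Site} {n : ℕ} (η : Config Λ n) (v : Λ) : ℤ := ((η v : ℕ) : ℤ)

/-- The SOS Hamiltonian on `Λ` with boundary condition `ξ`. -/
def hamiltonian (Λ : Finset Site) (ξ : Site → ℤ) (η : Λ → ℤ) : ℝ :=
  (1 / 2 : ℝ) * (∑ x : Λ, ∑ y : Λ, if Adj x y then |(η x : ℝ) - (η y : ℝ)| else 0)
    + ∑ x : Λ, ∑ y ∈ extBoundary Λ, if Adj x y then |(η x : ℝ) - (ξ y : ℝ)| else 0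

/-- The Boltzmann weight of a configuration. -/
def weight (β : ℝ) (Λ : Finset Site) (n : ℕ) (ξ : Site → ℤ) (η : Config Λ n) : ℝ :=
  Real.exp (-β * hamiltonian Λ ξ (height η))

/-- The partition function with floor at `0` and ceiling at `n`. -/
def partitionFn (β : ℝ) (Λ : Finset Site) (n : ℕ) (ξ : Site → ℤ) : ℝ :=
  ∑ η : Config Λ n, weight β Λ n ξ η

/-- The probability of the event `A` under the Gibbs measure on `Λ` at inverse temperature `β`
with floor at `0`, ceiling at `n` and boundary condition `ξ`. -/
def gibbsProb (β : ℝ) (Λ : Finset Site) (n : ℕ) (ξ : Site → ℤ) (A : Set (Config Λ n)) : ℝ :=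
  ∑ η : Config Λ n, if η ∈ A then weight β Λ n ξ η / partitionFn β Λ n ξ else 0

theorem partitionFn_pos (β : ℝ) (Λ : Finset Site) (n : ℕ) (ξ : Site → ℤ) :
    0 < partitionFn β Λ n ξ :=
  Finset.sum_pos (fun _ _ => Real.exp_pos _) Finset.univ_nonempty

theorem gibbsProb_univ (β : ℝ) (Λ : Finset Site) (n : ℕ) (ξ : Site → ℤ) :
    gibbsProb β Λ n ξ Set.univ = 1 := by
  simp only [gibbsProb, Set.mem_univ, if_true, ← Finset.sum_div]
  exact div_self (partitionFn_pos β Λ n ξ).ne'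

/-- The number of sites of `Λ` whose height is at most `h`. -/
def numLE {Λ : Finset Site} {n : ℕ} (η : Config Λ n) (h : ℤ) : ℕ :=
  (Finset.univ.filter fun v : Λ => height η v ≤ h).card

/-- The number of sites of `Λ` whose height is at least `h`. -/
def numGE {Λ : Finset Site} {n : ℕ} (η : Config Λ n) (h : ℤ) : ℕ :=
  (Finset.univ.filter fun v : Λ => h ≤ height η v).card

/-- The equilibrium height `⌊(1 / 4β) log L⌋`. -/
def eqHeight (β : ℝ) (L : ℕ) : ℤ := ⌊1 / (4 * β) * Real.log L⌋

end SOS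

end

open scoped Classical

noncomputable section

namespace SOS

/-! ### Counting self-avoiding turn words -/

/-! Both bounds compare total weights (`WN` with ceiling, `W` without) through explicit injective
changes of the surface.

High sites. The event is increasing, so by FKG removing the ceiling only makes it likelier
(`WN_mul_W_le`). A contour at height `ℓ` around a region `F` is removed by lowering `F` by one,
which gains a factor `exp (-β * per F)` but requires heights at least `1` on all of `F`. Given the
contour and `b ≤ ℓ`, a site of `F` sits on the floor with probability at most `p`, of order `exp
(-4βb)`: such a spike is surrounded by `b` nested contours (`W_jump_spike_le`), and nested chains of
contours weigh no more than chains of single sites, up to a constant (`exists_chainSum_le`).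
Positive association then bounds the price of the floor by `(1 - p)^(-|F|)`, and `2|F| ≤ L * per F`
turns this into `exp (p * L * per F)` (`W_jump_le`). Since `L ≤ exp (4β(H+1))`, `pL` is as small as
desired once `b` exceeds `H` by a constant, so higher contours keep a cost `exp (-(β-κ) * per F)`.
Peeling off the level sets downwards (`mass_peel_le`, `peel_le_exp`) bounds the exponential moment
of the number of high sites for a parameter `t` of order `1/L` (`exists_mass_exp_le`). Markov's
inequality gives an exponent linear in `L`, stronger than the minimum in the theorem.

Low sites. Raise the surface by one, at a cost of at most `4βL`, and drop an arbitrary subset of the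
sites of height `h` to the floor. The subset can be read off as the new zero set, so the entropy
gained is `(1 + exp (-4β(h+1)))^|level|`, which beats the cost when a level below `H - k` is
overpopulated (`WN_level_le`). The move needs one more unit of ceiling; `log L ≤ n` makes the
ceiling rarely reached, so this costs a factor `2` (`WN_succ_le`).

To reach every `β ≥ 1`, the number of contours must grow at a rate strictly below `e`, so the
trivial rate `3` is not enough. The finite certificate `loopTrie` yields the rate `2.718`, and the
remaining gap pays for the losses `κ`. -/

/-- A turn of a lattice path: straight on, left or right. -/
inductive Turn
  | S
  | L
  | R

/-- Rotation by a quarter turn, counterclockwise. -/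
def rot (h : Site) : Site := (-h.2, h.1)

/-- The heading after a turn. -/
def Turn.apply : Turn → Site → Site
  | .S, h => h
  | .L, h => rot h
  | .R, h => -rot h

/-- The displacement of the path that starts with a step `h` and then follows the turns `w`. -/
def disp : List Turn → Site → Site
  | [], h => h
  | t :: w, h => h + disp w (t.apply h)

theorem disp_eq (w : List Turn) (h : Site) :
    disp w h = ((disp w (1, 0)).1 * h.1 - (disp w (1, 0)).2 * h.2,
      (disp w (1, 0)).1 * h.2 + (disp w (1, 0)).2 * h.1) := by
  induction w generalizing h with
  | nil => simp [disp]
  | cons t w ih =>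
    rw [disp, disp, ih (t.apply h), ih (t.apply (1, 0))]
    cases t <;> simp [Turn.apply, rot, Prod.ext_iff] <;> constructor <;> ring

theorem disp_eq_zero {w : List Turn} (hw : disp w (1, 0) = 0) (h : Site) : disp w h = 0 := by
  rw [disp_eq, hw]; simp

/-- No sub-path of the path with turns `w` closes up. -/
def SelfAvoiding (w : List Turn) : Prop := ∀ u, u <:+: w → disp u (1, 0) ≠ 0

theorem SelfAvoiding.mono {u w : List Turn} (hw : SelfAvoiding w) (h : u <:+: w) :
    SelfAvoiding u := fun v hv => hw v (hv.trans h)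

/-- A prefix tree of turn words with natural number labels. -/
inductive Trie
  | nil
  | node (v : ℕ) (s l r : Trie)

namespace Trie

/-- Exchanges left and right. -/
def mirror : Trie → Trie
  | nil => nil
  | node v s l r => node v s.mirror r.mirror l.mirror

/-- The label of a word; `10 ^ 6` for a word outside the tree. -/
def look : Trie → List Turn → ℕ
  | nil, _ => 1000000
  | node v _ _ _, [] => v
  | node _ s _ _, .S :: w => s.look w
  | node _ _ l _, .L :: w => l.look w
  | node _ _ _ r, .R :: w => r.look w

/-- The least label of a suffix of `w`. -/
def pot (T : Trie) : List Turn → ℕ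
  | [] => T.look []
  | t :: w => cond (Nat.ble (T.look (t :: w)) (T.pot w)) (T.look (t :: w)) (T.pot w)

/-- The label zero occurs only at words whose path closes up. -/
def zerosClose : Trie → Site → Site → Bool
  | nil, _, _ => true
  | node v s l r, p, h => (v != 0 || (p.1 == 0 && p.2 == 0)) &&
      s.zerosClose (p + h) h && l.zerosClose (p + rot h) (rot h) &&
      r.zerosClose (p + -rot h) (-rot h)

/-- The potential of the root tree `T` grows by at most a factor `2.718` from every word of the
subtree that is reached by the reversed word `p`. -/
def growthLE (T : Trie) : Trie → List Turn → Bool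
  | nil, _ => true
  | node v s l r, p => (v == 0 || Nat.ble (500 * (T.pot (p.reverse ++ [.S]) +
        (T.pot (p.reverse ++ [.L]) + T.pot (p.reverse ++ [.R])))) (1359 * v)) &&
      growthLE T s (.S :: p) && growthLE T l (.L :: p) && growthLE T r (.R :: p)

theorem pot_cons_le (T : Trie) (t : Turn) (w : List Turn) : T.pot (t :: w) ≤ T.pot w := by
  rw [pot]
  cases h : Nat.ble (T.look (t :: w)) (T.pot w)
  · simp
  · simpa using Nat.le_of_ble_eq_true h

theorem pot_le_of_suffix (T : Trie) {u w : List Turn} (h : u <:+ w) : T.pot w ≤ T.pot u := by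
  obtain ⟨v, rfl⟩ := h
  induction v with
  | nil => simp
  | cons t v ih => exact (T.pot_cons_le t _).trans ih

theorem exists_suffix_look_eq_pot (T : Trie) (w : List Turn) :
    ∃ u, u <:+ w ∧ T.look u = T.pot w := by
  induction w with
  | nil => exact ⟨[], List.suffix_rfl, rfl⟩
  | cons t w ih =>
    rw [pot]
    cases h : Nat.ble (T.look (t :: w)) (T.pot w)
    · obtain ⟨u, hu, h'⟩ := ih
      exact ⟨u, hu.trans (List.suffix_cons t w), by simpa using h'⟩
    · exact ⟨t :: w, List.suffix_rfl, by simp⟩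

theorem disp_eq_zero_of_zerosClose {T : Trie} {p h : Site} (hT : T.zerosClose p h = true)
    {w : List Turn} (hw : T.look w = 0) : p - h + disp w h = 0 := by
  induction w generalizing T p h with
  | nil =>
    cases T with
    | nil => simp [look] at hw
    | node v s l r =>
      simp only [look] at hw
      simp [zerosClose, hw] at hT
      simp [disp, Prod.ext_iff, hT]
  | cons t w ih =>
    cases T with
    | nil => simp [look] at hw
    | node v s l r =>
      simp only [zerosClose, Bool.and_eq_true] at hT
      have key : ∀ h' : Site, p - h + (h + disp w h') = p + h' - h' + disp w h' := by
        intro h'; abel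
      cases t
      · simp only [disp, Turn.apply]
        rw [key]; exact ih hT.1.1.2 hw
      · simp only [disp, Turn.apply]
        rw [key]; exact ih hT.1.2 hw
      · simp only [disp, Turn.apply]
        rw [key]; exact ih hT.2 hw

theorem growth_of_growthLE {T T' : Trie} {p w : List Turn} (h : growthLE T T' p = true)
    (h0 : T'.look w ≠ 0) (h1 : T'.look w ≠ 1000000) :
    500 * (T.pot (p.reverse ++ w ++ [.S]) + (T.pot (p.reverse ++ w ++ [.L]) +
      T.pot (p.reverse ++ w ++ [.R]))) ≤ 1359 * T'.look w := by
  induction w generalizing T' p with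
  | nil =>
    cases T' with
    | nil => simp [look] at h1
    | node v s l r =>
      simp only [look] at h0
      simp only [growthLE, Bool.and_eq_true, Bool.or_eq_true, beq_iff_eq, h0, false_or] at h
      simpa [look] using Nat.le_of_ble_eq_true h.1.1.1
  | cons t w ih =>
    cases T' with
    | nil => simp [look] at h1
    | node v s l r =>
      simp only [growthLE, Bool.and_eq_true] at h
      cases t
      · simpa [look] using ih h.1.1.2 h0 h1
      · simpa [look] using ih h.1.2 h0 h1
      · simpa [look] using ih h.2 h0 h1

end Trie

/-- A labelled prefix tree whose zeros are closed paths of at most `14` steps. -/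
def loopTrie : Trie :=
  let n := Trie.node
  let o := Trie.nil
  let z := n 0 o o o
  let l := fun v => n v o z o
  let r := fun v => n v o o z
  let y := fun v a b => n v a b b.mirror
  y 603 (y 573 (y 559 (y 555 o (n 476 (n 504 o (n 346 (n 360 (n 392 (n 459 o (n 215 z o o) o) (n
  123 o o (l 333)) o) (n 99 o o (n 267 (l 358) o o)) o) (n 87 o o (n 236 (n 293 (l 369) o o) o
  o)) o) o) (n 273 (n 280 (n 309 (l 380) o (n 459 o (n 451 o (n 189 z o o) o) o)) o (n 450 o (n
  395 (n 451 o (n 189 z o o) o) (n 123 o o (l 334)) o) o)) o (n 461 o (n 365 (n 394 (n 457 o (n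
  209 z o o) o) (n 123 o o (l 333)) o) (n 99 o o (n 268 (l 358) o o)) o) o)) o)) (n 482 (n 508
  (n 528 o (n 407 (n 436 (n 489 o (n 300 (n 202 z o o) o o) o) (n 199 (n 114 o o (l 308)) o (n
  400 o (n 187 z o o) o)) o) (n 157 (n 89 o o (n 241 (l 339) o o)) o (n 337 (n 426 o (n 189 z o
  o) o) (n 119 o o (l 321)) o)) o) o) (n 357 (n 381 (n 430 (n 510 o (n 353 (l 377) (r 66) o) o)
  (n 175 z o (n 473 o (l 380) o)) o) (n 118 o o (n 318 (n 497 o (l 378) o) z o)) (n 487 o (n 486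
  o (n 286 (n 266 z o o) o o) o) o)) (n 96 o o (n 259 (l 357) o (n 346 o (n 447 o (n 189 z o o)
  o) o))) (n 491 o (n 435 (n 485 o (n 285 (n 198 z o o) o o) o) (n 190 (n 114 o o (l 308)) o (n
  402 o (n 187 z o o) o)) o) o)) o) (n 286 (n 307 (n 368 (n 517 o (l 372) o) z o) o (n 465 (n
  512 o (n 471 o (n 247 (n 181 z o o) o o) o) o) (n 437 (n 501 o (n 326 (l 372) (r 1) o) o) (n
  188 z o o) o) o)) o (n 469 (n 516 o (n 434 (n 478 o (n 270 (n 183 z o o) o o) o) (n 189 (n 114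
  o o (l 308)) o (n 398 o (n 187 z o o) o)) o) o) (n 388 (n 432 (n 508 o (n 348 (l 377) (r 51)
  o) o) (n 175 z o (n 473 o (l 380) o)) o) (n 123 o o (l 333)) (n 499 o (n 483 o (n 275 (n 246 z
  o o) o o) o) o)) o)) o)) (n 499 (n 521 (n 534 (n 546 o (n 452 (n 489 o (n 304 (n 264 (n 178 z
  o o) o o) o o) o) (n 222 (n 177 (n 108 o o (l 293)) o (n 372 o (n 184 z o o) o)) o (n 425 o (n
  269 (n 181 z o o) o o) o)) o) o) (n 423 (n 457 (n 508 o (n 351 (n 341 (l 379) (r 52) o) (n 99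
  o o (n 180 z o o)) o) o) (n 237 (n 166 z o (n 448 o (l 381) o)) (n 25 o o (n 67 o o (l 181)))
  (n 452 o (n 327 (l 380) (r 1) o) o)) o) (n 178 (n 108 o o (n 292 (n 478 o (l 380) o) z o)) o
  (n 375 (n 477 o (n 328 (l 379) (r 1) o) o) (n 171 z o (n 462 o (l 382) o)) o)) (n 513 o (n 489
  o (n 296 (n 311 (n 242 z o o) o o) o o) o) o)) o) (n 385 (n 430 (n 499 o (n 326 (l 370) (r 1)
  o) o) (n 173 z o (n 468 o (l 372) o)) o) (n 117 o o (n 318 (n 493 o (l 371) o) z o)) (n 499 (n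
  534 o (n 480 o (n 276 (n 267 (n 242 z o o) o o) o o) o) o) (n 456 (n 504 o (n 337 (n 338 (l
  379) (r 43) o) (n 67 o o (n 180 z o o)) o) o) (n 228 (n 166 z o (n 448 o (l 381) o)) o (n 453
  o (n 327 (l 380) (r 1) o) o)) o) o)) o) (n 317 (n 370 (n 512 (n 539 o (n 433 o (n 164 z o o)
  o) o) (n 368 (n 484 o (l 292) o) z o) o) z (n 491 o (n 499 o (n 323 (l 366) o o) o) o)) o (n
  489 (n 524 (n 543 o (n 473 o (n 260 (n 237 (n 178 z o o) o o) o o) o) o) (n 455 (n 497 o (n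
  321 (n 322 (l 379) (r 1) o) (n 51 o o (n 137 z o o)) o) o) (n 227 (n 165 z o (n 448 o (l 381)
  o)) o (n 450 o (n 327 (l 380) (r 1) o) o)) o) o) (n 434 (n 499 o (n 323 (l 366) (r 1) o) o) (n
  173 z o (n 469 o (l 371) o)) o) o)) (n 516 o (n 498 (n 524 o (n 391 (n 429 (n 480 o (n 276 (n
  186 z o o) o o) o) (n 190 (n 114 o o (l 308)) o (n 400 o (n 187 z o o) o)) o) (n 124 o o (n
  337 (n 426 o (n 189 z o o) o) (n 119 o o (l 321)) o)) o) o) (n 321 (n 380 (n 429 (n 509 o (n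
  350 (l 377) (r 58) o) o) (n 175 z o (n 473 o (l 380) o)) o) (n 117 o o (n 318 (n 497 o (l 378)
  o) z o)) (n 485 o (n 483 o (n 278 (n 243 z o o) o o) o) o)) o (n 492 o (n 434 (n 481 o (n 274
  (n 183 z o o) o o) o) (n 190 (n 114 o o (l 308)) o (n 402 o (n 187 z o o) o)) o) o)) o) (n 365
  (n 479 (n 515 o o (n 369 (n 395 (n 453 o o (n 201 z o o)) o (n 123 o (r 331) o)) o (n 99 o (n
  268 (r 357) o o) o))) o (n 291 (n 314 (r 379) (n 473 o o (n 450 o o (n 188 z o o))) o) (n 476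
  o o (n 397 (n 449 o o (n 188 z o o)) o (n 123 o (r 333) o))) o)) o o)))) (n 532 (n 542 (n 546
  (n 550 o (n 462 (n 495 o (n 322 (n 315 (n 318 (l 380) (r 1) o) (n 51 o o (n 135 z o o)) o) (n
  69 o o (n 186 (n 157 z o o) o o)) o) o) (n 243 (n 215 (n 160 z o (n 433 o (l 382) o)) o (n 424
  o (n 324 (l 381) (r 1) o) o)) o (n 445 o (n 321 (n 321 (l 380) (r 1) o) (n 51 o o (n 137 z o
  o)) o) o)) o) o) (n 452 (n 490 o (n 308 (n 314 (l 365) (r 1) o) (n 44 o o (n 118 z o (n 320 o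
  (l 377) o))) (n 478 o (n 399 (n 458 o (n 212 z o o) o) (n 118 (r 1) o (n 319 (n 497 o (l 378)
  o) z o)) o) o)) o) (n 222 (n 162 z o (n 440 o (l 368) o)) o (n 439 (n 504 o (n 400 (n 454 o (n
  203 z o o) o) (n 122 (r 1) o (l 329)) o) o) (n 319 (l 367) (r 1) o) o)) o) o) (n 432 (n 491 (n
  523 o (n 392 (n 434 o (n 176 z o o) o) (n 116 (r 1) o (l 312)) o) o) (n 316 (n 366 (n 498 o (l
  325) o) z o) (r 1) (n 491 o (n 434 o (n 167 z o o) o) o)) o) (n 171 z o (n 463 (n 516 o (n 432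
  o (n 166 z o o) o) o) (n 371 (n 499 o (l 322) o) z o) o)) (n 512 o (n 488 o (n 293 (n 314 (l
  365) (r 1) o) o (n 480 o (n 400 (n 456 o (n 207 z o o) o) (n 123 (r 1) o (l 333)) o) o)) o)
  o)) (n 495 o (n 510 (n 535 o (n 418 (n 470 o (n 265 (n 240 (n 178 z o o) o o) o o) o) (n 152 o
  o (n 413 o (n 246 (n 180 z o o) o o) o)) o) o) (n 353 (n 449 (n 499 o (n 325 (n 322 (l 379) (r
  1) o) (n 51 o o (n 137 z o o)) o) o) (n 227 (n 165 z o (n 448 o (l 381) o)) o (n 450 o (n 327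
  (l 380) (r 1) o) o)) o) o (n 510 o (n 477 o (n 265 (n 240 (n 178 z o o) o o) o o) o) o)) o) (n
  314 (n 363 (n 495 o o (n 322 (r 377) (n 497 o o (n 447 o o (n 182 z o o))) o)) o o) o o))) (n
  381 (n 516 (n 537 (n 547 o (n 454 o (n 222 (n 156 z o o) o o) o) o) (n 428 (n 484 o (n 292 (l
  314) (r 1) o) o) (n 162 z o (n 439 o (l 319) o)) o) o) (n 370 (n 491 (n 523 o (n 391 o (n 115
  z o o) o) o) (l 316) o) z (n 512 o (n 487 o (n 292 (l 313) o o) o) o)) (n 494 o (n 507 o (n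
  345 (n 427 o (n 166 z o o) o) o o) o) o)) z (n 517 (n 537 o (n 486 o (n 292 (n 311 (l 362) o
  o) o o) o) o) (n 496 (n 523 o (n 388 (n 428 o (n 167 z o o) o) (n 115 o o (l 312)) o) o) (n
  316 (n 365 (n 498 o (l 322) o) z o) o (n 492 o (n 432 o (n 167 z o o) o) o)) o) o)) (n 521 (n
  538 o (n 489 (n 517 o (n 375 (n 411 (n 473 o (n 257 (n 183 z o o) o o) o) (n 148 o o (n 400 o
  (n 187 z o o) o)) o) (n 108 o o (n 293 (n 426 o (n 188 z o o) o) o o)) o) o) (n 301 (n 335 (n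
  427 (n 501 o (n 329 (l 377) (r 1) o) o) (n 175 z o (n 473 o (l 380) o)) o) o (n 482 o (n 474 o
  (n 255 (n 182 z o o) o o) o) o)) o (n 482 o (n 416 (n 474 o (n 255 (n 183 z o o) o o) o) (n
  148 o o (n 402 o (n 187 z o o) o)) o) o)) o) (n 425 (n 480 (n 516 o o (n 373 (n 401 (n 462 o o
  (n 226 z o o)) o (n 131 o (r 331) o)) o (n 99 o (n 268 (r 357) o o) o))) o (n 293 (n 314 (r
  379) (n 473 o o (n 450 o o (n 188 z o o))) o) (n 479 o o (n 401 (n 458 o o (n 212 z o o)) o (n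
  123 o (r 333) o))) o)) o (n 162 o (n 439 (n 504 o o (n 400 (n 454 o o (n 203 z o o)) o (n 122
  o (r 329) o))) o (n 319 (r 380) (n 486 o o (n 449 o o (n 184 z o o))) o)) o))) (n 507 (n 529
  (n 543 o (n 442 (n 481 o (n 283 (n 246 (n 178 z o o) o o) o o) o) (n 203 (n 137 o o (n 372 o
  (n 184 z o o) o)) o (n 414 o (n 251 (n 180 z o o) o o) o)) o) o) (n 404 (n 450 (n 499 o (n 328
  (n 326 (l 379) (r 10) o) (n 51 o o (n 137 z o o)) o) o) (n 228 (n 165 z o (n 448 o (l 381) o))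
  o (n 452 o (n 327 (l 380) (r 1) o) o)) o) (n 138 o o (n 375 (n 477 o (n 328 (l 379) (r 1) o)
  o) (n 170 z o (n 462 o (l 382) o)) o)) (n 509 o (n 478 o (n 267 (n 245 (n 178 z o o) o o) o o)
  o) o)) o) (n 342 (n 429 (n 498 o (n 323 (l 367) (r 1) o) o) (n 172 z o (n 466 o (l 370) o)) o)
  o (n 500 (n 533 o (n 477 o (n 267 (n 243 (n 178 z o o) o o) o o) o) o) (n 455 (n 500 o (n 325
  (n 322 (l 379) (r 1) o) (n 51 o o (n 137 z o o)) o) o) (n 228 (n 165 z o (n 448 o (l 381) o))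
  o (n 453 o (n 327 (l 380) (r 1) o) o)) o) o)) o) (n 370 (n 491 (n 523 o o (n 390 (n 432 (n 502
  o o (n 335 (r 363) o (l 33))) o (n 177 z o o)) (n 508 o o (n 477 o o (n 263 (n 222 z o o) o
  o))) (n 119 o (r 322) o))) o (n 317 (n 369 (n 507 o o (r 349)) o z) (n 490 (n 530 o o (n 468 o
  o (n 243 (n 178 z o o) o o))) o (n 435 (n 498 o o (n 320 (r 359) o (l 1))) o (n 177 z o o)))
  o)) (n 513 o o (n 487 o o (n 293 (n 314 (r 379) (n 473 o o (n 450 o o (n 188 z o o))) o) (n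
  480 o o (n 400 (n 456 o o (n 207 z o o)) o (n 123 o (r 333) o))) o))) o)))

theorem loopTrie_zerosClose : loopTrie.zerosClose (1, 0) (1, 0) = true := by decide +kernel

theorem loopTrie_growthLE : Trie.growthLE loopTrie loopTrie [] = true := by decide +kernel

/-- The potential of a turn word that the certificate `loopTrie` provides. -/
def turnPot (w : List Turn) : ℕ := loopTrie.pot w

/-- The potential is the label of some suffix, and a label zero would exhibit a suffix that closes
up. -/
theorem turnPot_pos {w : List Turn} (hw : SelfAvoiding w) : 0 < turnPot w := by
  obtain ⟨u, hu, h⟩ := loopTrie.exists_suffix_look_eq_pot w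
  refine Nat.pos_of_ne_zero fun h0 => hw u hu.isInfix ?_
  have := Trie.disp_eq_zero_of_zerosClose loopTrie_zerosClose (h.trans h0)
  simpa using this

/-- Let the suffix `u` realise the potential of `w`. Then `u ++ [t]` is a suffix of `w ++ [t]`, so
the inequality checked at the node `u` of the finite tree transfers to `w`. -/
theorem turnPot_growth {w : List Turn} (hw : SelfAvoiding w) :
    500 * (turnPot (w ++ [.S]) + (turnPot (w ++ [.L]) + turnPot (w ++ [.R]))) ≤
      1359 * turnPot w := by
  obtain ⟨u, hu, h⟩ := loopTrie.exists_suffix_look_eq_pot w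
  have h0 : loopTrie.look u ≠ 0 := by rw [h]; exact (turnPot_pos hw).ne'
  have h1 : loopTrie.look u ≠ 1000000 := by
    -- The default label plays the role of infinity: it exceeds the label of the empty word, so it
    -- is never minimal.
    have h2 : loopTrie.look u ≤ loopTrie.look [] :=
      h.le.trans (loopTrie.pot_le_of_suffix (List.nil_suffix))
    have h3 : loopTrie.look [] < 1000000 := by decide +kernel
    omega
  have key := Trie.growth_of_growthLE loopTrie_growthLE h0 h1
  simp only [List.reverse_nil, List.nil_append] at key
  have hm : ∀ t, turnPot (w ++ [t]) ≤ loopTrie.pot (u ++ [t]) := fun t => by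
    refine loopTrie.pot_le_of_suffix ?_
    obtain ⟨v, rfl⟩ := hu
    exact ⟨v, by simp⟩
  have hS := hm .S
  have hL := hm .L
  have hR := hm .R
  have : turnPot w = loopTrie.look u := h.symm
  rw [this]
  omega

theorem sum_biUnion_le {ι α : Type*} [DecidableEq α] (s : Finset ι) (t : ι → Finset α) {f : α → ℝ}
    (hf : ∀ a, 0 ≤ f a) : ∑ a ∈ s.biUnion t, f a ≤ ∑ i ∈ s, ∑ a ∈ t i, f a := by
  induction s using Finset.induction_on with
  | empty => simp
  | insert i s hi ih =>
    rw [Finset.biUnion_insert, Finset.sum_insert hi]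
    have h := Finset.sum_union_inter (s₁ := t i) (s₂ := s.biUnion t) (f := f)
    have h' : 0 ≤ ∑ a ∈ t i ∩ s.biUnion t, f a := Finset.sum_nonneg fun a _ => hf a
    linarith

/-- The self-avoiding turn words of length `n`. -/
def avoidingWords : ℕ → Finset (List Turn)
  | 0 => {[]}
  | n + 1 => ((avoidingWords n).biUnion fun w => {w ++ [.S], w ++ [.L], w ++ [.R]}).filter
      SelfAvoiding

theorem mem_avoidingWords {n : ℕ} {w : List Turn} :
    w ∈ avoidingWords n ↔ w.length = n ∧ SelfAvoiding w := by
  induction n generalizing w with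
  | zero =>
    simp only [avoidingWords, Finset.mem_singleton, List.length_eq_zero_iff]
    refine ⟨fun h => ⟨h, ?_⟩, fun h => h.1⟩
    rintro u hu
    rw [h, List.infix_nil] at hu
    simp [hu, disp]
  | succ n ih =>
    simp only [avoidingWords, Finset.mem_filter, Finset.mem_biUnion, Finset.mem_insert,
      Finset.mem_singleton, and_congr_left_iff]
    intro hw
    constructor
    · rintro ⟨u, hu, h⟩
      have := (ih.1 hu).1
      rcases h with rfl | rfl | rfl <;> simp [this]
    · intro hlen
      obtain ⟨u, t, rfl⟩ : ∃ u t, w = u ++ [t] := by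
        rcases List.eq_nil_or_concat w with h | ⟨u, t, h⟩
        · simp [h] at hlen
        · exact ⟨u, t, by simpa using h⟩
      refine ⟨u, ih.2 ⟨by simpa using hlen, hw.mono (List.prefix_append _ _).isInfix⟩, ?_⟩
      cases t <;> simp

/-- The total potential grows by at most `1359 / 500` per step, and each self-avoiding word
contributes at least one to it because its potential is a positive integer. -/
theorem card_avoidingWords_le (n : ℕ) :
    ((avoidingWords n).card : ℝ) ≤ turnPot [] * (1359 / 500 : ℝ) ^ n := by
  have hsum : ∀ n, (∑ w ∈ avoidingWords n, (turnPot w : ℝ)) ≤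
      turnPot [] * (1359 / 500 : ℝ) ^ n := by
    intro n
    induction n with
    | zero => simp [avoidingWords]
    | succ n ih =>
      have h1 : (∑ w ∈ avoidingWords (n + 1), (turnPot w : ℝ)) ≤
          ∑ w ∈ avoidingWords n, ∑ u ∈ ({w ++ [.S], w ++ [.L], w ++ [.R]} : Finset (List Turn)),
            (turnPot u : ℝ) := by
        refine (Finset.sum_le_sum_of_subset_of_nonneg (Finset.filter_subset _ _)
          fun _ _ _ => Nat.cast_nonneg _).trans ?_
        exact sum_biUnion_le _ _ fun _ => Nat.cast_nonneg _
      have h2 : ∀ w ∈ avoidingWords n,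
          (∑ u ∈ ({w ++ [.S], w ++ [.L], w ++ [.R]} : Finset (List Turn)), (turnPot u : ℝ)) ≤
            (1359 / 500 : ℝ) * turnPot w := by
        intro w hw
        rw [Finset.sum_insert (by simp), Finset.sum_insert (by simp), Finset.sum_singleton]
        have := turnPot_growth (mem_avoidingWords.1 hw).2
        have h3 : (500 : ℝ) * (turnPot (w ++ [.S]) + (turnPot (w ++ [.L]) +
            turnPot (w ++ [.R]))) ≤ 1359 * turnPot w := by exact_mod_cast this
        linarith
      calc _ ≤ _ := h1
        _ ≤ _ := Finset.sum_le_sum h2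
        _ = (1359 / 500 : ℝ) * ∑ w ∈ avoidingWords n, (turnPot w : ℝ) := by
          rw [Finset.mul_sum]
        _ ≤ (1359 / 500 : ℝ) * (turnPot [] * (1359 / 500 : ℝ) ^ n) := by gcongr
        _ = _ := by ring
  refine le_trans ?_ (hsum n)
  rw [Finset.card_eq_sum_ones, Nat.cast_sum]
  refine Finset.sum_le_sum fun w hw => ?_
  exact_mod_cast turnPot_pos (mem_avoidingWords.1 hw).2

end SOS

end

noncomputable section

namespace SOS

/-! ### Boundaries of finite sets -/

theorem Adj.symm {x y : Site} (h : Adj x y) : Adj y x := by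
  unfold Adj at *; rw [abs_sub_comm y.1, abs_sub_comm y.2]; exact h

theorem Adj.ne {x y : Site} (h : Adj x y) : x ≠ y := by
  rintro rfl; simp [Adj] at h

/-- The directed edges that lead out of `D`. -/
def bd (D : Finset Site) : Finset (Site × Site) :=
  D.biUnion fun x => ((nbrs x).filter (· ∉ D)).image fun y => (x, y)

theorem mem_bd {D : Finset Site} {x y : Site} : (x, y) ∈ bd D ↔ x ∈ D ∧ y ∉ D ∧ Adj x y := by
  simp only [bd, Finset.mem_biUnion, Finset.mem_image, Finset.mem_filter, mem_nbrs, Prod.mk.injEq]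
  constructor
  · rintro ⟨a, ha, b, ⟨h1, h2⟩, rfl, rfl⟩; exact ⟨ha, h2, h1⟩
  · rintro ⟨h1, h2, h3⟩; exact ⟨x, h1, y, ⟨h3, h2⟩, rfl, rfl⟩

/-- The perimeter. -/
def per (D : Finset Site) : ℕ := (bd D).card

/-- The unit vectors. -/
def IsDir (d : Site) : Prop := d = (1, 0) ∨ d = (-1, 0) ∨ d = (0, 1) ∨ d = (0, -1)

theorem isDir_iff {x d : Site} : Adj x (x + d) ↔ IsDir d := by
  obtain ⟨a, b⟩ := x
  obtain ⟨c, e⟩ := d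
  simp only [Adj, IsDir, Prod.fst_add, Prod.snd_add, Prod.mk.injEq, sub_add_cancel_left, abs_neg]
  rcases abs_cases c with h | h <;> rcases abs_cases e with h' | h' <;> omega

theorem IsDir.rot {d : Site} (h : IsDir d) : IsDir (rot d) := by
  rcases h with rfl | rfl | rfl | rfl <;> simp [IsDir, SOS.rot]

theorem IsDir.neg {d : Site} (h : IsDir d) : IsDir (-d) := by
  rcases h with rfl | rfl | rfl | rfl <;> simp [IsDir]

theorem IsDir.ne_zero {d : Site} (h : IsDir d) : d ≠ 0 := by
  rcases h with rfl | rfl | rfl | rfl <;> simp [Prod.ext_iff]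

theorem exists_exit {D : Finset Site} {x d : Site} (hx : x ∈ D) (hd : IsDir d) :
    ∃ j : ℕ, (∀ i : ℕ, i ≤ j → x + (i : ℤ) • d ∈ D) ∧ x + ((j : ℤ) + 1) • d ∉ D := by
  have hex : ∃ j : ℕ, x + (j : ℤ) • d ∉ D := by
    by_contra! h
    have hinj : Function.Injective fun j : ℕ => x + (j : ℤ) • d := by
      intro a b hab
      have : (a : ℤ) • d = (b : ℤ) • d := by simpa using hab
      exact_mod_cast smul_left_injective ℤ hd.ne_zero this
    exact Set.infinite_of_injective_forall_mem hinj (s := (D : Set Site)) (by simpa using h)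
      D.finite_toSet
  have h0 : Nat.find hex ≠ 0 := by
    intro h
    have := Nat.find_spec hex
    rw [h] at this
    simp [hx] at this
  refine ⟨Nat.find hex - 1, fun i hi => ?_, ?_⟩
  · by_contra hc
    have := Nat.find_min' hex hc
    omega
  · have := Nat.find_spec hex
    convert this using 4
    omega

/-- The boundary edges in a given direction. -/
def bdDir (D : Finset Site) (d : Site) : Finset (Site × Site) := (bd D).filter fun e => e.2 = e.1 + d

theorem exists_mem_bdDir {D : Finset Site} {x d : Site} (hx : x ∈ D) (hd : IsDir d) :
    ∃ j : ℕ, (∀ i : ℕ, i ≤ j → x + (i : ℤ) • d ∈ D) ∧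
      (x + (j : ℤ) • d, x + (j : ℤ) • d + d) ∈ bdDir D d := by
  obtain ⟨j, h1, h2⟩ := exists_exit hx hd
  refine ⟨j, h1, ?_⟩
  have h3 : x + (j : ℤ) • d + d = x + ((j : ℤ) + 1) • d := by rw [add_smul, one_smul, add_assoc]
  simp only [bdDir, Finset.mem_filter, mem_bd, and_true]
  exact ⟨h1 j le_rfl, h3 ▸ h2, isDir_iff.2 hd⟩

theorem rows_le_bdDir (D : Finset Site) {d : Site} (hd : IsDir d) (h : d.2 = 0) :
    (D.image Prod.snd).card ≤ (bdDir D d).card := by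
  refine (Finset.card_le_card ?_).trans (Finset.card_image_le (f := fun e => e.1.2))
  intro r hr
  obtain ⟨x, hx, rfl⟩ := Finset.mem_image.1 hr
  obtain ⟨j, -, hj⟩ := exists_mem_bdDir hx hd
  exact Finset.mem_image.2 ⟨_, hj, by simp [h]⟩

theorem cols_le_bdDir (D : Finset Site) {d : Site} (hd : IsDir d) (h : d.1 = 0) :
    (D.image Prod.fst).card ≤ (bdDir D d).card := by
  refine (Finset.card_le_card ?_).trans (Finset.card_image_le (f := fun e => e.1.1))
  intro r hr
  obtain ⟨x, hx, rfl⟩ := Finset.mem_image.1 hr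
  obtain ⟨j, -, hj⟩ := exists_mem_bdDir hx hd
  exact Finset.mem_image.2 ⟨_, hj, by simp [h]⟩

/-- Each occupied row is left through an edge on either side, and each occupied column at either
end; edges in different directions are distinct. -/
theorem two_mul_rows_add_cols_le_per (D : Finset Site) :
    2 * ((D.image Prod.snd).card + (D.image Prod.fst).card) ≤ per D := by
  have h1 := rows_le_bdDir D (d := (1, 0)) (by simp [IsDir]) rfl
  have h2 := rows_le_bdDir D (d := (-1, 0)) (by simp [IsDir]) rfl
  have h3 := cols_le_bdDir D (d := (0, 1)) (by simp [IsDir]) rfl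
  have h4 := cols_le_bdDir D (d := (0, -1)) (by simp [IsDir]) rfl
  have hdisj : ∀ d d' : Site, d ≠ d' → Disjoint (bdDir D d) (bdDir D d') := by
    intro d d' hne
    rw [Finset.disjoint_left]
    intro e he he'
    have h1 := (Finset.mem_filter.1 he).2
    have h2 := (Finset.mem_filter.1 he').2
    exact hne (add_left_cancel (h1.symm.trans h2))
  have hsub : (bdDir D (1, 0) ∪ bdDir D (-1, 0)) ∪ (bdDir D (0, 1) ∪ bdDir D (0, -1)) ⊆ bd D := by
    intro e he
    simp only [Finset.mem_union, bdDir, Finset.mem_filter] at he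
    tauto
  have hcard := Finset.card_le_card hsub
  rw [Finset.card_union_of_disjoint, Finset.card_union_of_disjoint (hdisj _ _ (by decide)),
    Finset.card_union_of_disjoint (hdisj _ _ (by decide))] at hcard
  · unfold per; omega
  · simp only [Finset.disjoint_union_left, Finset.disjoint_union_right]
    refine ⟨⟨?_, ?_⟩, ?_, ?_⟩ <;> exact hdisj _ _ (by decide)

theorem card_le_rows_mul_cols (D : Finset Site) :
    D.card ≤ (D.image Prod.snd).card * (D.image Prod.fst).card := by
  rw [mul_comm, ← Finset.card_product]
  refine Finset.card_le_card fun x hx => ?_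
  exact Finset.mem_product.2 ⟨Finset.mem_image_of_mem _ hx, Finset.mem_image_of_mem _ hx⟩

theorem four_le_per {D : Finset Site} (h : D.Nonempty) : 4 ≤ per D := by
  have := two_mul_rows_add_cols_le_per D
  have h1 := (h.image Prod.fst).card_pos
  have h2 := (h.image Prod.snd).card_pos
  omega

theorem six_le_per {D : Finset Site} {v : Site} (h : v ∈ D) (hD : D ≠ {v}) : 6 ≤ per D := by
  have := two_mul_rows_add_cols_le_per D
  have h1 := (Finset.Nonempty.image ⟨v, h⟩ Prod.fst).card_pos
  have h2 := (Finset.Nonempty.image ⟨v, h⟩ Prod.snd).card_pos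
  have h3 := card_le_rows_mul_cols D
  have h4 : D.card ≠ 1 := by
    intro hc
    obtain ⟨w, rfl⟩ := Finset.card_eq_one.1 hc
    simp at h; simp [h] at hD
  have h5 : 0 < D.card := Finset.card_pos.2 ⟨v, h⟩
  by_contra hlt
  have h6 : (D.image Prod.snd).card = 1 := by omega
  have h7 : (D.image Prod.fst).card = 1 := by omega
  rw [h6, h7] at h3
  omega

theorem two_mul_card_le_of_subset_box {D : Finset Site} {a : Site} {L : ℕ} (h : D ⊆ box a L) :
    2 * D.card ≤ L * per D := by
  have h1 := two_mul_rows_add_cols_le_per D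
  have h2 := card_le_rows_mul_cols D
  have h3 : (D.image Prod.fst).card ≤ L := by
    have : D.image Prod.fst ⊆ Finset.Icc (a.1 + 1) (a.1 + L) := by
      intro r hr
      obtain ⟨x, hx, rfl⟩ := Finset.mem_image.1 hr
      exact (Finset.mem_product.1 (h hx)).1
    refine (Finset.card_le_card this).trans ?_
    simp
  calc 2 * D.card ≤ 2 * ((D.image Prod.snd).card * (D.image Prod.fst).card) := by omega
    _ ≤ 2 * ((D.image Prod.snd).card * L) := by gcongr
    _ = L * (2 * (D.image Prod.snd).card) := by ring
    _ ≤ L * per D := Nat.mul_le_mul_left _ (by omega)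

/-- From `x` go right to the exit from `D`; the last site is shared with `D'`. Walking back, leaving
`D'` would cross a common boundary edge whose outer endpoint lies in `D`, which is absurd. -/
theorem subset_of_bd_eq {D D' : Finset Site} (h : bd D = bd D') : D ⊆ D' := by
  intro x hx
  obtain ⟨j, h1, h2⟩ := exists_mem_bdDir hx (d := (1, 0)) (by simp [IsDir])
  have hj : x + (j : ℤ) • ((1, 0) : Site) ∈ D' := by
    have := (Finset.mem_filter.1 h2).1
    rw [h] at this
    exact (mem_bd.1 this).1
  have key : ∀ i : ℕ, i ≤ j → x + ((j - i : ℕ) : ℤ) • ((1, 0) : Site) ∈ D' := by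
    intro i
    induction i with
    | zero => intro _; simpa using hj
    | succ i ih =>
      intro hi
      by_contra hc
      have hmem : (x + ((j - i : ℕ) : ℤ) • ((1, 0) : Site),
          x + ((j - (i + 1) : ℕ) : ℤ) • ((1, 0) : Site)) ∈ bd D' := by
        refine mem_bd.2 ⟨ih (by omega), hc, ?_⟩
        have : x + ((j - (i + 1) : ℕ) : ℤ) • ((1, 0) : Site) =
            x + ((j - i : ℕ) : ℤ) • ((1, 0) : Site) + (-1, 0) := by
          ext
          · simp; omega
          · simp
        rw [this]
        exact isDir_iff.2 (by simp [IsDir])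
      rw [← h] at hmem
      exact (mem_bd.1 hmem).2.1 (h1 _ (by omega))
  have := key j le_rfl
  simpa using this

theorem bd_injective : Function.Injective bd := fun _ _ h =>
  Finset.Subset.antisymm (subset_of_bd_eq h) (subset_of_bd_eq h.symm)

end SOS

end

noncomputable section

namespace SOS

/-! ### Simple sets and their boundary walks -/

/-- `x` and `y` are joined by a lattice path inside `P`. -/
def Conn (P : Site → Prop) : Site → Site → Prop :=
  Relation.ReflTransGen fun a b => Adj a b ∧ P a ∧ P b

theorem Conn.symm {P : Site → Prop} {x y : Site} (h : Conn P x y) : Conn P y x := by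
  induction h with
  | refl => exact .refl
  | tail _ h ih => exact .head ⟨h.1.symm, h.2.2, h.2.1⟩ ih

theorem Conn.mono {P Q : Site → Prop} (hPQ : ∀ x, P x → Q x) {x y : Site} (h : Conn P x y) :
    Conn Q x y := by
  induction h with
  | refl => exact .refl
  | tail _ h ih => exact ih.tail ⟨h.1, hPQ _ h.2.1, hPQ _ h.2.2⟩

theorem Conn.eq_of_locally_const {α : Type*} {P : Site → Prop} {f : Site → α}
    (hf : ∀ a b, Adj a b → P a → P b → f a = f b) {x y : Site} (h : Conn P x y) : f x = f y := by
  induction h with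
  | refl => rfl
  | tail _ h ih => exact ih.trans (hf _ _ h.1 h.2.1 h.2.2)

/-- A finite set without holes that is connected. -/
structure Simple (D : Finset Site) : Prop where
  nonempty : D.Nonempty
  conn : ∀ x ∈ D, ∀ y ∈ D, Conn (· ∈ D) x y
  conn_compl : ∀ x ∉ D, ∀ y ∉ D, Conn (· ∉ D) x y

/-- `(x, d)` is a boundary edge of `D` with base point `x` and outward direction `d`. -/
def IsBd (D : Finset Site) (e : Site × Site) : Prop := e.1 ∈ D ∧ e.1 + e.2 ∉ D ∧ IsDir e.2

/-- The dual edge that follows `e` after a turn. -/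
def Turn.step : Turn → Site × Site → Site × Site
  | .S, e => (e.1 + rot e.2, e.2)
  | .L, e => (e.1, rot e.2)
  | .R, e => (e.1 + rot e.2 + e.2, -rot e.2)

/-- The turn that keeps the set `D` on the left. -/
def nextTurn (D : Finset Site) (e : Site × Site) : Turn :=
  if e.1 + rot e.2 ∉ D then .L else if e.1 + rot e.2 + e.2 ∉ D then .S else .R

/-- The boundary edge that follows `e` along the boundary of `D`. -/
def next (D : Finset Site) (e : Site × Site) : Site × Site := (nextTurn D e).step e

/-- Twice the starting point of the dual edge of `e`. -/
def tail (e : Site × Site) : Site := (2 : ℤ) • e.1 + e.2 - rot e.2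

/-- The turns of the first `p` steps along the boundary of `D`. -/
def turnWord (D : Finset Site) : ℕ → Site × Site → List Turn
  | 0, _ => []
  | p + 1, e => nextTurn D e :: turnWord D p (next D e)

theorem rot_neg (d : Site) : rot (-d) = -rot d := by ext <;> simp [rot]

theorem rot_apply (t : Turn) (d : Site) : rot (t.apply d) = t.apply (rot d) := by
  cases t <;> simp [Turn.apply, rot_neg]

theorem step_snd (t : Turn) (e : Site × Site) : (t.step e).2 = t.apply e.2 := by
  cases t <;> rfl

theorem tail_step (t : Turn) (e : Site × Site) :
    tail (t.step e) = tail e + (2 : ℤ) • rot e.2 := by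
  cases t <;> ext <;> simp [tail, Turn.step, rot] <;> ring

theorem IsBd.next {D : Finset Site} {e : Site × Site} (h : IsBd D e) : IsBd D (next D e) := by
  obtain ⟨h1, h2, h3⟩ := h
  by_cases ha : e.1 + rot e.2 ∈ D
  · by_cases hb : e.1 + rot e.2 + e.2 ∈ D
    · have : SOS.next D e = Turn.R.step e := by simp [SOS.next, nextTurn, ha, hb]
      rw [this]
      exact ⟨hb, by simpa [Turn.step, add_right_comm] using h2, h3.rot.neg⟩
    · have : SOS.next D e = Turn.S.step e := by simp [SOS.next, nextTurn, ha, hb]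
      rw [this]
      exact ⟨ha, hb, h3⟩
  · have : SOS.next D e = Turn.L.step e := by simp [SOS.next, nextTurn, ha]
    rw [this]
    exact ⟨h1, ha, h3.rot⟩

theorem IsBd.iterate {D : Finset Site} {e : Site × Site} (h : IsBd D e) (i : ℕ) :
    IsBd D ((SOS.next D)^[i] e) := by
  induction i with
  | zero => exact h
  | succ i ih => rw [Function.iterate_succ_apply']; exact ih.next

theorem tail_iterate_succ (D : Finset Site) (p : ℕ) (e : Site × Site) :
    tail ((next D)^[p + 1] e) = tail e + (2 : ℤ) • disp (turnWord D p e) (rot e.2) := by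
  induction p generalizing e with
  | zero => simp [turnWord, disp, next, tail_step]
  | succ p ih =>
    rw [Function.iterate_succ_apply, ih, turnWord, disp, next, step_snd, rot_apply, tail_step,
      smul_add, add_assoc]

theorem length_turnWord (D : Finset Site) (p : ℕ) (e : Site × Site) :
    (turnWord D p e).length = p := by
  induction p generalizing e with
  | zero => rfl
  | succ p ih => simp [turnWord, ih]

theorem turnWord_add (D : Finset Site) (m k : ℕ) (e : Site × Site) :
    turnWord D (m + k) e = turnWord D m e ++ turnWord D k ((next D)^[m] e) := by
  induction m generalizing e with
  | zero => simp [turnWord]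
  | succ m ih => rw [Nat.succ_add, turnWord, ih]; rfl

theorem exists_of_infix_turnWord {D : Finset Site} {n : ℕ} {e : Site × Site} {u : List Turn}
    (h : u <:+: turnWord D n e) :
    ∃ i p, i + p ≤ n ∧ u = turnWord D p ((next D)^[i] e) := by
  obtain ⟨a, b, h⟩ := h
  have hlen := congrArg List.length h
  simp only [List.length_append, length_turnWord] at hlen
  refine ⟨a.length, u.length, by omega, ?_⟩
  rw [← hlen, turnWord_add, turnWord_add] at h
  have h1 := List.append_inj h (by simp [length_turnWord])
  exact (List.append_inj h1.1 (by simp [length_turnWord])).2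

theorem iterate_eq_of_turnWord_eq {D D' : Finset Site} {n : ℕ} {e : Site × Site}
    (h : turnWord D n e = turnWord D' n e) {i : ℕ} (hi : i ≤ n) :
    (next D)^[i] e = (next D')^[i] e := by
  induction n generalizing e i with
  | zero =>
    have : i = 0 := by omega
    simp [this]
  | succ n ih =>
    cases i with
    | zero => rfl
    | succ i =>
      simp only [turnWord, List.cons.injEq] at h
      have hn : next D e = next D' e := by simp only [next, h.1]
      rw [Function.iterate_succ_apply, Function.iterate_succ_apply, ← hn]
      exact ih (by rw [h.2, hn]) (by omega)

/-- The contribution of a dual edge to the winding number around `x`. -/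
def wind (e : Site × Site) (x : Site) : ℤ :=
  (if e.2 = (1, 0) ∧ e.1.2 = x.2 ∧ x.1 ≤ e.1.1 then 1 else 0) -
    (if e.2 = (-1, 0) ∧ e.1.2 = x.2 ∧ x.1 < e.1.1 then 1 else 0)

/-- The indicator of the dual sites to the right of `x`, half a unit higher. -/
def rayInd (x P : Site) : ℤ := if P.2 = 2 * x.2 + 1 ∧ 2 * x.1 < P.1 then 1 else 0

theorem wind_sub_right (e : Site × Site) (x : Site) :
    wind e x - wind e (x + (1, 0)) =
      (if e = (x, (1, 0)) then 1 else 0) - (if e = (x + (1, 0), (-1, 0)) then 1 else 0) := by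
  obtain ⟨⟨a, b⟩, c, d⟩ := e
  obtain ⟨p, q⟩ := x
  simp only [wind, Prod.mk.injEq, Prod.mk_add_mk]
  split_ifs <;> omega

/-- The horizontal rays from `x` and from the site above it bound a strip. Apart from a crossing of
the edge between the two sites, a dual edge changes the count only by entering or leaving the middle
line of the strip; these `rayInd` terms telescope along a walk. Coordinates are doubled to keep dual
sites integral. -/
theorem wind_sub_up (e : Site × Site) (he : IsDir e.2) (x : Site) :
    wind e x - wind e (x + (0, 1)) =
      rayInd x (tail e + (2 : ℤ) • rot e.2) - rayInd x (tail e) +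
      ((if e = (x, (0, 1)) then 1 else 0) - (if e = (x + (0, 1), (0, -1)) then 1 else 0)) := by
  obtain ⟨⟨a, b⟩, d⟩ := e
  obtain ⟨p, q⟩ := x
  rcases he with h | h | h | h <;> simp only at h <;> subst h <;>
    norm_num [wind, rayInd, tail, rot] <;> split_ifs <;> omega

/-- The number of visits of a walk to the edge from `x` to `y`. -/
def visits (e : ℕ → Site × Site) (m : ℕ) (x y : Site) : ℤ :=
  ∑ i ∈ Finset.range m, if e i = (x, y - x) then 1 else 0

/-- A closed dual walk has a winding number around each site, and crossing an edge changes it by the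
signed number of passages of the walk. -/
theorem exists_winding (e : ℕ → Site × Site) (m : ℕ) (hdir : ∀ i, IsDir (e i).2)
    (hstep : ∀ i, tail (e (i + 1)) = tail (e i) + (2 : ℤ) • rot (e i).2)
    (hclosed : tail (e m) = tail (e 0)) :
    ∃ f : Site → ℤ, ∀ x y, Adj x y → f x - f y = visits e m x y - visits e m y x := by
  let f : Site → ℤ := fun x => ∑ i ∈ Finset.range m, wind (e i) x
  have hr : ∀ x, f x - f (x + (1, 0)) =
      visits e m x (x + (1, 0)) - visits e m (x + (1, 0)) x := by
    intro x
    simp only [f, visits, ← Finset.sum_sub_distrib]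
    refine Finset.sum_congr rfl fun i _ => ?_
    rw [wind_sub_right]
    have h1 : x + (1, 0) - x = (1, 0) := by simp
    have h2 : x - (x + (1, 0)) = (-1, 0) := by simp
    rw [h1, h2]
  have hu : ∀ x, f x - f (x + (0, 1)) =
      visits e m x (x + (0, 1)) - visits e m (x + (0, 1)) x := by
    intro x
    have htel : ∑ i ∈ Finset.range m,
        (rayInd x (tail (e i) + (2 : ℤ) • rot (e i).2) - rayInd x (tail (e i))) = 0 := by
      simp only [← hstep]
      rw [Finset.sum_range_sub (fun i => rayInd x (tail (e i))), hclosed, sub_self]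
    have key := Finset.sum_congr rfl fun i (_ : i ∈ Finset.range m) =>
      wind_sub_up (e i) (hdir i) x
    rw [Finset.sum_add_distrib, htel, zero_add] at key
    simp only [f, visits, ← Finset.sum_sub_distrib]
    rw [key]
    have h1 : x + (0, 1) - x = (0, 1) := by simp
    have h2 : x - (x + (0, 1)) = (0, -1) := by simp
    rw [h1, h2]
  refine ⟨f, fun x y hxy => ?_⟩
  obtain ⟨d, rfl⟩ : ∃ d, y = x + d := ⟨y - x, by simp⟩
  rcases isDir_iff.1 hxy with rfl | rfl | rfl | rfl
  · exact hr x
  · have := hr (x + (-1, 0))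
    have h1 : x + (-1, 0) + (1, 0) = x := by ext <;> simp
    rw [h1] at this
    linarith
  · exact hu x
  · have := hu (x + (0, -1))
    have h1 : x + (0, -1) + (0, 1) = x := by ext <;> simp
    rw [h1] at this
    linarith

theorem mem_bd_of_isBd {D : Finset Site} {e : Site × Site} (h : IsBd D e) :
    (e.1, e.1 + e.2) ∈ bd D := mem_bd.2 ⟨h.1, h.2.1, isDir_iff.2 h.2.2⟩

theorem injective_edge : Function.Injective fun e : Site × Site => (e.1, e.1 + e.2) := by
  rintro ⟨a, b⟩ ⟨c, d⟩ h
  simp only [Prod.mk.injEq] at h ⊢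
  obtain ⟨rfl, h⟩ := h
  exact ⟨rfl, add_left_cancel h⟩

/-- The boundary walk visits only outward edges of `D`, so its winding number is constant on `D` and
on the complement, both being connected. All boundary edges are therefore visited equally often. The
starting edge is visited, hence so is every other one. -/
theorem Simple.per_le_of_closed {D : Finset Site} (hD : Simple D) {m : ℕ} (hm : 0 < m)
    {e : Site × Site} (he : IsBd D e) (hc : tail ((next D)^[m] e) = tail e) : per D ≤ m := by
  obtain ⟨f, hf⟩ := exists_winding (fun i => (next D)^[i] e) m (fun i => (he.iterate i).2.2)
    (fun i => by rw [Function.iterate_succ_apply']; exact tail_step _ _) hc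
  have hv0 : ∀ x y, ¬(x ∈ D ∧ y ∉ D) → visits (fun i => (next D)^[i] e) m x y = 0 := by
    intro x y hxy
    refine Finset.sum_eq_zero fun i _ => if_neg fun h => hxy ?_
    have h1 := he.iterate i
    change (next D)^[i] e = (x, y - x) at h
    rw [h] at h1
    exact ⟨h1.1, by simpa using h1.2.1⟩
  have hin : ∀ x ∈ D, ∀ y ∈ D, f x = f y := fun x hx y hy =>
    (hD.conn x hx y hy).eq_of_locally_const fun a b hab ha hb => by
      have := hf a b hab
      rw [hv0 a b (by tauto), hv0 b a (by tauto)] at this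
      linarith
  have hout : ∀ x ∉ D, ∀ y ∉ D, f x = f y := fun x hx y hy =>
    (hD.conn_compl x hx y hy).eq_of_locally_const fun a b hab ha hb => by
      have := hf a b hab
      rw [hv0 a b (by tauto), hv0 b a (by tauto)] at this
      linarith
  have hpos : 0 < visits (fun i => (next D)^[i] e) m e.1 (e.1 + e.2) := by
    refine Finset.sum_pos' (fun i _ => by split_ifs <;> simp) ⟨0, Finset.mem_range.2 hm, ?_⟩
    simp
  have hall : ∀ x y, (x, y) ∈ bd D → 0 < visits (fun i => (next D)^[i] e) m x y := by
    intro x y hxy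
    obtain ⟨hx, hy, hadj⟩ := mem_bd.1 hxy
    have h1 := hf x y hadj
    have h2 := hf e.1 (e.1 + e.2) (isDir_iff.2 he.2.2)
    rw [hv0 y x (by tauto)] at h1
    rw [hv0 (e.1 + e.2) e.1 (by have := he.1; tauto), hin _ he.1 _ hx, hout _ he.2.1 _ hy] at h2
    linarith
  have hsub : bd D ⊆ (Finset.range m).image fun i =>
      (((next D)^[i] e).1, ((next D)^[i] e).1 + ((next D)^[i] e).2) := by
    rintro ⟨x, y⟩ hxy
    obtain ⟨i, hi, h⟩ := Finset.exists_ne_zero_of_sum_ne_zero (hall x y hxy).ne'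
    refine Finset.mem_image.2 ⟨i, hi, ?_⟩
    have h' : (next D)^[i] e = (x, y - x) := by
      by_contra hne
      simp [hne] at h
    rw [h']; simp
  exact (Finset.card_le_card hsub).trans (Finset.card_image_le.trans (by simp))

theorem Simple.tail_injOn {D : Finset Site} (hD : Simple D) {e : Site × Site} (he : IsBd D e)
    {i j : ℕ} (hij : i < j) (hj : j < per D) :
    tail ((next D)^[i] e) ≠ tail ((next D)^[j] e) := by
  intro h
  have := hD.per_le_of_closed (m := j - i) (by omega) (he.iterate i)
    (by rw [← Function.iterate_add_apply, Nat.sub_add_cancel hij.le, h])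
  omega

theorem Simple.bd_eq_image {D : Finset Site} (hD : Simple D) {e : Site × Site} (he : IsBd D e) :
    bd D = (Finset.range (per D)).image fun i =>
      (((next D)^[i] e).1, ((next D)^[i] e).1 + ((next D)^[i] e).2) := by
  refine (Finset.eq_of_subset_of_card_le ?_ ?_).symm
  · intro p hp
    obtain ⟨i, -, rfl⟩ := Finset.mem_image.1 hp
    exact mem_bd_of_isBd (he.iterate i)
  · rw [Finset.card_image_of_injOn, Finset.card_range]
    · rfl
    · intro i hi j hj hij
      have h := injective_edge hij
      simp only [Finset.coe_range, Set.mem_Iio] at hi hj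
      rcases lt_trichotomy i j with hlt | rfl | hlt
      · exact (hD.tail_injOn he hlt hj (by rw [h])).elim
      · rfl
      · exact (hD.tail_injOn he hlt hi (by rw [h])).elim

/-- A word of `p` turns describes `p + 1` steps, and a closed stretch has at least `per D` of them.
A sub-path of `m` turns has at most `m + 1 < per D` steps. -/
theorem Simple.selfAvoiding {D : Finset Site} (hD : Simple D) {e : Site × Site} (he : IsBd D e)
    {m : ℕ} (hm : per D = m + 2) : SelfAvoiding (turnWord D m e) := by
  intro u hu h0
  obtain ⟨i, p, hip, rfl⟩ := exists_of_infix_turnWord hu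
  have h1 := tail_iterate_succ D p ((next D)^[i] e)
  rw [disp_eq_zero h0, smul_zero, add_zero] at h1
  have := hD.per_le_of_closed (Nat.succ_pos p) (he.iterate i) h1
  omega

/-- The simple subsets of `Λ`. -/
def simpleSubsets (Λ : Finset Site) : Finset (Finset Site) := Λ.powerset.filter Simple

theorem mem_simpleSubsets {Λ D : Finset Site} : D ∈ simpleSubsets Λ ↔ D ⊆ Λ ∧ Simple D := by
  simp [simpleSubsets]

/-- The initial edge and `m + 1` turns list all `m + 2` boundary edges and so determine the set. The
first `m` turns are self-avoiding; the last one, which precedes the closing, is bounded by the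
factor `3`. -/
theorem card_simpleSubsets_edge_le (Λ : Finset Site) (e : Site × Site) (m : ℕ) :
    ((simpleSubsets Λ).filter fun D => IsBd D e ∧ per D = m + 2).card ≤
      (avoidingWords m).card * 3 := by
  have hcard : ((avoidingWords m).biUnion fun w =>
      ({w ++ [.S], w ++ [.L], w ++ [.R]} : Finset (List Turn))).card ≤
        (avoidingWords m).card * 3 :=
    Finset.card_biUnion_le_card_mul _ _ _ fun w _ => Finset.card_le_three
  refine le_trans (Finset.card_le_card_of_injOn (fun D => turnWord D (m + 1) e) ?_ ?_) hcard
  · intro D hD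
    simp only [Finset.coe_filter, mem_simpleSubsets, Set.mem_ofPred_eq] at hD
    simp only [Finset.coe_biUnion, Set.mem_iUnion]
    refine ⟨turnWord D m e, mem_avoidingWords.2 ⟨length_turnWord _ _ _,
      hD.1.2.selfAvoiding hD.2.1 hD.2.2⟩, ?_⟩
    rw [turnWord_add]
    have : ∀ e', turnWord D 1 e' = [nextTurn D e'] := fun _ => rfl
    rw [this]
    cases nextTurn D ((next D)^[m] e) <;> simp
  · intro D hD D' hD' h
    simp only [Finset.coe_filter, mem_simpleSubsets, Set.mem_ofPred_eq] at hD hD'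
    apply bd_injective
    rw [hD.1.2.bd_eq_image hD.2.1, hD'.1.2.bd_eq_image hD'.2.1, hD.2.2, hD'.2.2]
    refine Finset.image_congr fun i hi => ?_
    simp only [Finset.coe_range, Set.mem_Iio] at hi
    simp only [iterate_eq_of_turnWord_eq h (by omega : i ≤ m + 1)]

/-- Leaving `D` horizontally from `v` gives a starting edge for the contour, among at most `per D`
candidates. -/
theorem Simple.exists_isBd {D : Finset Site} {v : Site} (hv : v ∈ D) :
    ∃ j : ℕ, j < per D ∧ IsBd D (v + ((j : ℤ), 0), (1, 0)) := by
  obtain ⟨j, h1, h2⟩ := exists_mem_bdDir hv (d := (1, 0)) (by simp [IsDir])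
  refine ⟨j, ?_, ?_⟩
  · have hcols : j + 1 ≤ (D.image Prod.fst).card := by
      rw [← Finset.card_range (j + 1)]
      refine Finset.card_le_card_of_injOn (fun i => v.1 + (i : ℤ)) ?_ ?_
      · intro i hi
        have := h1 i (by simpa [Nat.lt_succ_iff] using hi)
        exact Finset.mem_coe.2 (Finset.mem_image.2 ⟨_, this, by simp⟩)
      · intro a _ b _ hab
        simpa using hab
    have := two_mul_rows_add_cols_le_per D
    omega
  · have := mem_bd.1 (Finset.mem_filter.1 h2).1
    refine ⟨?_, ?_, by simp [IsDir]⟩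
    · simpa using this.1
    · simpa using this.2.1

/-- The Peierls sum over simple sets around a site converges below inverse temperature one. -/
theorem exists_peierls_sum : ∃ θ S : ℝ, 3 / 4 ≤ θ ∧ θ < 1 ∧ 0 ≤ S ∧ ∀ (Λ : Finset Site) (v : Site),
    ∑ D ∈ (simpleSubsets Λ).filter (v ∈ ·), Real.exp (-θ * per D) ≤ S := by
  have hlog : Real.log (1359 / 500) < 1 := by
    rw [Real.log_lt_iff_lt_exp (by norm_num)]
    exact lt_trans (by norm_num) Real.exp_one_gt_d9
  -- Strictly between `log 2.718` and `1`: the first gap makes the series converge, the second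
  -- leaves room for later losses. The lower bound `3 / 4` later yields `κ ≤ 1 / 8`.
  set θ : ℝ := max (3 / 4) ((1 + Real.log (1359 / 500)) / 2) with hθ
  have hθ1 : θ < 1 := max_lt (by norm_num) (by linarith)
  have hθ2 : Real.log (1359 / 500) < θ := lt_of_lt_of_le (by linarith) (le_max_right _ _)
  set r : ℝ := 1359 / 500 * Real.exp (-θ) with hr
  have hr0 : 0 < r := by positivity
  have hr1 : r < 1 := by
    rw [hr, ← Real.exp_log (by norm_num : (0 : ℝ) < 1359 / 500), ← Real.exp_add]
    rw [Real.exp_lt_one_iff]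
    linarith
  set A : ℝ := 3 * turnPot [] with hA
  have hsum : Summable fun n : ℕ => A * (n * r ^ n) := by
    have := summable_pow_mul_geometric_of_norm_lt_one 1
      (by rwa [Real.norm_of_nonneg hr0.le] : ‖r‖ < 1)
    simpa using this.mul_left A
  have hnn : ∀ n : ℕ, 0 ≤ A * (n * r ^ n) := fun n => by positivity
  refine ⟨θ, ∑' n : ℕ, A * (n * r ^ n), le_max_left _ _, hθ1, tsum_nonneg hnn, fun Λ v => ?_⟩
  have hcount : ∀ n : ℕ, (((simpleSubsets Λ).filter fun D => v ∈ D ∧ per D = n).card : ℝ) ≤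
      A * (n * (1359 / 500 : ℝ) ^ n) := by
    intro n
    by_cases hn : n < 2
    · have : ((simpleSubsets Λ).filter fun D => v ∈ D ∧ per D = n) = ∅ := by
        refine Finset.filter_eq_empty_iff.2 fun D _ h => ?_
        have := four_le_per ⟨v, h.1⟩
        omega
      rw [this]
      simp only [Finset.card_empty, Nat.cast_zero]
      positivity
    · obtain ⟨m, rfl⟩ : ∃ m, n = m + 2 := ⟨n - 2, by omega⟩
      have hsub : ((simpleSubsets Λ).filter fun D => v ∈ D ∧ per D = m + 2) ⊆
          (Finset.range (m + 2)).biUnion fun j => (simpleSubsets Λ).filter fun D =>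
            IsBd D (v + ((j : ℤ), 0), (1, 0)) ∧ per D = m + 2 := by
        intro D hD
        obtain ⟨h1, h2, h3⟩ := Finset.mem_filter.1 hD
        obtain ⟨j, hj, hb⟩ := Simple.exists_isBd h2
        exact Finset.mem_biUnion.2 ⟨j, Finset.mem_range.2 (h3 ▸ hj),
          Finset.mem_filter.2 ⟨h1, hb, h3⟩⟩
      have h1 := (Finset.card_le_card hsub).trans (Finset.card_biUnion_le_card_mul _ _
        ((avoidingWords m).card * 3) fun j _ => card_simpleSubsets_edge_le Λ _ m)
      rw [Finset.card_range] at h1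
      have h2 := card_avoidingWords_le m
      calc (((simpleSubsets Λ).filter fun D => v ∈ D ∧ per D = m + 2).card : ℝ)
          ≤ ((m + 2 : ℕ) : ℝ) * ((avoidingWords m).card * 3) := by exact_mod_cast h1
        _ ≤ ((m + 2 : ℕ) : ℝ) * ((turnPot [] * (1359 / 500 : ℝ) ^ m) * 3) := by gcongr
        _ ≤ ((m + 2 : ℕ) : ℝ) * ((turnPot [] * (1359 / 500 : ℝ) ^ (m + 2)) * 3) := by
          gcongr
          · norm_num
          · omega
        _ = _ := by rw [hA]; ring
  have hfib : ∑ D ∈ (simpleSubsets Λ).filter (v ∈ ·), Real.exp (-θ * per D) =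
      ∑ n ∈ ((simpleSubsets Λ).filter (v ∈ ·)).image per,
        ∑ D ∈ ((simpleSubsets Λ).filter (v ∈ ·)).filter (per · = n), Real.exp (-θ * per D) :=
    (Finset.sum_fiberwise_of_maps_to (fun D hD => Finset.mem_image_of_mem per hD) _).symm
  rw [hfib]
  refine le_trans (Finset.sum_le_sum fun n _ => ?_) (hsum.sum_le_tsum _ fun n _ => hnn n)
  have h1 : ∑ D ∈ ((simpleSubsets Λ).filter (v ∈ ·)).filter (per · = n), Real.exp (-θ * per D) =
      (((simpleSubsets Λ).filter fun D => v ∈ D ∧ per D = n).card : ℝ) * Real.exp (-θ * n) := by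
    rw [Finset.filter_filter, ← nsmul_eq_mul, ← Finset.sum_const]
    exact Finset.sum_congr rfl fun D hD => by rw [(Finset.mem_filter.1 hD).2.2]
  rw [h1]
  calc _ ≤ A * (n * (1359 / 500 : ℝ) ^ n) * Real.exp (-θ * n) := by gcongr; exact hcount n
    _ = A * (n * r ^ n) := by
      rw [hr, mul_pow, ← Real.exp_nat_mul, mul_comm (n : ℝ) (-θ)]; ring

end SOS

end

noncomputable section

namespace SOS

/-! ### Filling holes and connected components -/

theorem Conn.trans {P : Site → Prop} {x y z : Site} (h : Conn P x y) (h' : Conn P y z) :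
    Conn P x z := Relation.ReflTransGen.trans h h'

theorem Conn.of_line {P : Site → Prop} {x d : Site} (hd : IsDir d) {j : ℕ}
    (h : ∀ i : ℕ, i ≤ j → P (x + (i : ℤ) • d)) : Conn P x (x + (j : ℤ) • d) := by
  induction j with
  | zero =>
    rw [Nat.cast_zero, zero_smul, add_zero]
    exact .refl
  | succ j ih =>
    refine (ih fun i hi => h i (by omega)).tail ⟨?_, h j (by omega), h (j + 1) le_rfl⟩
    have : x + ((j + 1 : ℕ) : ℤ) • d = x + (j : ℤ) • d + d := by
      push_cast; rw [add_smul, one_smul, add_assoc]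
    rw [this]
    exact isDir_iff.2 hd

theorem Conn.eq_or {P : Site → Prop} {x y : Site} (h : Conn P x y) : x = y ∨ P x := by
  rcases Relation.ReflTransGen.cases_head h with h | ⟨z, h, -⟩
  · exact .inl h
  · exact .inr h.2.1

theorem conn_of_high {P : Site → Prop} {M : ℤ} (h : ∀ z : Site, M < z.2 → P z) {x y : Site}
    (hx : M < x.2) (hy : M < y.2) : Conn P x y := by
  have horiz : ∀ (x : Site) (j : ℕ), M < x.2 → Conn P x (x + ((j : ℤ), 0)) := by
    intro x j hx
    have := Conn.of_line (P := P) (x := x) (d := (1, 0)) (j := j) (by simp [IsDir])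
      fun i _ => h _ (by simpa using hx)
    simpa using this
  have vert : ∀ (x : Site) (j : ℕ), M < x.2 → Conn P x (x + (0, (j : ℤ))) := by
    intro x j hx
    have := Conn.of_line (P := P) (x := x) (d := (0, 1)) (j := j) (by simp [IsDir])
      fun i _ => h _ (by simp; omega)
    simpa using this
  have horiz' : ∀ a b c : ℤ, M < c → Conn P (a, c) (b, c) := by
    intro a b c hc
    rcases le_total a b with hab | hab
    · have := horiz (a, c) (b - a).toNat hc
      simpa [Int.toNat_of_nonneg (sub_nonneg.2 hab)] using this
    · have := (horiz (b, c) (a - b).toNat hc).symm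
      simpa [Int.toNat_of_nonneg (sub_nonneg.2 hab)] using this
  have vert' : ∀ a b c : ℤ, M < b → M < c → Conn P (a, b) (a, c) := by
    intro a b c hb hc
    rcases le_total b c with hbc | hbc
    · have := vert (a, b) (c - b).toNat hb
      simpa [Int.toNat_of_nonneg (sub_nonneg.2 hbc)] using this
    · have := (vert (a, c) (b - c).toNat hc).symm
      simpa [Int.toNat_of_nonneg (sub_nonneg.2 hbc)] using this
  exact (horiz' x.1 y.1 x.2 hx).trans (vert' y.1 x.2 y.2 hx hy)

/-- `y` is joined to infinity outside `S`. -/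
def Ext (S : Finset Site) (y : Site) : Prop := ∀ M : ℤ, ∃ z : Site, M < z.2 ∧ Conn (· ∉ S) y z

theorem Ext.notMem {S : Finset Site} {y : Site} (h : Ext S y) : y ∉ S := by
  obtain ⟨z, hz, hc⟩ := h y.2
  rcases hc.eq_or with rfl | h
  · exact (lt_irrefl _ hz).elim
  · exact h

theorem Ext.mono {S S' : Finset Site} (hS : S ⊆ S') {y : Site} (h : Ext S' y) : Ext S y := by
  intro M
  obtain ⟨z, hz, hc⟩ := h M
  exact ⟨z, hz, hc.mono fun x hx hx' => hx (hS hx')⟩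

theorem Ext.of_conn {S : Finset Site} {x y : Site} (h : Ext S y) (hc : Conn (· ∉ S) x y) :
    Ext S x := fun M => by
  obtain ⟨z, hz, h'⟩ := h M
  exact ⟨z, hz, hc.trans h'⟩

/-- The set has no holes. -/
def Full (F : Finset Site) : Prop := ∀ x, x ∉ F → Ext F x

theorem Full.conn_compl {F : Finset Site} (hF : Full F) {x y : Site} (hx : x ∉ F) (hy : y ∉ F) :
    Conn (· ∉ F) x y := by
  obtain ⟨M, hM⟩ : ∃ M : ℤ, ∀ z : Site, M < z.2 → z ∉ F := by
    obtain ⟨M, hM⟩ := (F.image Prod.snd).bddAbove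
    refine ⟨M, fun z hz hzF => ?_⟩
    exact absurd (hM (Finset.mem_coe.2 (Finset.mem_image_of_mem _ hzF))) (not_le.2 hz)
  obtain ⟨z, hz, hxz⟩ := hF x hx M
  obtain ⟨w, hw, hyw⟩ := hF y hy M
  exact (hxz.trans (conn_of_high hM hz hw)).trans hyw.symm

/-- The part of `Λ` that `S` separates from infinity. -/
def fill (Λ S : Finset Site) : Finset Site := Λ.filter fun x => ¬Ext S x

theorem mem_fill {Λ S : Finset Site} {x : Site} : x ∈ fill Λ S ↔ x ∈ Λ ∧ ¬Ext S x :=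
  Finset.mem_filter

theorem fill_subset (Λ S : Finset Site) : fill Λ S ⊆ Λ := Finset.filter_subset _ _

theorem subset_fill {Λ S : Finset Site} (h : S ⊆ Λ) : S ⊆ fill Λ S :=
  fun _ hx => mem_fill.2 ⟨h hx, fun he => he.notMem hx⟩

theorem box_full (a : Site) (L : ℕ) : Full (box a L) := by
  have hup : ∀ x : Site, (x.1 ≤ a.1 ∨ a.1 + L < x.1 ∨ a.2 + L < x.2) → Ext (box a L) x := by
    intro x hx M
    obtain ⟨j, hj⟩ : ∃ j : ℕ, M < x.2 + j := ⟨(M - x.2).toNat + 1, by omega⟩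
    refine ⟨x + (j : ℤ) • ((0, 1) : Site), by simpa using hj,
      Conn.of_line (by simp [IsDir]) fun i _ => ?_⟩
    simp only [box, Finset.mem_product, Finset.mem_Icc, Prod.fst_add, Prod.snd_add, Prod.smul_fst,
      Prod.smul_snd, smul_eq_mul]
    omega
  intro x hx
  by_cases h : x.1 ≤ a.1 ∨ a.1 + L < x.1 ∨ a.2 + L < x.2
  · exact hup x h
  · have hlow : x.2 ≤ a.2 := by
      simp only [box, Finset.mem_product, Finset.mem_Icc] at hx
      omega
    obtain ⟨j, hj⟩ : ∃ j : ℕ, x.1 - j ≤ a.1 := ⟨(x.1 - a.1).toNat, by omega⟩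
    refine Ext.of_conn (y := x + (j : ℤ) • ((-1, 0) : Site)) (hup _ (.inl (by simp; omega)))
      (Conn.of_line (by simp [IsDir]) fun i _ => ?_)
    simp only [box, Finset.mem_product, Finset.mem_Icc, Prod.fst_add, Prod.snd_add, Prod.smul_fst,
      Prod.smul_snd, smul_eq_mul]
    omega

theorem notMem_fill {Λ S : Finset Site} (hΛ : Full Λ) (hS : S ⊆ Λ) {x : Site} :
    x ∉ fill Λ S ↔ Ext S x := by
  rw [mem_fill]
  constructor
  · intro h
    by_cases hx : x ∈ Λ
    · by_contra hc; exact h ⟨hx, hc⟩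
    · exact (hΛ x hx).mono hS
  · exact fun h h' => h'.2 h

/-- A site outside the filled set is joined to infinity off `S`. An inner neighbour outside `S`
would be joined too. -/
theorem bd_fill {Λ S : Finset Site} (hΛ : Full Λ) (hS : S ⊆ Λ) {x y : Site}
    (h : (x, y) ∈ bd (fill Λ S)) : x ∈ S ∧ y ∉ S := by
  obtain ⟨hx, hy, hadj⟩ := mem_bd.1 h
  have hye := (notMem_fill hΛ hS).1 hy
  refine ⟨?_, hye.notMem⟩
  by_contra hxS
  exact (mem_fill.1 hx).2 (hye.of_conn (.single ⟨hadj, hxS, hye.notMem⟩))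

theorem fill_full {Λ S : Finset Site} (hΛ : Full Λ) (hS : S ⊆ Λ) : Full (fill Λ S) := by
  intro x hx M
  have hxe := (notMem_fill hΛ hS).1 hx
  obtain ⟨z, hz, hc⟩ := hxe M
  refine ⟨z, hz, ?_⟩
  have key : Ext S z ∧ Conn (· ∉ fill Λ S) x z := by
    clear hz
    induction hc with
    | refl => exact ⟨hxe, .refl⟩
    | tail _ h ih =>
      have he := ih.1.of_conn (.single ⟨h.1.symm, h.2.2, h.2.1⟩)
      exact ⟨he, ih.2.tail ⟨h.1, (notMem_fill hΛ hS).2 ih.1, (notMem_fill hΛ hS).2 he⟩⟩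
  exact key.2

theorem fill_subset_of_full {Λ S F : Finset Site} (hF : Full F) (hS : S ⊆ F) : fill Λ S ⊆ F := by
  intro x hx
  by_contra h
  exact (mem_fill.1 hx).2 ((hF x h).mono hS)

/-- A path off `S` starting in `D` cannot cross the boundary of `D`, so it stays in a bounded set.
-/
theorem subset_fill_of_bd {Λ S D : Finset Site} (hD : D ⊆ Λ) (h : ∀ x y, (x, y) ∈ bd D → x ∈ S) :
    D ⊆ fill Λ S := by
  intro x hx
  refine mem_fill.2 ⟨hD hx, fun he => ?_⟩
  obtain ⟨M, hM⟩ := (D.image Prod.snd).bddAbove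
  obtain ⟨z, hz, hc⟩ := he M
  have : z ∈ D := by
    clear hz
    induction hc with
    | refl => exact hx
    | tail _ hab ih =>
      by_contra hb
      exact hab.2.1 (h _ _ (mem_bd.2 ⟨ih, hb, hab.1⟩))
  exact absurd (hM (Finset.mem_coe.2 (Finset.mem_image_of_mem _ this))) (not_le.2 hz)

/-- The connected component of `v` in `X`. -/
def comp (X : Finset Site) (v : Site) : Finset Site := X.filter (Conn (· ∈ X) v)

theorem mem_comp {X : Finset Site} {v x : Site} : x ∈ comp X v ↔ x ∈ X ∧ Conn (· ∈ X) v x :=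
  Finset.mem_filter

theorem comp_subset (X : Finset Site) (v : Site) : comp X v ⊆ X := Finset.filter_subset _ _

theorem mem_comp_self {X : Finset Site} {v : Site} (hv : v ∈ X) : v ∈ comp X v :=
  mem_comp.2 ⟨hv, .refl⟩

theorem mem_comp_of_adj {X : Finset Site} {v x y : Site} (hx : x ∈ comp X v) (hy : y ∈ X)
    (h : Adj x y) : y ∈ comp X v :=
  mem_comp.2 ⟨hy, (mem_comp.1 hx).2.tail ⟨h, (mem_comp.1 hx).1, hy⟩⟩

theorem bd_comp_subset (X : Finset Site) (v : Site) : bd (comp X v) ⊆ bd X := by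
  rintro ⟨x, y⟩ h
  obtain ⟨hx, hy, hadj⟩ := mem_bd.1 h
  exact mem_bd.2 ⟨comp_subset _ _ hx, fun hyX => hy (mem_comp_of_adj hx hyX hadj), hadj⟩

/-- From a site of `X` outside `Y`, walk right until `X` is left. The walk cannot enter `Y` on the
way, since `Y` is closed under adjacency in `X`; outside `X` the fullness of `X` takes over. -/
theorem full_of_closed {X Y : Finset Site} (hX : Full X) (hY : Y ⊆ X)
    (h : ∀ x ∈ Y, ∀ y ∈ X, Adj x y → y ∈ Y) : Full Y := by
  intro x hx
  by_cases hxX : x ∈ X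
  · obtain ⟨j, h1, h2⟩ := exists_exit hxX (d := (1, 0)) (by simp [IsDir])
    have hnot : ∀ i : ℕ, i ≤ j + 1 → x + (i : ℤ) • ((1, 0) : Site) ∉ Y := by
      intro i
      induction i with
      | zero => intro _; simpa using hx
      | succ i ih =>
        intro hi hc
        refine ih (by omega) (h _ hc _ (h1 i (by omega)) ?_)
        have : x + (i : ℤ) • ((1, 0) : Site) =
            x + ((i + 1 : ℕ) : ℤ) • ((1, 0) : Site) + (-1, 0) := by
          ext
          · simp; ring
          · simp
        rw [this]
        exact isDir_iff.2 (by simp [IsDir])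
    refine Ext.of_conn (((hX _ h2)).mono hY) ?_
    have := Conn.of_line (P := (· ∉ Y)) (x := x) (d := (1, 0)) (j := j + 1) (by simp [IsDir]) hnot
    exact_mod_cast this
  · exact (hX x hxX).mono hY

theorem simple_comp {X : Finset Site} (hX : Full X) {v : Site} (hv : v ∈ X) :
    Simple (comp X v) := by
  have hfull : Full (comp X v) := full_of_closed hX (comp_subset X v)
    fun x hx y hy h => mem_comp_of_adj hx hy h
  have hconn : ∀ x ∈ comp X v, Conn (· ∈ comp X v) v x := by
    intro x hx
    have hc := (mem_comp.1 hx).2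
    clear hx
    induction hc with
    | refl => exact .refl
    | tail hab h ih =>
      exact ih.tail ⟨h.1, mem_comp.2 ⟨h.2.1, hab⟩, mem_comp.2 ⟨h.2.2, Conn.trans hab (.single h)⟩⟩
  exact ⟨⟨v, mem_comp_self hv⟩, fun x hx y hy => (hconn x hx).symm.trans (hconn y hy),
    fun x hx y hy => hfull.conn_compl hx hy⟩

theorem comp_eq_of_mem {X : Finset Site} {v x : Site} (hx : x ∈ comp X v) : comp X v = comp X x := by
  have h := (mem_comp.1 hx).2
  ext y
  simp only [mem_comp]
  exact ⟨fun hy => ⟨hy.1, h.symm.trans hy.2⟩, fun hy => ⟨hy.1, h.trans hy.2⟩⟩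

/-- The connected components of `X`. -/
def comps (X : Finset Site) : Finset (Finset Site) := X.image (comp X)

theorem mem_comps {X D : Finset Site} : D ∈ comps X ↔ ∃ v ∈ X, comp X v = D := Finset.mem_image

theorem eq_of_mem_comps {X D D' : Finset Site} (hD : D ∈ comps X) (hD' : D' ∈ comps X) {x : Site}
    (hx : x ∈ D) (hx' : x ∈ D') : D = D' := by
  obtain ⟨v, -, rfl⟩ := mem_comps.1 hD
  obtain ⟨w, -, rfl⟩ := mem_comps.1 hD'
  rw [comp_eq_of_mem hx, comp_eq_of_mem hx']

theorem comps_subset_simpleSubsets {Λ X : Finset Site} (hX : Full X) (h : X ⊆ Λ) :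
    comps X ⊆ simpleSubsets Λ := by
  intro D hD
  obtain ⟨v, hv, rfl⟩ := mem_comps.1 hD
  exact mem_simpleSubsets.2 ⟨(comp_subset _ _).trans h, simple_comp hX hv⟩

theorem biUnion_comps (X : Finset Site) : (comps X).biUnion id = X := by
  ext x
  simp only [Finset.mem_biUnion, id]
  constructor
  · rintro ⟨D, hD, hx⟩
    obtain ⟨v, -, rfl⟩ := mem_comps.1 hD
    exact comp_subset _ _ hx
  · exact fun hx => ⟨comp X x, mem_comps.2 ⟨x, hx, rfl⟩, mem_comp_self hx⟩

theorem card_eq_sum_comps (X : Finset Site) : X.card = ∑ D ∈ comps X, D.card := by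
  conv_lhs => rw [← biUnion_comps X]
  refine Finset.card_biUnion fun D hD D' hD' hne => ?_
  change Disjoint D D'
  rw [Finset.disjoint_left]
  exact fun x hx hx' => hne (eq_of_mem_comps hD hD' hx hx')

section Subfamily

variable {X : Finset Site} {T : Finset (Finset Site)}

theorem biUnion_subset_of_subset_comps (hT : T ⊆ comps X) : T.biUnion id ⊆ X := by
  conv_rhs => rw [← biUnion_comps X]
  exact Finset.biUnion_subset_biUnion_of_subset_left _ hT

theorem bd_biUnion_subset (hT : T ⊆ comps X) : bd (T.biUnion id) ⊆ bd X := by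
  rintro ⟨x, y⟩ h
  obtain ⟨hx, hy, hadj⟩ := mem_bd.1 h
  obtain ⟨D, hD, hxD⟩ := Finset.mem_biUnion.1 hx
  obtain ⟨v, hv, rfl⟩ := mem_comps.1 (hT hD)
  refine bd_comp_subset X v (mem_bd.2 ⟨hxD, fun hyD => hy ?_, hadj⟩)
  exact Finset.mem_biUnion.2 ⟨_, hD, hyD⟩

theorem bd_biUnion (hT : T ⊆ comps X) : bd (T.biUnion id) = T.biUnion bd := by
  ext ⟨x, y⟩
  simp only [mem_bd, Finset.mem_biUnion, id]
  constructor
  · rintro ⟨⟨D, hD, hx⟩, hy, hadj⟩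
    exact ⟨D, hD, hx, fun h => hy ⟨D, hD, h⟩, hadj⟩
  · rintro ⟨D, hD, hx, hy, hadj⟩
    refine ⟨⟨D, hD, hx⟩, ?_, hadj⟩
    rintro ⟨D', hD', hy'⟩
    obtain ⟨v, -, rfl⟩ := mem_comps.1 (hT hD)
    obtain ⟨w, -, rfl⟩ := mem_comps.1 (hT hD')
    exact hy (mem_comp_of_adj hx (comp_subset _ _ hy') hadj)

theorem per_biUnion (hT : T ⊆ comps X) : per (T.biUnion id) = ∑ D ∈ T, per D := by
  unfold per
  rw [bd_biUnion hT]
  refine Finset.card_biUnion fun D hD D' hD' hne => ?_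
  change Disjoint (bd D) (bd D')
  rw [Finset.disjoint_left]
  rintro ⟨x, y⟩ h h'
  exact hne (eq_of_mem_comps (hT hD) (hT hD') (mem_bd.1 h).1 (mem_bd.1 h').1)

theorem full_biUnion (hX : Full X) (hT : T ⊆ comps X) : Full (T.biUnion id) := by
  refine full_of_closed hX (biUnion_subset_of_subset_comps hT) fun x hx y hy hadj => ?_
  obtain ⟨D, hD, hxD⟩ := Finset.mem_biUnion.1 hx
  obtain ⟨v, hv, rfl⟩ := mem_comps.1 (hT hD)
  exact Finset.mem_biUnion.2 ⟨_, hD, mem_comp_of_adj hxD hy hadj⟩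

end Subfamily

end SOS

end

noncomputable section

namespace SOS

/-! ### Sums over nested chains of simple sets -/

theorem simpleSubsets_mono {Λ Λ' : Finset Site} (h : Λ ⊆ Λ') :
    simpleSubsets Λ ⊆ simpleSubsets Λ' := fun _ hD =>
  mem_simpleSubsets.2 ⟨(mem_simpleSubsets.1 hD).1.trans h, (mem_simpleSubsets.1 hD).2⟩

/-- The simple subsets of `Y` that contain `v`. -/
def simpleAt (v : Site) (Y : Finset Site) : Finset (Finset Site) :=
  (simpleSubsets Y).filter (v ∈ ·)

theorem mem_simpleAt {v : Site} {Y D : Finset Site} :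
    D ∈ simpleAt v Y ↔ (D ⊆ Y ∧ Simple D) ∧ v ∈ D := by
  simp [simpleAt, mem_simpleSubsets]

/-- The total weight of the chains `Y ⊇ D₁ ⊇ ⋯ ⊇ D_q ∋ v` of simple sets. -/
def chainSum (θ : ℝ) (v : Site) : ℕ → Finset Site → ℝ
  | 0, _ => 1
  | q + 1, Y => ∑ D ∈ simpleAt v Y, Real.exp (-θ * per D) * chainSum θ v q D

theorem chainSum_nonneg (θ : ℝ) (v : Site) (q : ℕ) (Y : Finset Site) : 0 ≤ chainSum θ v q Y := by
  induction q generalizing Y with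
  | zero => exact zero_le_one
  | succ q ih => exact Finset.sum_nonneg fun D _ => mul_nonneg (Real.exp_pos _).le (ih D)

/-- Remove a set `M` of maximal cardinality. It lies in no other member, so the other terms do not
change, and `y M * (1 - y M)⁻¹ = (1 - y M)⁻¹ - 1` makes the sum telescope. -/
theorem sum_mul_prod_subset_le (A : Finset (Finset Site)) (y : Finset Site → ℝ)
    (h0 : ∀ D ∈ A, 0 ≤ y D) (h1 : ∀ D ∈ A, y D < 1) :
    ∑ D ∈ A, y D * ∏ D' ∈ A.filter (· ⊆ D), (1 - y D')⁻¹ ≤ ∏ D ∈ A, (1 - y D)⁻¹ - 1 := by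
  revert h0 h1
  refine Finset.induction_on_max_value Finset.card A ?_ ?_
  · simp
  · intro M A hM hmax ih h0 h1
    have h0' : ∀ D ∈ A, 0 ≤ y D := fun D hD => h0 D (Finset.mem_insert_of_mem hD)
    have h1' : ∀ D ∈ A, y D < 1 := fun D hD => h1 D (Finset.mem_insert_of_mem hD)
    have hy0 := h0 M (Finset.mem_insert_self _ _)
    have hy1 := h1 M (Finset.mem_insert_self _ _)
    have hinv : ∀ D ∈ A, 1 ≤ (1 - y D)⁻¹ := fun D hD => by
      have := h0' D hD
      have := h1' D hD
      exact (one_le_inv₀ (by linarith)).2 (by linarith)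
    have hM1 : ∏ D' ∈ (insert M A).filter (· ⊆ M), (1 - y D')⁻¹ ≤
        (1 - y M)⁻¹ * ∏ D ∈ A, (1 - y D)⁻¹ := by
      rw [Finset.filter_insert, if_pos Finset.Subset.rfl, Finset.prod_insert (by simp [hM])]
      have hinvM : 0 ≤ (1 - y M)⁻¹ := inv_nonneg.2 (by linarith)
      refine mul_le_mul_of_nonneg_left ?_ hinvM
      refine Finset.prod_le_prod_of_subset_of_one_le (Finset.filter_subset _ _) ?_ ?_
      · exact fun D hD => zero_le_one.trans (hinv D (Finset.mem_filter.1 hD).1)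
      · exact fun D hD _ => hinv D hD
    have hrest : ∑ D ∈ A, y D * ∏ D' ∈ (insert M A).filter (· ⊆ D), (1 - y D')⁻¹ =
        ∑ D ∈ A, y D * ∏ D' ∈ A.filter (· ⊆ D), (1 - y D')⁻¹ := by
      refine Finset.sum_congr rfl fun D hD => ?_
      rw [Finset.filter_insert, if_neg]
      intro hsub
      exact hM (Finset.eq_of_subset_of_card_le hsub (hmax D hD) ▸ hD)
    rw [Finset.sum_insert hM, Finset.prod_insert hM, hrest]
    have h2 : y M * ∏ D' ∈ (insert M A).filter (· ⊆ M), (1 - y D')⁻¹ ≤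
        y M * ((1 - y M)⁻¹ * ∏ D ∈ A, (1 - y D)⁻¹) := mul_le_mul_of_nonneg_left hM1 hy0
    have h3 : y M * (1 - y M)⁻¹ = (1 - y M)⁻¹ - 1 := by
      have : (1 - y M) ≠ 0 := by linarith
      field_simp
      ring
    have h4 := ih h0' h1'
    rw [← mul_assoc, h3] at h2
    linarith

/-- Normalise each step by the weight `exp (-4θ)` of the single site. A set other than `{v}` then
has weight below one, and its repetitions in the chain form a geometric series, whence one factor
per set, independently of `q`. -/
theorem chainSum_le_prod {θ : ℝ} (hθ : 0 < θ) (v : Site) (q : ℕ) (Y : Finset Site) :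
    chainSum θ v q Y ≤ Real.exp (-4 * θ * q) *
      ∏ D ∈ (simpleAt v Y).erase {v}, (1 - Real.exp (-θ * (per D - 4)))⁻¹ := by
  set y : Finset Site → ℝ := fun D => Real.exp (-θ * (per D - 4)) with hy
  have hy0 : ∀ D, 0 ≤ y D := fun D => (Real.exp_pos _).le
  have hy1 : ∀ D ∈ (simpleAt v Y).erase {v}, y D < 1 := by
    intro D hD
    obtain ⟨hne, hD⟩ := Finset.mem_erase.1 hD
    have h6 : (6 : ℝ) ≤ per D := by exact_mod_cast six_le_per (mem_simpleAt.1 hD).2 hne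
    rw [hy]
    simp only [Real.exp_lt_one_iff]
    nlinarith
  induction q generalizing Y with
  | zero =>
    simp only [chainSum, Nat.cast_zero, mul_zero, Real.exp_zero, one_mul]
    refine Finset.prod_induction _ (fun r : ℝ => 1 ≤ r) (fun a b ha hb => one_le_mul_of_one_le_of_one_le ha hb)
      le_rfl fun D hD => ?_
    exact (one_le_inv₀ (by linarith [hy1 D hD])).2 (by linarith [hy0 D])
  | succ q ih =>
    have hsub : ∀ D ∈ simpleAt v Y, (simpleAt v D).erase {v} =
        ((simpleAt v Y).erase {v}).filter (· ⊆ D) := by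
      intro D hD
      have hD' := (mem_simpleAt.1 hD).1.1
      ext D'
      simp only [Finset.mem_erase, mem_simpleAt, Finset.mem_filter]
      constructor
      · rintro ⟨h1, ⟨h2, h3⟩, h4⟩; exact ⟨⟨h1, ⟨h2.trans hD', h3⟩, h4⟩, h2⟩
      · rintro ⟨⟨h1, ⟨h2, h3⟩, h4⟩, h5⟩; exact ⟨h1, ⟨h5, h3⟩, h4⟩
    have hterm : ∀ D ∈ simpleAt v Y, Real.exp (-θ * per D) * chainSum θ v q D ≤
        Real.exp (-4 * θ * (q + 1 : ℕ)) *
          (y D * ∏ D' ∈ ((simpleAt v Y).erase {v}).filter (· ⊆ D), (1 - y D')⁻¹) := by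
      intro D hD
      have h1 := ih D fun D' hD' => hy1 D' (by
        rw [hsub D hD] at hD'; exact (Finset.mem_filter.1 hD').1)
      rw [hsub D hD] at h1
      refine (mul_le_mul_of_nonneg_left h1 (Real.exp_pos _).le).trans (le_of_eq ?_)
      rw [← mul_assoc, ← mul_assoc, ← Real.exp_add, hy, ← Real.exp_add]
      congr 2
      push_cast
      ring
    have hv4 : per {v} = 4 := by
      unfold per
      have : bd {v} = (nbrs v).image fun y => (v, y) := by
        ext ⟨a, b⟩
        simp only [mem_bd, Finset.mem_singleton, Finset.mem_image, mem_nbrs, Prod.mk.injEq]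
        constructor
        · rintro ⟨rfl, h2, h3⟩; exact ⟨b, h3, rfl, rfl⟩
        · rintro ⟨c, h, rfl, rfl⟩; exact ⟨rfl, h.ne.symm, h⟩
      rw [this, Finset.card_image_of_injective _ fun a b h => by simpa using h]
      obtain ⟨a, b⟩ := v
      simp only [nbrs]
      rw [Finset.card_insert_of_notMem, Finset.card_insert_of_notMem,
        Finset.card_insert_of_notMem, Finset.card_singleton] <;>
        simp [Prod.ext_iff] <;> omega
    have hyv : y {v} = 1 := by simp [hy, hv4]
    have hmain := sum_mul_prod_subset_le ((simpleAt v Y).erase {v}) y (fun D _ => hy0 D) hy1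
    have hsingle : ((simpleAt v Y).erase {v}).filter (· ⊆ ({v} : Finset Site)) = ∅ := by
      refine Finset.filter_eq_empty_iff.2 fun D hD hsub => ?_
      obtain ⟨hne, hD⟩ := Finset.mem_erase.1 hD
      exact hne (Finset.Subset.antisymm hsub (by simpa using (mem_simpleAt.1 hD).2))
    rw [chainSum]
    refine (Finset.sum_le_sum hterm).trans ?_
    rw [← Finset.mul_sum]
    refine mul_le_mul_of_nonneg_left ?_ (Real.exp_pos _).le
    change _ ≤ ∏ D ∈ (simpleAt v Y).erase {v}, (1 - y D)⁻¹
    by_cases hmem : ({v} : Finset Site) ∈ simpleAt v Y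
    · rw [← Finset.add_sum_erase _ _ hmem, hyv, hsingle, Finset.prod_empty]
      linarith
    · rw [Finset.erase_eq_of_notMem hmem] at hmain ⊢
      linarith

/-- Chains of simple sets have the weight of chains of single sites, up to a constant. -/
theorem exists_chainSum_le : ∃ θ₀ C₀ : ℝ, 3 / 4 ≤ θ₀ ∧ θ₀ < 1 ∧ 1 ≤ C₀ ∧
    ∀ θ, θ₀ ≤ θ → ∀ (v : Site) (q : ℕ) (Y : Finset Site),
      chainSum θ v q Y ≤ C₀ * Real.exp (-4 * θ * q) := by
  obtain ⟨θ₀, S, h34, h1, hS0, hS⟩ := exists_peierls_sum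
  -- Sets other than `{v}` have perimeter at least `6`, so `δ` bounds all denominators below. The
  -- infinite product is then controlled by the Peierls sum at `θ₀`.
  set δ : ℝ := 1 - Real.exp (-2 * θ₀) with hδ
  have hδ0 : 0 < δ := by
    have : Real.exp (-2 * θ₀) < 1 := by rw [Real.exp_lt_one_iff]; linarith
    linarith
  refine ⟨θ₀, Real.exp (S * Real.exp (4 * θ₀) / δ), h34, h1, Real.one_le_exp (by positivity), ?_⟩
  intro θ hθ v q Y
  refine (chainSum_le_prod (by linarith) v q Y).trans ?_
  rw [mul_comm]
  refine mul_le_mul_of_nonneg_right ?_ (Real.exp_pos _).le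
  have hfac : ∀ D ∈ (simpleAt v Y).erase {v}, (1 - Real.exp (-θ * (per D - 4)))⁻¹ ≤
      Real.exp (Real.exp (4 * θ₀) / δ * Real.exp (-θ₀ * per D)) := by
    intro D hD
    obtain ⟨hne, hD⟩ := Finset.mem_erase.1 hD
    have h6 : (6 : ℝ) ≤ per D := by exact_mod_cast six_le_per (mem_simpleAt.1 hD).2 hne
    set y := Real.exp (-θ * (per D - 4)) with hy
    have hy1 : y ≤ Real.exp (-2 * θ₀) := Real.exp_le_exp.2 (by nlinarith)
    have hy2 : y ≤ Real.exp (4 * θ₀) * Real.exp (-θ₀ * per D) := by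
      rw [← Real.exp_add]; exact Real.exp_le_exp.2 (by nlinarith)
    have hy0 : 0 < y := Real.exp_pos _
    have hd : δ ≤ 1 - y := by linarith
    have hpos : 0 < 1 - y := by linarith
    have h2 : (1 - y)⁻¹ = y / (1 - y) + 1 := by field_simp; ring
    rw [h2]
    refine (Real.add_one_le_exp _).trans (Real.exp_le_exp.2 ?_)
    calc y / (1 - y) ≤ y / δ := by gcongr
      _ ≤ Real.exp (4 * θ₀) * Real.exp (-θ₀ * per D) / δ := by gcongr
      _ = _ := by ring
  have hnn : ∀ D ∈ (simpleAt v Y).erase {v}, 0 ≤ (1 - Real.exp (-θ * (per D - 4)))⁻¹ := by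
    intro D hD
    obtain ⟨hne, hD⟩ := Finset.mem_erase.1 hD
    have h6 : (6 : ℝ) ≤ per D := by exact_mod_cast six_le_per (mem_simpleAt.1 hD).2 hne
    have : Real.exp (-θ * (per D - 4)) < 1 := by rw [Real.exp_lt_one_iff]; nlinarith
    exact inv_nonneg.2 (by linarith)
  refine (Finset.prod_le_prod hnn hfac).trans ?_
  rw [← Real.exp_sum, ← Finset.mul_sum]
  refine Real.exp_le_exp.2 ?_
  have h3 : ∑ D ∈ (simpleAt v Y).erase {v}, Real.exp (-θ₀ * per D) ≤ S :=
    (Finset.sum_le_sum_of_subset_of_nonneg (Finset.erase_subset _ _)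
      fun _ _ _ => (Real.exp_pos _).le).trans (hS Y v)
  calc _ ≤ Real.exp (4 * θ₀) / δ * S := by gcongr
    _ = _ := by ring

end SOS

end

noncomputable section

namespace SOS

/-! ### Height functions on the whole lattice, their energy and the measure without ceiling -/

/-- A box together with its external boundary. -/
def hull (Λ : Finset Site) : Finset Site := Λ ∪ extBoundary Λ

theorem mem_hull_of_adj {Λ : Finset Site} {x y : Site} (hx : x ∈ Λ) (h : Adj x y) :
    y ∈ hull Λ := by
  by_cases hy : y ∈ Λ
  · exact Finset.mem_union_left _ hy
  · exact Finset.mem_union_right _ ((mem_extBoundary _ _).2 ⟨hy, x, hx, h⟩)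

/-- The energy of a height function on the lattice. -/
def energy (Λ : Finset Site) (η : Site → ℤ) : ℝ :=
  (1 / 2 : ℝ) * ∑ x ∈ hull Λ, ∑ y ∈ hull Λ, if Adj x y then |(η x : ℝ) - (η y : ℝ)| else 0

/-- Extension of a configuration by zero. -/
def extend {Λ : Finset Site} {n : ℕ} (η : Config Λ n) (x : Site) : ℤ :=
  if h : x ∈ Λ then height η ⟨x, h⟩ else 0

theorem extend_coe {Λ : Finset Site} {n : ℕ} (η : Config Λ n) (x : Λ) :
    extend η x = height η x := by simp [extend]

theorem extend_of_notMem {Λ : Finset Site} {n : ℕ} (η : Config Λ n) {x : Site} (h : x ∉ Λ) :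
    extend η x = 0 := by simp [extend, h]

theorem extend_injective {Λ : Finset Site} {n : ℕ} :
    Function.Injective (extend : Config Λ n → Site → ℤ) := by
  intro η η' h
  funext x
  have := congrFun h x
  rw [extend_coe, extend_coe, height, height] at this
  exact Fin.ext (by exact_mod_cast this)

theorem energy_extend {Λ : Finset Site} {n : ℕ} (η : Config Λ n) :
    energy Λ (extend η) = hamiltonian Λ (fun _ => 0) (height η) := by
  have hdisj : Disjoint Λ (extBoundary Λ) := by
    rw [Finset.disjoint_left]
    exact fun x hx hx' => ((mem_extBoundary _ _).1 hx').1 hx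
  have h1 : (∑ x : Λ, ∑ y : Λ, if Adj x y then |(height η x : ℝ) - (height η y : ℝ)| else 0) =
      ∑ x ∈ Λ, ∑ y ∈ Λ, if Adj x y then |(extend η x : ℝ) - (extend η y : ℝ)| else 0 := by
    rw [← Finset.sum_coe_sort Λ]
    refine Finset.sum_congr rfl fun x _ => ?_
    rw [← Finset.sum_coe_sort Λ]
    simp only [extend_coe]
  have h2 : (∑ x : Λ, ∑ y ∈ extBoundary Λ,
        if Adj x y then |(height η x : ℝ) - (((fun _ => 0 : Site → ℤ) y : ℤ) : ℝ)| else 0) =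
      ∑ x ∈ Λ, ∑ y ∈ extBoundary Λ,
        if Adj x y then |(extend η x : ℝ) - (extend η y : ℝ)| else 0 := by
    rw [← Finset.sum_coe_sort Λ]
    refine Finset.sum_congr rfl fun x _ => Finset.sum_congr rfl fun y hy => ?_
    rw [extend_coe, extend_of_notMem η ((mem_extBoundary _ _).1 hy).1]
  have h3 : (∑ x ∈ extBoundary Λ, ∑ y ∈ Λ,
        if Adj x y then |(extend η x : ℝ) - (extend η y : ℝ)| else 0) =
      ∑ x ∈ Λ, ∑ y ∈ extBoundary Λ,
        if Adj x y then |(extend η x : ℝ) - (extend η y : ℝ)| else 0 := by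
    rw [Finset.sum_comm]
    refine Finset.sum_congr rfl fun x _ => Finset.sum_congr rfl fun y _ => ?_
    rw [abs_sub_comm]
    exact if_congr ⟨Adj.symm, Adj.symm⟩ rfl rfl
  have h4 : (∑ x ∈ extBoundary Λ, ∑ y ∈ extBoundary Λ,
        if Adj x y then |(extend η x : ℝ) - (extend η y : ℝ)| else 0) = 0 := by
    refine Finset.sum_eq_zero fun x hx => Finset.sum_eq_zero fun y hy => ?_
    rw [extend_of_notMem η ((mem_extBoundary _ _).1 hx).1,
      extend_of_notMem η ((mem_extBoundary _ _).1 hy).1]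
    simp
  rw [hamiltonian, h1, h2, energy, hull]
  simp only [Finset.sum_union hdisj, Finset.sum_add_distrib]
  rw [h3, h4]
  ring

/-- The height functions with floor `0` and ceiling `N` that vanish outside `Λ`. -/
def confs (Λ : Finset Site) (N : ℕ) : Finset (Site → ℤ) :=
  (Finset.univ : Finset (Config Λ N)).image extend

theorem mem_confs {Λ : Finset Site} {N : ℕ} {η : Site → ℤ} :
    η ∈ confs Λ N ↔ (∀ x, x ∉ Λ → η x = 0) ∧ ∀ x, 0 ≤ η x ∧ η x ≤ N := by
  simp only [confs, Finset.mem_image, Finset.mem_univ, true_and]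
  constructor
  · rintro ⟨ζ, rfl⟩
    refine ⟨fun x hx => extend_of_notMem ζ hx, fun x => ?_⟩
    by_cases hx : x ∈ Λ
    · have := (ζ ⟨x, hx⟩).is_lt
      simp only [extend, hx, dif_pos, height]
      omega
    · rw [extend_of_notMem ζ hx]; simp
  · rintro ⟨h1, h2⟩
    refine ⟨fun x => ⟨(η x).toNat, by have := h2 x; omega⟩, ?_⟩
    funext x
    by_cases hx : x ∈ Λ
    · simp only [extend, hx, dif_pos, height]
      exact Int.toNat_of_nonneg (h2 x).1
    · rw [extend_of_notMem _ hx, h1 x hx]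

theorem confs_mono {Λ : Finset Site} {N M : ℕ} (h : N ≤ M) : confs Λ N ⊆ confs Λ M := by
  intro η hη
  rw [mem_confs] at hη ⊢
  exact ⟨hη.1, fun x => ⟨(hη.2 x).1, (hη.2 x).2.trans (by exact_mod_cast h)⟩⟩

theorem energy_nonneg (Λ : Finset Site) (η : Site → ℤ) : 0 ≤ energy Λ η := by
  refine mul_nonneg (by norm_num) (Finset.sum_nonneg fun x _ => Finset.sum_nonneg fun y _ => ?_)
  split_ifs <;> positivity

theorem energy_add_le (Λ : Finset Site) (η g : Site → ℤ) :
    energy Λ (η + g) ≤ energy Λ η + energy Λ g := by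
  unfold energy
  rw [← mul_add, ← Finset.sum_add_distrib]
  refine mul_le_mul_of_nonneg_left (Finset.sum_le_sum fun x _ => ?_) (by norm_num)
  rw [← Finset.sum_add_distrib]
  refine Finset.sum_le_sum fun y _ => ?_
  split_ifs
  · have h : ((η + g) x : ℝ) - ((η + g) y : ℝ) = (η x - η y : ℝ) + (g x - g y : ℝ) := by
      simp only [Pi.add_apply]; push_cast; ring
    rw [h]
    exact abs_add_le _ _
  · simp

/-- Submodularity of the gradient energy, which is the lattice condition behind every use of FKG
below. -/
theorem energy_inf_add_energy_sup_le (Λ : Finset Site) (η ζ : Site → ℤ) :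
    energy Λ (η ⊓ ζ) + energy Λ (η ⊔ ζ) ≤ energy Λ η + energy Λ ζ := by
  unfold energy
  rw [← mul_add, ← mul_add, ← Finset.sum_add_distrib, ← Finset.sum_add_distrib]
  refine mul_le_mul_of_nonneg_left (Finset.sum_le_sum fun x _ => ?_) (by norm_num)
  rw [← Finset.sum_add_distrib, ← Finset.sum_add_distrib]
  refine Finset.sum_le_sum fun y _ => ?_
  split_ifs
  · simp only [Pi.inf_apply, Pi.sup_apply, Int.cast_min, Int.cast_max]
    generalize (η x : ℝ) = a
    generalize (η y : ℝ) = b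
    generalize (ζ x : ℝ) = c
    generalize (ζ y : ℝ) = d
    rcases le_total a c with h1 | h1 <;> rcases le_total b d with h2 | h2 <;>
      simp only [min_eq_left h1, min_eq_right h1, max_eq_left h1, max_eq_right h1,
        min_eq_left h2, min_eq_right h2, max_eq_left h2, max_eq_right h2]
    · exact le_rfl
    · rcases abs_cases (a - d) with h | h <;> rcases abs_cases (c - b) with h' | h' <;>
      rcases abs_cases (a - b) with h3 | h3 <;> rcases abs_cases (c - d) with h4 | h4 <;>
      linarith
    · rcases abs_cases (c - b) with h | h <;> rcases abs_cases (a - d) with h' | h' <;>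
      rcases abs_cases (a - b) with h3 | h3 <;> rcases abs_cases (c - d) with h4 | h4 <;>
      linarith
    · linarith
  · simp

/-- The indicator function of a finite set. -/
def ind (D : Finset Site) (x : Site) : ℤ := if x ∈ D then 1 else 0

theorem sum_bd_eq_per {Λ D : Finset Site} (hD : D ⊆ Λ) :
    ∑ x ∈ hull Λ, ∑ y ∈ hull Λ, (if (x, y) ∈ bd D then (1 : ℝ) else 0) = per D := by
  rw [← Finset.sum_product', Finset.sum_boole, per]
  congr 2
  ext ⟨x, y⟩
  simp only [Finset.mem_filter, Finset.mem_product, and_iff_right_iff_imp]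
  intro h
  obtain ⟨hx, -, hadj⟩ := mem_bd.1 h
  exact ⟨Finset.mem_union_left _ (hD hx), mem_hull_of_adj (hD hx) hadj⟩

theorem sum_bd_swap_eq_per {Λ D : Finset Site} (hD : D ⊆ Λ) :
    ∑ x ∈ hull Λ, ∑ y ∈ hull Λ, (if (y, x) ∈ bd D then (1 : ℝ) else 0) = per D := by
  rw [Finset.sum_comm]; exact sum_bd_eq_per hD

theorem energy_eq_sub_of_bd {Λ D : Finset Site} (hD : D ⊆ Λ) {η ζ : Site → ℤ} {c : ℝ}
    (h : ∀ x y, Adj x y → |(ζ x : ℝ) - ζ y| = |(η x : ℝ) - η y| -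
      c * ((if (x, y) ∈ bd D then 1 else 0) + (if (y, x) ∈ bd D then 1 else 0))) :
    energy Λ ζ = energy Λ η - c * per D := by
  have h1 : ∀ x y, (if Adj x y then |(ζ x : ℝ) - ζ y| else 0) =
      (if Adj x y then |(η x : ℝ) - η y| else 0) -
        c * ((if (x, y) ∈ bd D then 1 else 0) + (if (y, x) ∈ bd D then 1 else 0)) := by
    intro x y
    by_cases hadj : Adj x y
    · rw [if_pos hadj, if_pos hadj, h x y hadj]
    · rw [if_neg hadj, if_neg hadj, if_neg fun hb => hadj (mem_bd.1 hb).2.2,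
        if_neg fun hb => hadj (mem_bd.1 hb).2.2.symm]
      simp
  unfold energy
  simp only [h1, Finset.sum_sub_distrib, ← Finset.mul_sum, Finset.sum_add_distrib]
  rw [sum_bd_eq_per hD, sum_bd_swap_eq_per hD]
  ring

theorem energy_sub_ind {Λ D : Finset Site} (hD : D ⊆ Λ) {η : Site → ℤ}
    (h : ∀ x y, (x, y) ∈ bd D → η y < η x) :
    energy Λ (η + -ind D) = energy Λ η - per D := by
  have := energy_eq_sub_of_bd hD (η := η) (ζ := η + -ind D) (c := 1) fun x y hadj => ?_
  · simpa using this
  have hxy : (x, y) ∈ bd D ↔ x ∈ D ∧ y ∉ D := by rw [mem_bd]; tauto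
  have hyx : (y, x) ∈ bd D ↔ y ∈ D ∧ x ∉ D := by rw [mem_bd]; have := hadj.symm; tauto
  have h1 := h x y
  have h2 := h y x
  simp only [hxy, hyx] at h1 h2 ⊢
  by_cases hx : x ∈ D <;> by_cases hy : y ∈ D <;> simp [ind, hx, hy]
  · have : (η y : ℝ) + 1 ≤ η x := by exact_mod_cast h1 ⟨hx, hy⟩
    rw [abs_of_nonneg (by linarith), abs_of_nonneg (by linarith)]; ring
  · have : (η x : ℝ) + 1 ≤ η y := by exact_mod_cast h2 ⟨hy, hx⟩
    rw [abs_of_nonpos (by linarith), abs_of_nonpos (by linarith)]; ring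

theorem energy_neg (Λ : Finset Site) (η : Site → ℤ) : energy Λ (-η) = energy Λ η := by
  unfold energy
  congr 1
  refine Finset.sum_congr rfl fun x _ => Finset.sum_congr rfl fun y _ => ?_
  have : ((-η) x : ℝ) - ((-η) y : ℝ) = -((η x : ℝ) - η y) := by
    simp only [Pi.neg_apply, Int.cast_neg]; ring
  rw [this, abs_neg]

theorem energy_add_ind {Λ D : Finset Site} (hD : D ⊆ Λ) {η : Site → ℤ}
    (h : ∀ x y, (x, y) ∈ bd D → η x < η y) :
    energy Λ (η + ind D) = energy Λ η - per D := by
  rw [← energy_neg Λ η, ← energy_neg Λ (η + ind D), neg_add]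
  exact energy_sub_ind hD fun x y hxy => by simpa using h x y hxy

theorem energy_smul_ind {Λ D : Finset Site} (hD : D ⊆ Λ) (c : ℤ) :
    energy Λ (fun x => c * ind D x) = |(c : ℝ)| * per D := by
  have h0 : energy Λ (fun _ => 0) = 0 := by simp [energy]
  have := energy_eq_sub_of_bd hD (η := fun _ => 0) (ζ := fun x => c * ind D x) (c := -|(c : ℝ)|)
    fun x y hadj => ?_
  · rw [this, h0]; ring
  have hxy : (x, y) ∈ bd D ↔ x ∈ D ∧ y ∉ D := by rw [mem_bd]; tauto
  have hyx : (y, x) ∈ bd D ↔ y ∈ D ∧ x ∉ D := by rw [mem_bd]; have := hadj.symm; tauto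
  simp only [hxy, hyx]
  by_cases hx : x ∈ D <;> by_cases hy : y ∈ D <;> simp [ind, hx, hy]

/-- Telescope the height along the horizontal line from `x` until it leaves `Λ`, where the height is
zero. -/
theorem abs_le_two_mul_energy {Λ : Finset Site} {η : Site → ℤ} (h0 : ∀ x, x ∉ Λ → η x = 0)
    (x : Site) : |(η x : ℝ)| ≤ 2 * energy Λ η := by
  by_cases hx : x ∈ Λ
  swap
  · rw [h0 x hx]; simpa using energy_nonneg Λ η
  obtain ⟨j, h1, h2⟩ := exists_exit hx (d := (1, 0)) (by simp [IsDir])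
  set d : Site := (1, 0) with hd
  have hdir : IsDir d := by simp [IsDir, hd]
  have hpt : ∀ i : ℕ, x + (i : ℤ) • d + d = x + ((i + 1 : ℕ) : ℤ) • d := by
    intro i; push_cast; rw [add_smul, one_smul, add_assoc]
  have htel : (η x : ℝ) = ∑ i ∈ Finset.range (j + 1),
      ((η (x + (i : ℤ) • d) : ℝ) - η (x + (i : ℤ) • d + d)) := by
    simp only [hpt]
    rw [Finset.sum_range_sub' (fun i : ℕ => (η (x + (i : ℤ) • d) : ℝ))]
    have : η (x + ((j + 1 : ℕ) : ℤ) • d) = 0 := h0 _ (by exact_mod_cast h2)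
    rw [this]; simp
  have hinj : Set.InjOn (fun i : ℕ => x + (i : ℤ) • d) (Finset.range (j + 1)) := by
    intro a _ b _ hab
    have : (a : ℤ) • d = (b : ℤ) • d := by simpa using hab
    exact_mod_cast smul_left_injective ℤ hdir.ne_zero this
  have hterm : ∀ z ∈ Λ, |(η z : ℝ) - η (z + d)| ≤
      ∑ y ∈ hull Λ, if Adj z y then |(η z : ℝ) - (η y : ℝ)| else 0 := by
    intro z hz
    have hadj : Adj z (z + d) := isDir_iff.2 hdir
    refine le_trans ?_ (Finset.single_le_sum (f := fun y => if Adj z y then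
      |(η z : ℝ) - (η y : ℝ)| else 0) (fun y _ => by split_ifs <;> positivity)
      (mem_hull_of_adj hz hadj))
    simp [hadj]
  have hnn : ∀ z, 0 ≤ ∑ y ∈ hull Λ, if Adj z y then |(η z : ℝ) - (η y : ℝ)| else 0 :=
    fun z => Finset.sum_nonneg fun y _ => by split_ifs <;> positivity
  calc |(η x : ℝ)| ≤ ∑ i ∈ Finset.range (j + 1),
        |(η (x + (i : ℤ) • d) : ℝ) - η (x + (i : ℤ) • d + d)| := by
        conv_lhs => rw [htel]
        exact Finset.abs_sum_le_sum_abs _ _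
    _ = ∑ z ∈ (Finset.range (j + 1)).image (fun i : ℕ => x + (i : ℤ) • d),
        |(η z : ℝ) - η (z + d)| :=
        (Finset.sum_image (f := fun z => |(η z : ℝ) - η (z + d)|) hinj).symm
    _ ≤ ∑ z ∈ (Finset.range (j + 1)).image (fun i : ℕ => x + (i : ℤ) • d),
        ∑ y ∈ hull Λ, (if Adj z y then |(η z : ℝ) - (η y : ℝ)| else 0) := by
        refine Finset.sum_le_sum fun z hz => ?_
        obtain ⟨i, hi, rfl⟩ := Finset.mem_image.1 hz
        exact hterm _ (h1 i (by have := Finset.mem_range.1 hi; omega))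
    _ ≤ ∑ z ∈ hull Λ, ∑ y ∈ hull Λ, (if Adj z y then |(η z : ℝ) - (η y : ℝ)| else 0) := by
        refine Finset.sum_le_sum_of_subset_of_nonneg ?_ fun z _ _ => hnn z
        intro z hz
        obtain ⟨i, hi, rfl⟩ := Finset.mem_image.1 hz
        exact Finset.mem_union_left _ (h1 i (by have := Finset.mem_range.1 hi; omega))
    _ = 2 * energy Λ η := by unfold energy; ring

/-- The Boltzmann weight of a height function. -/
def wt (β : ℝ) (Λ : Finset Site) (η : Site → ℤ) : ℝ := Real.exp (-β * energy Λ η)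

theorem wt_pos (β : ℝ) (Λ : Finset Site) (η : Site → ℤ) : 0 < wt β Λ η := Real.exp_pos _

/-- The total weight of an event with ceiling `N`. -/
def WN (β : ℝ) (Λ : Finset Site) (N : ℕ) (P : (Site → ℤ) → Prop) : ℝ :=
  ∑ η ∈ (confs Λ N).filter P, wt β Λ η

/-- The total weight of an event without ceiling. -/
def W (β : ℝ) (Λ : Finset Site) (P : (Site → ℤ) → Prop) : ℝ := ⨆ N, WN β Λ N P

section Measure

variable {β : ℝ} {Λ : Finset Site}

theorem WN_nonneg (N : ℕ) (P : (Site → ℤ) → Prop) : 0 ≤ WN β Λ N P :=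
  Finset.sum_nonneg fun _ _ => (wt_pos _ _ _).le

theorem WN_mono {N M : ℕ} (h : N ≤ M) {P Q : (Site → ℤ) → Prop}
    (hPQ : ∀ η ∈ confs Λ N, P η → Q η) : WN β Λ N P ≤ WN β Λ M Q := by
  refine Finset.sum_le_sum_of_subset_of_nonneg ?_ fun _ _ _ => (wt_pos _ _ _).le
  intro η hη
  rw [Finset.mem_filter] at hη ⊢
  exact ⟨confs_mono h hη.1, hPQ η hη.1 hη.2⟩

/-- The energy dominates every single height, hence also their average, so the weight is at most a
product of geometric weights over the sites. This makes the supremum over ceilings finite. -/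
theorem exists_WN_le (hβ : 0 < β) (Λ : Finset Site) :
    ∃ B : ℝ, ∀ N P, WN β Λ N P ≤ B := by
  set ρ : ℝ := Real.exp (-(β / (2 * (Λ.card + 1)))) with hρ
  have hρ0 : 0 < ρ := Real.exp_pos _
  have hρ1 : ρ < 1 := by rw [hρ, Real.exp_lt_one_iff]; simp only [Left.neg_neg_iff]; positivity
  refine ⟨∏ _x : Λ, (1 - ρ)⁻¹, fun N P => ?_⟩
  have h1 : WN β Λ N P ≤ ∑ η ∈ confs Λ N, wt β Λ η :=
    Finset.sum_le_sum_of_subset_of_nonneg (Finset.filter_subset _ _) fun _ _ _ => (wt_pos _ _ _).le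
  refine h1.trans ?_
  rw [confs, Finset.sum_image fun a _ b _ h => extend_injective h]
  have h2 : ∀ η : Config Λ N, wt β Λ (extend η) ≤ ∏ x : Λ, ρ ^ (η x : ℕ) := by
    intro η
    have h3 : ∀ x : Λ, ((η x : ℕ) : ℝ) ≤ 2 * energy Λ (extend η) := by
      intro x
      have := abs_le_two_mul_energy (Λ := Λ) (η := extend η)
        (fun x hx => extend_of_notMem η hx) x
      rw [extend_coe, height] at this
      simpa using this
    have h4 : ∑ x : Λ, ((η x : ℕ) : ℝ) ≤ (Λ.card + 1) * (2 * energy Λ (extend η)) := by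
      refine (Finset.sum_le_sum fun x _ => h3 x).trans ?_
      rw [Finset.sum_const, nsmul_eq_mul, Finset.card_univ, Fintype.card_coe]
      have := energy_nonneg Λ (extend η)
      nlinarith
    have h5 : ∏ x : Λ, ρ ^ (η x : ℕ) =
        Real.exp (-(β / (2 * (Λ.card + 1))) * ∑ x : Λ, ((η x : ℕ) : ℝ)) := by
      rw [Finset.mul_sum, Real.exp_sum]
      refine Finset.prod_congr rfl fun x _ => ?_
      rw [hρ, ← Real.exp_nat_mul, mul_comm]
    rw [h5, wt]
    refine Real.exp_le_exp.2 ?_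
    have h6 : β / (2 * (Λ.card + 1)) * ∑ x : Λ, ((η x : ℕ) : ℝ) ≤
        β / (2 * (Λ.card + 1)) * ((Λ.card + 1) * (2 * energy Λ (extend η))) := by gcongr
    have h7 : β / (2 * (Λ.card + 1)) * ((Λ.card + 1) * (2 * energy Λ (extend η))) =
        β * energy Λ (extend η) := by field_simp
    linarith
  refine (Finset.sum_le_sum fun η _ => h2 η).trans ?_
  have h8 : ∑ η : Config Λ N, ∏ x : Λ, ρ ^ (η x : ℕ) =
      ∏ _x : Λ, ∑ i : Fin (N + 1), ρ ^ (i : ℕ) := by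
    rw [Finset.prod_univ_sum, Fintype.piFinset_univ]
  rw [h8]
  refine Finset.prod_le_prod (fun _ _ => Finset.sum_nonneg fun _ _ => by positivity) fun _ _ => ?_
  rw [Fin.sum_univ_eq_sum_range (fun i => ρ ^ i), ← tsum_geometric_of_lt_one hρ0.le hρ1]
  exact (summable_geometric_of_lt_one hρ0.le hρ1).sum_le_tsum _ fun _ _ => by positivity

theorem bddAbove_WN (hβ : 0 < β) (P : (Site → ℤ) → Prop) :
    BddAbove (Set.range fun N => WN β Λ N P) := by
  obtain ⟨B, hB⟩ := exists_WN_le hβ Λ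
  exact ⟨B, by rintro _ ⟨N, rfl⟩; exact hB N P⟩

theorem WN_le_W (hβ : 0 < β) (N : ℕ) (P : (Site → ℤ) → Prop) : WN β Λ N P ≤ W β Λ P :=
  le_ciSup (bddAbove_WN hβ P) N

theorem W_le {P : (Site → ℤ) → Prop} {c : ℝ} (h : ∀ N, WN β Λ N P ≤ c) : W β Λ P ≤ c :=
  ciSup_le h

theorem W_nonneg (P : (Site → ℤ) → Prop) : 0 ≤ W β Λ P :=
  Real.iSup_nonneg fun N => WN_nonneg N P

theorem tendsto_WN (hβ : 0 < β) (P : (Site → ℤ) → Prop) :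
    Filter.Tendsto (fun N => WN β Λ N P) Filter.atTop (nhds (W β Λ P)) :=
  tendsto_atTop_ciSup (fun _ _ h => WN_mono h fun _ _ hP => hP) (bddAbove_WN hβ P)

theorem W_pos (hβ : 0 < β) : 0 < W β Λ fun _ => True := by
  refine lt_of_lt_of_le ?_ (WN_le_W hβ 0 _)
  refine Finset.sum_pos (fun _ _ => wt_pos _ _ _) ⟨fun _ => 0, ?_⟩
  simp [mem_confs]

theorem W_mono (hβ : 0 < β) {P Q : (Site → ℤ) → Prop} (h : ∀ N, ∀ η ∈ confs Λ N, P η → Q η) :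
    W β Λ P ≤ W β Λ Q :=
  W_le fun N => (WN_mono le_rfl (h N)).trans (WN_le_W hβ N Q)

theorem WN_le_sum {ι : Type*} (s : Finset ι) {N : ℕ} {P : (Site → ℤ) → Prop}
    {Q : ι → (Site → ℤ) → Prop} (h : ∀ η ∈ confs Λ N, P η → ∃ i ∈ s, Q i η) :
    WN β Λ N P ≤ ∑ i ∈ s, WN β Λ N (Q i) := by
  unfold WN
  refine le_trans (Finset.sum_le_sum_of_subset_of_nonneg
    (t := s.biUnion fun i => (confs Λ N).filter (Q i)) ?_ fun _ _ _ => (wt_pos _ _ _).le)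
    (sum_biUnion_le _ _ fun _ => (wt_pos _ _ _).le)
  intro η hη
  obtain ⟨hη, hP⟩ := Finset.mem_filter.1 hη
  obtain ⟨i, hi, hQ⟩ := h η hη hP
  exact Finset.mem_biUnion.2 ⟨i, hi, Finset.mem_filter.2 ⟨hη, hQ⟩⟩

theorem W_le_sum (hβ : 0 < β) {ι : Type*} (s : Finset ι) {P : (Site → ℤ) → Prop}
    {Q : ι → (Site → ℤ) → Prop} (h : ∀ N, ∀ η ∈ confs Λ N, P η → ∃ i ∈ s, Q i η) :
    W β Λ P ≤ ∑ i ∈ s, W β Λ (Q i) :=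
  W_le fun N => (WN_le_sum s (h N)).trans (Finset.sum_le_sum fun i _ => WN_le_W hβ N (Q i))

theorem W_le_add (hβ : 0 < β) {P Q R : (Site → ℤ) → Prop} (h : ∀ η, P η → Q η ∨ R η) :
    W β Λ P ≤ W β Λ Q + W β Λ R := by
  have := W_le_sum (Λ := Λ) hβ (Finset.univ : Finset Bool) (P := P)
    (Q := fun b => cond b Q R) fun N η _ hP => by
      rcases h η hP with h | h
      · exact ⟨true, by simp, h⟩
      · exact ⟨false, by simp, h⟩
  simpa using this

/-- Adding a fixed `g` is injective. This is why a contour is always fixed, by a union bound, before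
the surface is shifted along it. -/
theorem WN_le_of_shift (hβ : 0 ≤ β) {N M : ℕ} {P Q : (Site → ℤ) → Prop} (g : Site → ℤ) (c : ℝ)
    (h : ∀ η ∈ confs Λ N, P η → η + g ∈ confs Λ M ∧ Q (η + g) ∧
      energy Λ (η + g) ≤ energy Λ η - c) :
    WN β Λ N P ≤ Real.exp (-β * c) * WN β Λ M Q := by
  unfold WN
  rw [Finset.mul_sum]
  calc ∑ η ∈ (confs Λ N).filter P, wt β Λ η
      ≤ ∑ η ∈ (confs Λ N).filter P, Real.exp (-β * c) * wt β Λ (η + g) := by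
        refine Finset.sum_le_sum fun η hη => ?_
        obtain ⟨hη, hP⟩ := Finset.mem_filter.1 hη
        rw [wt, wt, ← Real.exp_add]
        refine Real.exp_le_exp.2 ?_
        have := mul_le_mul_of_nonneg_left (h η hη hP).2.2 hβ
        linarith
    _ = ∑ ζ ∈ ((confs Λ N).filter P).image (· + g), Real.exp (-β * c) * wt β Λ ζ := by
        rw [Finset.sum_image fun a _ b _ hab => add_right_cancel hab]
    _ ≤ _ := by
        refine Finset.sum_le_sum_of_subset_of_nonneg ?_ fun _ _ _ =>
          mul_nonneg (Real.exp_pos _).le (wt_pos _ _ _).le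
        intro ζ hζ
        obtain ⟨η, hη, rfl⟩ := Finset.mem_image.1 hζ
        obtain ⟨hη, hP⟩ := Finset.mem_filter.1 hη
        exact Finset.mem_filter.2 ⟨(h η hη hP).1, (h η hη hP).2.1⟩

theorem W_le_of_shift (hβ : 0 < β) {P Q : (Site → ℤ) → Prop} (g : Site → ℤ) (c : ℝ)
    (h : ∀ N, ∀ η ∈ confs Λ N, P η → η + g ∈ confs Λ (N + 1) ∧ Q (η + g) ∧
      energy Λ (η + g) ≤ energy Λ η - c) :
    W β Λ P ≤ Real.exp (-β * c) * W β Λ Q :=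
  W_le fun N => (WN_le_of_shift hβ.le g c (h N)).trans
    (mul_le_mul_of_nonneg_left (WN_le_W hβ _ Q) (Real.exp_pos _).le)

theorem wt_mul_wt_le (hβ : 0 ≤ β) (η ζ : Site → ℤ) :
    wt β Λ η * wt β Λ ζ ≤ wt β Λ (η ⊓ ζ) * wt β Λ (η ⊔ ζ) := by
  unfold wt
  rw [← Real.exp_add, ← Real.exp_add]
  refine Real.exp_le_exp.2 ?_
  have := mul_le_mul_of_nonneg_left (energy_inf_add_energy_sup_le Λ η ζ) hβ
  linarith

/-- The four functions theorem. Two different ceilings are admissible because minima respect the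
lower one and maxima the higher one. -/
theorem WN_mul_WN_le (hβ : 0 ≤ β) {N M : ℕ} (hNM : N ≤ M) {P Q R S : (Site → ℤ) → Prop}
    (h : ∀ η ζ, P η → Q ζ → R (η ⊓ ζ) ∧ S (η ⊔ ζ)) :
    WN β Λ N P * WN β Λ M Q ≤ WN β Λ N R * WN β Λ M S := by
  have h4 := four_functions_theorem (wt β Λ) (wt β Λ) (wt β Λ) (wt β Λ)
    (fun _ => (wt_pos _ _ _).le) (fun _ => (wt_pos _ _ _).le) (fun _ => (wt_pos _ _ _).le)
    (fun _ => (wt_pos _ _ _).le) (wt_mul_wt_le hβ) ((confs Λ N).filter P) ((confs Λ M).filter Q)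
  refine h4.trans (mul_le_mul ?_ ?_ (Finset.sum_nonneg fun _ _ => (wt_pos _ _ _).le)
    (WN_nonneg _ _))
  · refine Finset.sum_le_sum_of_subset_of_nonneg ?_ fun _ _ _ => (wt_pos _ _ _).le
    intro ξ hξ
    obtain ⟨η, hη, ζ, hζ, rfl⟩ := Finset.mem_infs.1 hξ
    obtain ⟨hη, hP⟩ := Finset.mem_filter.1 hη
    obtain ⟨hζ, hQ⟩ := Finset.mem_filter.1 hζ
    rw [mem_confs] at hη hζ
    refine Finset.mem_filter.2 ⟨mem_confs.2 ⟨fun x hx => ?_, fun x => ?_⟩, (h η ζ hP hQ).1⟩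
    · simp [hη.1 x hx, hζ.1 x hx]
    · exact ⟨le_inf (hη.2 x).1 (hζ.2 x).1, inf_le_left.trans (hη.2 x).2⟩
  · refine Finset.sum_le_sum_of_subset_of_nonneg ?_ fun _ _ _ => (wt_pos _ _ _).le
    intro ξ hξ
    obtain ⟨η, hη, ζ, hζ, rfl⟩ := Finset.mem_sups.1 hξ
    obtain ⟨hη, hP⟩ := Finset.mem_filter.1 hη
    obtain ⟨hζ, hQ⟩ := Finset.mem_filter.1 hζ
    rw [mem_confs] at hη hζ
    refine Finset.mem_filter.2 ⟨mem_confs.2 ⟨fun x hx => ?_, fun x => ?_⟩, (h η ζ hP hQ).2⟩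
    · simp [hη.1 x hx, hζ.1 x hx]
    · exact ⟨(hη.2 x).1.trans le_sup_left,
        sup_le ((hη.2 x).2.trans (by exact_mod_cast hNM)) (hζ.2 x).2⟩

theorem W_mul_W_le (hβ : 0 < β) {P Q R S : (Site → ℤ) → Prop}
    (h : ∀ η ζ, P η → Q ζ → R (η ⊓ ζ) ∧ S (η ⊔ ζ)) :
    W β Λ P * W β Λ Q ≤ W β Λ R * W β Λ S :=
  le_of_tendsto_of_tendsto' ((tendsto_WN hβ P).mul (tendsto_WN hβ Q))
    ((tendsto_WN hβ R).mul (tendsto_WN hβ S)) fun _ => WN_mul_WN_le hβ.le le_rfl h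

/-- Raising the ceiling increases the probability of increasing events. -/
theorem WN_mul_W_le (hβ : 0 < β) (N : ℕ) {P : (Site → ℤ) → Prop}
    (hP : ∀ η ζ, P η → η ≤ ζ → P ζ) :
    WN β Λ N P * W β Λ (fun _ => True) ≤ WN β Λ N (fun _ => True) * W β Λ P := by
  refine le_of_tendsto_of_tendsto ((tendsto_WN hβ _).const_mul _) ((tendsto_WN hβ _).const_mul _) ?_
  filter_upwards [Filter.eventually_ge_atTop N] with M hM
  exact WN_mul_WN_le hβ.le hM fun η ζ h _ => ⟨trivial, hP η _ h le_sup_left⟩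

theorem partitionFn_eq (β : ℝ) (Λ : Finset Site) (n : ℕ) :
    partitionFn β Λ n (fun _ => 0) = WN β Λ n fun _ => True := by
  unfold partitionFn WN weight wt
  rw [Finset.filter_true, confs, Finset.sum_image fun a _ b _ h => extend_injective h]
  simp only [energy_extend]

theorem gibbsProb_eq (β : ℝ) (Λ : Finset Site) (n : ℕ) (P : (Site → ℤ) → Prop) :
    gibbsProb β Λ n (fun _ => 0) {η | P (extend η)} =
      WN β Λ n P / WN β Λ n fun _ => True := by
  have hP : WN β Λ n P = ∑ η : Config Λ n, if P (extend η) then wt β Λ (extend η) else 0 := by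
    rw [WN, Finset.sum_filter, confs, Finset.sum_image fun a _ b _ h => extend_injective h]
  unfold gibbsProb
  rw [partitionFn_eq, hP, Finset.sum_div]
  refine Finset.sum_congr rfl fun η _ => ?_
  simp only [Set.mem_ofPred_eq, weight, wt, energy_extend, ite_div, zero_div]

theorem WN_true_pos (β : ℝ) (Λ : Finset Site) (n : ℕ) : 0 < WN β Λ n fun _ => True := by
  rw [← partitionFn_eq]; exact partitionFn_pos _ _ _ _

end Measure

end SOS

end

noncomputable section

namespace SOS

/-! ### Downward spikes inside a contour -/

/-- The boundary of `F` is a contour at height `ℓ`. -/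
def Jump (F : Finset Site) (ℓ : ℤ) (η : Site → ℤ) : Prop :=
  ∀ x y, (x, y) ∈ bd F → ℓ ≤ η x ∧ η y ≤ ℓ - 1

/-- The sites of `F` enclosed by heights at most `j`. -/
def lowFill (Λ F : Finset Site) (j : ℤ) (η : Site → ℤ) : Finset Site :=
  fill Λ (F.filter fun x => η x ≤ j)

variable {β : ℝ} {Λ F : Finset Site} {v : Site}

theorem mem_confs_add_ind {N : ℕ} {η : Site → ℤ} {D : Finset Site} (hD : D ⊆ Λ)
    (hη : η ∈ confs Λ N) : η + ind D ∈ confs Λ (N + 1) := by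
  rw [mem_confs] at hη ⊢
  refine ⟨fun x hx => ?_, fun x => ?_⟩
  · have : x ∉ D := fun h => hx (hD h)
    simp [ind, this, hη.1 x hx]
  · have := hη.2 x
    simp only [ind, Pi.add_apply]
    split_ifs <;> push_cast <;> omega

theorem Jump.add_ind {ℓ : ℤ} {η : Site → ℤ} {D : Finset Site} (hD : D ⊆ F) (h : Jump F ℓ η) :
    Jump F ℓ (η + ind D) := by
  intro x y hxy
  have h1 := h x y hxy
  have h2 : y ∉ D := fun hy => (mem_bd.1 hxy).2.1 (hD hy)
  simp only [ind, Pi.add_apply, h2, if_false]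
  split_ifs <;> omega

/-- Split according to the component `D` of `v` in the filled low set. Heights jump up across its
boundary, so raising `D` by one gains `per D`, and afterwards the boundary of `D` has heights at
most `j + 1`. -/
theorem W_subset_lowFill_le (hβ : 0 < β) (hΛ : Full Λ) (hF : Full F) (hFΛ : F ⊆ Λ) {ℓ j : ℤ}
    (hj : j < ℓ) {Y : Finset Site} (hv : v ∈ Y) (hY : ∀ x ∈ Y, Conn (· ∈ Y) v x) :
    W β Λ (fun η => Jump F ℓ η ∧ Y ⊆ lowFill Λ F j η) ≤
      ∑ D ∈ (simpleAt v F).filter (Y ⊆ ·), Real.exp (-β * per D) *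
        W β Λ (fun η => Jump F ℓ η ∧ D ⊆ lowFill Λ F (j + 1) η) := by
  have hS : ∀ η : Site → ℤ, (F.filter fun x => η x ≤ j) ⊆ Λ := fun η =>
    (Finset.filter_subset _ _).trans hFΛ
  refine (W_le_sum hβ ((simpleAt v F).filter (Y ⊆ ·)) (Q := fun D η => Jump F ℓ η ∧
    comp (lowFill Λ F j η) v = D) fun N η _ h => ?_).trans (Finset.sum_le_sum fun D hD => ?_)
  · refine ⟨_, Finset.mem_filter.2 ⟨mem_simpleAt.2 ⟨⟨(comp_subset _ _).trans
      (fill_subset_of_full hF (Finset.filter_subset _ _)),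
      simple_comp (fill_full hΛ (hS η)) (h.2 hv)⟩, mem_comp_self (h.2 hv)⟩, ?_⟩, h.1, rfl⟩
    exact fun x hx => mem_comp.2 ⟨h.2 hx, (hY x hx).mono fun z hz => h.2 hz⟩
  · obtain ⟨⟨hDF, -⟩, -⟩ := mem_simpleAt.1 (Finset.mem_filter.1 hD).1
    refine W_le_of_shift hβ (ind D) _ fun N η hη h => ?_
    obtain ⟨hJ, hcomp⟩ := h
    have hbd : ∀ x y, (x, y) ∈ bd D → η x ≤ j ∧ j < η y := by
      intro x y hxy
      have h1 := bd_fill hΛ (hS η) (bd_comp_subset _ _ (hcomp ▸ hxy))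
      simp only [Finset.mem_filter] at h1
      refine ⟨h1.1.2, ?_⟩
      by_contra hy
      -- An outer neighbour as low as `j` would lie outside `F`, but the contour keeps the inner
      -- boundary of `F` at height at least `ℓ > j`.
      have hyF : y ∉ F := fun hyF => h1.2 ⟨hyF, not_lt.1 hy⟩
      have := (hJ x y (mem_bd.2 ⟨h1.1.1, hyF, (mem_bd.1 hxy).2.2⟩)).1
      omega
    refine ⟨mem_confs_add_ind (hDF.trans hFΛ) hη, ⟨hJ.add_ind hDF, ?_⟩,
      (energy_add_ind (hDF.trans hFΛ) fun x y hxy => ?_).le⟩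
    · refine subset_fill_of_bd (hDF.trans hFΛ) fun x y hxy => Finset.mem_filter.2 ⟨?_, ?_⟩
      · exact hDF (mem_bd.1 hxy).1
      · have := (hbd x y hxy).1
        simp only [ind, Pi.add_apply, (mem_bd.1 hxy).1, if_true]
        omega
    · have := hbd x y hxy
      omega

/-- Iterating the previous bound from height `0` upwards produces increasing sets; exchanging the
order of summation collects all but the outermost into `chainSum`. -/
theorem W_jump_spike_le_sum (hβ : 0 < β) (hΛ : Full Λ) (hF : Full F) (hFΛ : F ⊆ Λ) {ℓ : ℤ}
    (hv : v ∈ F) (m : ℕ) (hm : (m : ℤ) < ℓ) :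
    W β Λ (fun η => Jump F ℓ η ∧ η v ≤ 0) ≤
      ∑ D ∈ simpleAt v F, Real.exp (-β * per D) * chainSum β v m D *
        W β Λ (fun η => Jump F ℓ η ∧ D ⊆ lowFill Λ F (m + 1) η) := by
  induction m with
  | zero =>
    have h1 : W β Λ (fun η => Jump F ℓ η ∧ η v ≤ 0) ≤
        W β Λ (fun η => Jump F ℓ η ∧ {v} ⊆ lowFill Λ F 0 η) := by
      refine W_mono hβ fun N η _ h => ⟨h.1, ?_⟩
      rw [Finset.singleton_subset_iff]
      exact subset_fill ((Finset.filter_subset _ _).trans hFΛ) (Finset.mem_filter.2 ⟨hv, h.2⟩)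
    refine h1.trans ((W_subset_lowFill_le hβ hΛ hF hFΛ (by simpa using hm)
      (Finset.mem_singleton_self v) fun x hx => ?_).trans ?_)
    · rw [Finset.mem_singleton.1 hx]; exact .refl
    · rw [Finset.filter_true_of_mem fun D hD =>
        Finset.singleton_subset_iff.2 (mem_simpleAt.1 hD).2]
      simp [chainSum]
  | succ m ih =>
    refine (ih (by push_cast at hm; omega)).trans ?_
    calc _ ≤ ∑ D ∈ simpleAt v F, Real.exp (-β * per D) * chainSum β v m D *
          ∑ D' ∈ (simpleAt v F).filter (D ⊆ ·), Real.exp (-β * per D') *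
            W β Λ (fun η => Jump F ℓ η ∧ D' ⊆ lowFill Λ F (m + 1 + 1) η) := by
          refine Finset.sum_le_sum fun D hD => mul_le_mul_of_nonneg_left ?_
            (mul_nonneg (Real.exp_pos _).le (chainSum_nonneg _ _ _ _))
          obtain ⟨⟨-, hs⟩, hvD⟩ := mem_simpleAt.1 hD
          exact W_subset_lowFill_le hβ hΛ hF hFΛ (by exact_mod_cast hm) hvD
            fun x hx => hs.conn v hvD x hx
      _ = ∑ D' ∈ simpleAt v F, ∑ D ∈ (simpleAt v F).filter (· ⊆ D'),
            Real.exp (-β * per D) * chainSum β v m D * (Real.exp (-β * per D') *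
            W β Λ (fun η => Jump F ℓ η ∧ D' ⊆ lowFill Λ F (m + 1 + 1) η)) := by
          simp only [Finset.mul_sum, Finset.sum_filter, mul_ite, mul_zero]
          rw [Finset.sum_comm]
      _ = _ := by
          refine Finset.sum_congr rfl fun D' hD' => ?_
          have : (simpleAt v F).filter (· ⊆ D') = simpleAt v D' := by
            ext D
            have := (mem_simpleAt.1 hD').1.1
            simp only [Finset.mem_filter, mem_simpleAt]
            exact ⟨fun h => ⟨⟨h.2, h.1.1.2⟩, h.1.2⟩,
              fun h => ⟨⟨⟨h.1.1.trans this, h.1.2⟩, h.2⟩, h.1.1⟩⟩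
          rw [this, ← Finset.sum_mul, chainSum]
          push_cast
          ring

theorem W_jump_spike_le (hβ : 0 < β) (hΛ : Full Λ) (hF : Full F) (hFΛ : F ⊆ Λ) {ℓ : ℤ}
    (hv : v ∈ F) (b : ℕ) (hb : (b : ℤ) ≤ ℓ) :
    W β Λ (fun η => Jump F ℓ η ∧ η v ≤ 0) ≤ chainSum β v b F * W β Λ (Jump F ℓ) := by
  cases b with
  | zero => rw [chainSum, one_mul]; exact W_mono hβ fun _ _ _ h => h.1
  | succ m =>
    refine (W_jump_spike_le_sum hβ hΛ hF hFΛ hv m (by push_cast at hb; omega)).trans ?_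
    rw [chainSum, Finset.sum_mul]
    exact Finset.sum_le_sum fun D _ => mul_le_mul_of_nonneg_left (W_mono hβ fun _ _ _ h => h.1)
      (mul_nonneg (Real.exp_pos _).le (chainSum_nonneg _ _ _ _))

/-! ### The cost of a contour in the presence of the floor -/

theorem Jump.inf {ℓ : ℤ} {η ζ : Site → ℤ} (h : Jump F ℓ η) (h' : Jump F ℓ ζ) :
    Jump F ℓ (η ⊓ ζ) := fun x y hxy =>
  ⟨le_inf (h x y hxy).1 (h' x y hxy).1, inf_le_left.trans (h x y hxy).2⟩

theorem Jump.sup {ℓ : ℤ} {η ζ : Site → ℤ} (h : Jump F ℓ η) (h' : Jump F ℓ ζ) :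
    Jump F ℓ (η ⊔ ζ) := fun x y hxy =>
  ⟨(h x y hxy).1.trans le_sup_left, sup_le (h x y hxy).2 (h' x y hxy).2⟩

/-- The contour event is stable under minima and maxima, so the events `1 ≤ η v` are positively
associated given it. They can be imposed one site at a time, each at the price `1 - p`. -/
theorem W_jump_mul_pow_le (hβ : 0 < β) {ℓ : ℤ} {p : ℝ} (hp : p ≤ 1)
    (hspike : ∀ v ∈ F, W β Λ (fun η => Jump F ℓ η ∧ η v ≤ 0) ≤ p * W β Λ (Jump F ℓ))
    {G : Finset Site} (hG : G ⊆ F) :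
    W β Λ (Jump F ℓ) * (1 - p) ^ G.card ≤
      W β Λ (fun η => Jump F ℓ η ∧ ∀ v ∈ G, 1 ≤ η v) := by
  rcases (W_nonneg (β := β) (Λ := Λ) (Jump F ℓ)).eq_or_lt with h0 | h0
  · rw [← h0, zero_mul]; exact W_nonneg _
  induction G using Finset.induction_on with
  | empty => simp
  | insert v G hv ih =>
    have ih := ih ((Finset.subset_insert _ _).trans hG)
    have h1 : (1 - p) * W β Λ (Jump F ℓ) ≤ W β Λ (fun η => Jump F ℓ η ∧ 1 ≤ η v) := by
      have := W_le_add (Λ := Λ) hβ (P := Jump F ℓ) (Q := fun η => Jump F ℓ η ∧ η v ≤ 0)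
        (R := fun η => Jump F ℓ η ∧ 1 ≤ η v) fun η h => by
          rcases le_or_gt (η v) 0 with h' | h'
          · exact .inl ⟨h, h'⟩
          · exact .inr ⟨h, h'⟩
      have := hspike v (hG (Finset.mem_insert_self _ _))
      linarith
    have h2 := W_mul_W_le (Λ := Λ) hβ (P := fun η => Jump F ℓ η ∧ ∀ v ∈ G, 1 ≤ η v)
      (Q := fun η => Jump F ℓ η ∧ 1 ≤ η v) (R := Jump F ℓ)
      (S := fun η => Jump F ℓ η ∧ ∀ w ∈ insert v G, 1 ≤ η w) fun η ζ h h' => by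
        refine ⟨h.1.inf h'.1, h.1.sup h'.1, fun w hw => ?_⟩
        rcases Finset.mem_insert.1 hw with rfl | hw
        · exact h'.2.trans le_sup_right
        · exact (h.2 w hw).trans le_sup_left
    have h3 := mul_le_mul ih h1 (mul_nonneg (by linarith) h0.le) (W_nonneg _)
    rw [Finset.card_insert_of_notMem hv]
    refine le_of_mul_le_mul_left ?_ h0
    calc _ = W β Λ (Jump F ℓ) * (1 - p) ^ G.card * ((1 - p) * W β Λ (Jump F ℓ)) := by ring
      _ ≤ _ := h3.trans h2

/-- Lower `F` by one. Only the heights along the inner boundary are remembered, which is what the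
next level needs. -/
theorem W_jump_one_le (hβ : 0 < β) (hFΛ : F ⊆ Λ) (ℓ : ℤ) :
    W β Λ (fun η => Jump F ℓ η ∧ ∀ v ∈ F, 1 ≤ η v) ≤
      Real.exp (-β * per F) * W β Λ (fun η => ∀ x y, (x, y) ∈ bd F → ℓ - 1 ≤ η x) := by
  refine W_le_of_shift hβ (-ind F) _ fun N η hη h => ⟨?_, fun x y hxy => ?_, ?_⟩
  · rw [mem_confs] at hη ⊢
    refine ⟨fun x hx => ?_, fun x => ?_⟩
    · have : x ∉ F := fun h => hx (hFΛ h)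
      simp [ind, this, hη.1 x hx]
    · have h1 := hη.2 x
      have h2 := h.2 x
      simp only [ind, Pi.add_apply, Pi.neg_apply]
      split_ifs with hx
      · have := h2 hx; push_cast; omega
      · push_cast; omega
  · have := (h.1 x y hxy).1
    simp only [ind, Pi.add_apply, Pi.neg_apply, (mem_bd.1 hxy).1, if_true]
    omega
  · refine (energy_sub_ind hFΛ fun x y hxy => ?_).le
    have := h.1 x y hxy
    omega

theorem exp_neg_two_mul_le {p : ℝ} (h0 : 0 ≤ p) (h : p ≤ 1 / 2) : Real.exp (-(2 * p)) ≤ 1 - p := by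
  rw [Real.exp_neg, inv_le_comm₀ (Real.exp_pos _) (by linarith)]
  refine le_trans ?_ (Real.add_one_le_exp _)
  rw [inv_le_iff_one_le_mul₀ (by linarith)]
  nlinarith

/-- Above height `b` a contour of length `m` costs at least `exp (-(β - p * L) * m)`, where `p`
bounds the probability of a downward spike of depth `b`. -/
theorem W_jump_le (hβ : 0 < β) {a : Site} {L : ℕ} (hF : Full F) (hFΛ : F ⊆ box a L) {b : ℕ}
    {ℓ : ℤ} (hb : (b : ℤ) ≤ ℓ) {p : ℝ} (hp0 : 0 ≤ p) (hp : p ≤ 1 / 2)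
    (hchain : ∀ v, chainSum β v b F ≤ p) :
    W β (box a L) (Jump F ℓ) ≤ Real.exp (-(β - p * L) * per F) *
      W β (box a L) (fun η => ∀ x y, (x, y) ∈ bd F → ℓ - 1 ≤ η x) := by
  have h1 := W_jump_mul_pow_le (Λ := box a L) (ℓ := ℓ) hβ (by linarith : p ≤ 1) (fun v hv =>
    (W_jump_spike_le hβ (box_full a L) hF hFΛ hv b hb).trans
      (mul_le_mul_of_nonneg_right (hchain v) (W_nonneg _))) (Finset.Subset.refl F)
  have h2 := h1.trans (W_jump_one_le hβ hFΛ ℓ)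
  -- Combine `1 - p ≥ exp (-2p)` with `2|F| ≤ L * per F`, trading the volume term for a perimeter
  -- term.
  have h3 : Real.exp (-(p * L * per F)) ≤ (1 - p) ^ F.card := by
    refine le_trans ?_ (pow_le_pow_left₀ (Real.exp_pos _).le (exp_neg_two_mul_le hp0 hp) _)
    rw [← Real.exp_nat_mul]
    refine Real.exp_le_exp.2 ?_
    have : (2 * F.card : ℝ) ≤ L * per F := by exact_mod_cast two_mul_card_le_of_subset_box hFΛ
    nlinarith
  have h4 := (mul_le_mul_of_nonneg_left h3 (W_nonneg (β := β) (Λ := box a L) (Jump F ℓ))).trans h2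
  calc _ = W β (box a L) (Jump F ℓ) * Real.exp (-(p * L * per F)) *
        Real.exp (p * L * per F) := by
        rw [mul_assoc, ← Real.exp_add]; simp
    _ ≤ _ := mul_le_mul_of_nonneg_right h4 (Real.exp_pos _).le
    _ = _ := by
        rw [mul_right_comm, ← Real.exp_add]
        congr 2; ring

end SOS

end

noncomputable section

namespace SOS

/-! ### Peeling off the upper level sets -/

/-- The sites enclosed by heights at least `ℓ`. -/
def highFill (Λ : Finset Site) (ℓ : ℤ) (η : Site → ℤ) : Finset Site :=
  fill Λ (Λ.filter fun x => ℓ ≤ η x)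

/-- The total mass of a nonnegative observable with ceiling `N`. -/
def mass (β : ℝ) (Λ : Finset Site) (N : ℕ) (f : (Site → ℤ) → ℝ) : ℝ :=
  ∑ η ∈ confs Λ N, wt β Λ η * f η

/-- The weight functions obtained by peeling off `i` levels. -/
def peel (γ t : ℝ) : ℕ → Finset Site → ℝ
  | 0, Y => Real.exp (t * Y.card)
  | i + 1, Y => ∏ D ∈ simpleSubsets Y, (1 + Real.exp (-γ * per D) * (peel γ t i D - 1))

variable {β γ t θ κ : ℝ} {Λ X Y : Finset Site}

theorem one_le_peel (ht : 0 ≤ t) (i : ℕ) (Y : Finset Site) : 1 ≤ peel γ t i Y := by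
  induction i generalizing Y with
  | zero => exact Real.one_le_exp (by positivity)
  | succ i ih =>
    rw [peel]
    refine Finset.one_le_prod fun D _ => ?_
    have := mul_nonneg (Real.exp_pos (-γ * per D)).le (sub_nonneg.2 (ih D))
    linarith

theorem peel_mono (ht : 0 ≤ t) (i : ℕ) (h : X ⊆ Y) : peel γ t i X ≤ peel γ t i Y := by
  cases i with
  | zero =>
    refine Real.exp_le_exp.2 (mul_le_mul_of_nonneg_left ?_ ht)
    exact_mod_cast Finset.card_le_card h
  | succ i =>
    simp only [peel]
    have h1 : ∀ D, 1 ≤ 1 + Real.exp (-γ * per D) * (peel γ t i D - 1) := fun D => by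
      have := mul_nonneg (Real.exp_pos (-γ * per D)).le (sub_nonneg.2 (one_le_peel (γ := γ) ht i D))
      linarith
    rw [← Finset.prod_sdiff (simpleSubsets_mono h)]
    refine le_mul_of_one_le_left (Finset.prod_nonneg fun D _ => by linarith [h1 D]) ?_
    exact Finset.one_le_prod fun D _ => h1 D

theorem exists_comps_of_subset {D : Finset Site} (hD : Simple D) (h : D ⊆ X) :
    ∃ Y ∈ comps X, D ⊆ Y := by
  obtain ⟨v, hv⟩ := hD.nonempty
  exact ⟨comp X v, mem_comps.2 ⟨v, h hv, rfl⟩, fun x hx =>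
    mem_comp.2 ⟨h hx, (hD.conn v hv x hx).mono fun z hz => h hz⟩⟩

theorem simpleSubsets_eq_biUnion (X : Finset Site) :
    simpleSubsets X = (comps X).biUnion simpleSubsets := by
  ext D
  simp only [Finset.mem_biUnion, mem_simpleSubsets]
  constructor
  · rintro ⟨h, hD⟩
    obtain ⟨Y, hY, hDY⟩ := exists_comps_of_subset hD h
    exact ⟨Y, hY, hDY, hD⟩
  · rintro ⟨Y, hY, hDY, hD⟩
    obtain ⟨v, -, rfl⟩ := mem_comps.1 hY
    exact ⟨hDY.trans (comp_subset _ _), hD⟩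

theorem prod_comps_simpleSubsets (f : Finset Site → ℝ) :
    ∏ Y ∈ comps X, ∏ D ∈ simpleSubsets Y, f D = ∏ D ∈ simpleSubsets X, f D := by
  rw [simpleSubsets_eq_biUnion X, Finset.prod_biUnion]
  intro Y hY Y' hY' hne
  change Disjoint (simpleSubsets Y) (simpleSubsets Y')
  rw [Finset.disjoint_left]
  intro D h h'
  rw [mem_simpleSubsets] at h h'
  obtain ⟨v, hv⟩ := h.2.nonempty
  exact hne (eq_of_mem_comps hY hY' (h.1 hv) (h'.1 hv))

/-- The peeled weights are multiplicative over components because a simple set is connected and lies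
in a single component. -/
theorem prod_comps_peel (i : ℕ) : ∏ Y ∈ comps X, peel γ t i Y = peel γ t i X := by
  cases i with
  | zero =>
    simp only [peel]
    rw [← Real.exp_sum, ← Finset.mul_sum, card_eq_sum_comps X]
    push_cast; rfl
  | succ i => exact prod_comps_simpleSubsets _

theorem mass_sum {ι : Type*} (s : Finset ι) (N : ℕ) (c : ι → ℝ) (P : ι → (Site → ℤ) → Prop) :
    mass β Λ N (fun η => ∑ i ∈ s, if P i η then c i else 0) = ∑ i ∈ s, c i * WN β Λ N (P i) := by
  simp only [mass, WN, Finset.mul_sum, Finset.sum_filter]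
  rw [Finset.sum_comm]
  refine Finset.sum_congr rfl fun i _ => Finset.sum_congr rfl fun η _ => ?_
  split_ifs <;> ring

theorem mass_mono {N : ℕ} {f g : (Site → ℤ) → ℝ} (h : ∀ η ∈ confs Λ N, f η ≤ g η) :
    mass β Λ N f ≤ mass β Λ N g :=
  Finset.sum_le_sum fun η hη => mul_le_mul_of_nonneg_left (h η hη) (wt_pos _ _ _).le

theorem highFill_subset (ℓ : ℤ) (η : Site → ℤ) : highFill Λ ℓ η ⊆ Λ := fill_subset _ _

theorem highFill_full (hΛ : Full Λ) (ℓ : ℤ) (η : Site → ℤ) : Full (highFill Λ ℓ η) :=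
  fill_full hΛ (Finset.filter_subset _ _)

theorem jump_biUnion (hΛ : Full Λ) {N : ℕ} {η : Site → ℤ} (hη : η ∈ confs Λ N) {ℓ : ℤ}
    (hℓ : 1 ≤ ℓ) {T : Finset (Finset Site)} (hT : T ⊆ comps (highFill Λ ℓ η)) :
    Jump (T.biUnion id) ℓ η := by
  intro x y hxy
  have h := bd_fill hΛ (Finset.filter_subset _ _) (bd_biUnion_subset hT hxy)
  simp only [Finset.mem_filter] at h
  refine ⟨h.1.2, ?_⟩
  by_cases hy : y ∈ Λ
  · have : ¬ ℓ ≤ η y := fun h' => h.2 ⟨hy, h'⟩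
    omega
  · rw [(mem_confs.1 hη).1 y hy]; omega

/-- A union of components of a level set is again full, and its perimeter is the sum of theirs. All
chosen contours are thus removed at once, and each leaves a simple set enclosed at the level below.
-/
theorem WN_subset_comps_le (hβ : 0 < β) (hΛ : Full Λ) {ℓ : ℤ} (hℓ : 1 ≤ ℓ)
    (hcost : ∀ F, Full F → F ⊆ Λ → W β Λ (Jump F ℓ) ≤ Real.exp (-γ * per F) *
      W β Λ (fun η => ∀ x y, (x, y) ∈ bd F → ℓ - 1 ≤ η x))
    (N : ℕ) {T : Finset (Finset Site)} :
    WN β Λ N (fun η => T ⊆ comps (highFill Λ ℓ η)) ≤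
      (∏ D ∈ T, Real.exp (-γ * per D)) *
        W β Λ (fun η => T ⊆ simpleSubsets (highFill Λ (ℓ - 1) η)) := by
  -- The geometric properties of `T` are read off one surface realising it; a family that no surface
  -- realises has weight zero.
  by_cases hex : ∃ η ∈ confs Λ N, T ⊆ comps (highFill Λ ℓ η)
  · obtain ⟨η₀, -, hT⟩ := hex
    have hsub := biUnion_subset_of_subset_comps hT
    have hS := hT.trans (comps_subset_simpleSubsets (highFill_full hΛ ℓ η₀) (highFill_subset ℓ η₀))
    have h1 : WN β Λ N (fun η => T ⊆ comps (highFill Λ ℓ η)) ≤ W β Λ (Jump (T.biUnion id) ℓ) :=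
      (WN_mono le_rfl fun η hη h => jump_biUnion hΛ hη hℓ h).trans (WN_le_W hβ N _)
    refine (h1.trans (hcost _ (full_biUnion (highFill_full hΛ ℓ η₀) hT)
      (hsub.trans (highFill_subset ℓ η₀)))).trans ?_
    rw [per_biUnion hT]
    push_cast
    rw [Finset.mul_sum, Real.exp_sum]
    refine mul_le_mul_of_nonneg_left (W_mono hβ fun M η _ h D hD => ?_)
      (Finset.prod_nonneg fun _ _ => (Real.exp_pos _).le)
    obtain ⟨hDΛ, hDs⟩ := mem_simpleSubsets.1 (hS hD)
    refine mem_simpleSubsets.2 ⟨subset_fill_of_bd hDΛ fun x y hxy => Finset.mem_filter.2 ⟨?_, ?_⟩, hDs⟩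
    · exact hDΛ (mem_bd.1 hxy).1
    · refine h x y ?_
      rw [bd_biUnion hT]
      exact Finset.mem_biUnion.2 ⟨D, hD, hxy⟩
  · have : WN β Λ N (fun η => T ⊆ comps (highFill Λ ℓ η)) = 0 := by
      rw [WN, Finset.sum_filter]
      exact Finset.sum_eq_zero fun η hη => if_neg fun h => hex ⟨η, hη, h⟩
    rw [this]
    exact mul_nonneg (Finset.prod_nonneg fun _ _ => (Real.exp_pos _).le) (W_nonneg _)

theorem prod_eq_sum_powerset {A B : Finset (Finset Site)} (h : A ⊆ B) (u : Finset Site → ℝ) :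
    ∏ D ∈ A, (1 + u D) = ∑ T ∈ B.powerset, if T ⊆ A then ∏ D ∈ T, u D else 0 := by
  rw [Finset.prod_one_add, ← Finset.sum_filter]
  refine Finset.sum_congr ?_ fun _ _ => rfl
  ext T
  simp only [Finset.mem_powerset, Finset.mem_filter]
  exact ⟨fun hT => ⟨hT.trans h, hT⟩, fun hT => hT.2⟩

/-- Write the weight as the product over components of `1 + (peel - 1)`, expand it over subfamilies,
pay the contour cost of each, and resum. Components at level `ℓ` become arbitrary simple subsets at
level `ℓ - 1`, which is the recursion defining `peel`. The limit removes the ceiling. -/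
theorem mass_peel_le_of_succ (hβ : 0 < β) (hΛ : Full Λ) (ht : 0 ≤ t) {ℓ : ℤ} (hℓ : 1 ≤ ℓ)
    (hcost : ∀ F, Full F → F ⊆ Λ → W β Λ (Jump F ℓ) ≤ Real.exp (-γ * per F) *
      W β Λ (fun η => ∀ x y, (x, y) ∈ bd F → ℓ - 1 ≤ η x)) (i : ℕ) {c : ℝ}
    (hc : ∀ N, mass β Λ N (fun η => peel γ t (i + 1) (highFill Λ (ℓ - 1) η)) ≤ c) (N : ℕ) :
    mass β Λ N (fun η => peel γ t i (highFill Λ ℓ η)) ≤ c := by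
  have hu : ∀ D, 0 ≤ peel γ t i D - 1 := fun D => sub_nonneg.2 (one_le_peel ht i D)
  have h1 : mass β Λ N (fun η => peel γ t i (highFill Λ ℓ η)) =
      ∑ T ∈ (simpleSubsets Λ).powerset, (∏ D ∈ T, (peel γ t i D - 1)) *
        WN β Λ N (fun η => T ⊆ comps (highFill Λ ℓ η)) := by
    rw [← mass_sum]
    congr 1
    ext η
    have := prod_eq_sum_powerset (comps_subset_simpleSubsets (highFill_full hΛ ℓ η)
      (highFill_subset ℓ η)) fun D => peel γ t i D - 1
    simp only [add_sub_cancel, prod_comps_peel] at this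
    convert this
  have h2 : ∀ M, ∑ T ∈ (simpleSubsets Λ).powerset,
      (∏ D ∈ T, Real.exp (-γ * per D) * (peel γ t i D - 1)) *
        WN β Λ M (fun η => T ⊆ simpleSubsets (highFill Λ (ℓ - 1) η)) ≤ c := by
    intro M
    refine le_of_eq_of_le ?_ (hc M)
    rw [← mass_sum]
    congr 1
    ext η
    rw [peel, prod_eq_sum_powerset (simpleSubsets_mono (highFill_subset (ℓ - 1) η))]
    congr!
  rw [h1]
  refine le_trans (Finset.sum_le_sum fun T hT => ?_) (le_of_tendsto' (tendsto_finsetSum _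
    fun T _ => (tendsto_WN hβ (fun η => T ⊆ simpleSubsets (highFill Λ (ℓ - 1) η))).const_mul _) h2)
  rw [Finset.prod_mul_distrib, mul_comm (∏ D ∈ T, Real.exp _), mul_assoc]
  exact mul_le_mul_of_nonneg_left (WN_subset_comps_le hβ hΛ hℓ hcost N)
    (Finset.prod_nonneg fun D _ => hu D)

theorem mass_peel_le (hβ : 0 < β) (hΛ : Full Λ) (ht : 0 ≤ t) {b : ℕ}
    (hcost : ∀ ℓ : ℤ, b < ℓ → ∀ F, Full F → F ⊆ Λ → W β Λ (Jump F ℓ) ≤ Real.exp (-γ * per F) *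
      W β Λ (fun η => ∀ x y, (x, y) ∈ bd F → ℓ - 1 ≤ η x)) (i q : ℕ) (N : ℕ) :
    mass β Λ N (fun η => peel γ t i (highFill Λ (b + q : ℕ) η)) ≤
      peel γ t (i + q) Λ * W β Λ (fun _ => True) := by
  induction q generalizing i N with
  | zero =>
    calc _ ≤ mass β Λ N (fun _ => peel γ t i Λ) :=
          mass_mono fun η _ => peel_mono ht i (highFill_subset _ _)
      _ = peel γ t i Λ * WN β Λ N (fun _ => True) := by
          simp only [mass, WN, Finset.filter_true]
          rw [← Finset.sum_mul, mul_comm]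
      _ ≤ _ := mul_le_mul_of_nonneg_left (WN_le_W hβ N _) (zero_le_one.trans (one_le_peel ht i Λ))
  | succ q ih =>
    refine mass_peel_le_of_succ hβ hΛ ht (by push_cast; omega) (hcost _ (by push_cast; omega)) i
      (fun M => ?_) N
    have := ih (i + 1) M
    rw [show i + 1 + q = i + (q + 1) by ring] at this
    convert this using 5
    push_cast; ring

/-! ### The peeled weights are small -/

theorem exp_sub_one_le (s : ℝ) : Real.exp s - 1 ≤ s * Real.exp s := by
  have := mul_le_mul_of_nonneg_right (Real.add_one_le_exp (-s)) (Real.exp_pos s).le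
  rw [← Real.exp_add] at this
  simp only [neg_add_cancel, Real.exp_zero] at this
  linarith

/-- With `peel ≤ exp s` on `D`, the assumption on `t` gives `s ≤ κ * per D`. Hence `exp s - 1 ≤ s *
exp (κ * per D)` merely lowers the decay rate from `γ` to `γ - κ`, the same at every level.
Exchanging sums turns the recursion into that of `chainSum`. -/
theorem peel_le_exp {a : Site} {L : ℕ} {C : ℝ} (ht : 0 ≤ t)
    (hC : ∀ (v : Site) (q : ℕ) (Y : Finset Site), chainSum (γ - κ) v q Y ≤ C)
    (htC : t * C * L ≤ 2 * κ) (q : ℕ) (hY : Y ⊆ box a L) :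
    peel γ t q Y ≤ Real.exp (t * ∑ v ∈ Y, chainSum (γ - κ) v q Y) := by
  induction q generalizing Y with
  | zero => simp [peel, chainSum]
  | succ q ih =>
    rw [peel]
    have h1 : ∀ D ∈ simpleSubsets Y, 1 + Real.exp (-γ * per D) * (peel γ t q D - 1) ≤
        Real.exp (∑ v ∈ D, t * (Real.exp (-(γ - κ) * per D) * chainSum (γ - κ) v q D)) := by
      intro D hD
      have hDY := (mem_simpleSubsets.1 hD).1
      set s := t * ∑ v ∈ D, chainSum (γ - κ) v q D with hs
      have hs0 : 0 ≤ s := mul_nonneg ht (Finset.sum_nonneg fun v _ => chainSum_nonneg _ _ _ _)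
      have hsle : s ≤ κ * per D := by
        have h2 : ∑ v ∈ D, chainSum (γ - κ) v q D ≤ D.card * C := by
          simpa using Finset.sum_le_card_nsmul D _ C fun v _ => hC v q D
        have h3 : (2 * D.card : ℝ) ≤ L * per D := by
          exact_mod_cast two_mul_card_le_of_subset_box (hDY.trans hY)
        have hC0 : 0 ≤ C := (chainSum_nonneg _ _ _ _).trans (hC a 0 ∅)
        have h4 := mul_le_mul_of_nonneg_left h2 ht
        have h5 := mul_le_mul_of_nonneg_left h3 (mul_nonneg ht hC0)
        have h6 := mul_le_mul_of_nonneg_right htC (Nat.cast_nonneg (α := ℝ) (per D))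
        linarith
      have h7 : peel γ t q D - 1 ≤ s * Real.exp (κ * per D) :=
        (sub_le_sub_right (ih (hDY.trans hY)) 1).trans ((exp_sub_one_le s).trans
          (mul_le_mul_of_nonneg_left (Real.exp_le_exp.2 hsle) hs0))
      have h8 := mul_le_mul_of_nonneg_left h7 (Real.exp_pos (-γ * per D)).le
      have h9 : Real.exp (-γ * per D) * (s * Real.exp (κ * per D)) =
          ∑ v ∈ D, t * (Real.exp (-(γ - κ) * per D) * chainSum (γ - κ) v q D) := by
        rw [← Finset.mul_sum, ← Finset.mul_sum, hs, show -(γ - κ) * (per D : ℝ) =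
          -γ * per D + κ * per D by ring, Real.exp_add]
        ring
      rw [h9] at h8
      have := Real.add_one_le_exp (∑ v ∈ D, t * (Real.exp (-(γ - κ) * per D) *
        chainSum (γ - κ) v q D))
      linarith
    have h0 : ∀ D ∈ simpleSubsets Y, 0 ≤ 1 + Real.exp (-γ * per D) * (peel γ t q D - 1) :=
      fun D _ => by
        have := mul_nonneg (Real.exp_pos (-γ * per D)).le (sub_nonneg.2 (one_le_peel (γ := γ) ht q D))
        linarith
    refine (Finset.prod_le_prod h0 h1).trans ?_
    rw [← Real.exp_sum]
    refine (congrArg Real.exp ?_).le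
    simp only [chainSum, Finset.mul_sum]
    rw [Finset.sum_comm' (t' := Y) (s' := fun v => simpleAt v Y)]
    intro D v
    simp only [mem_simpleSubsets, mem_simpleAt]
    exact ⟨fun h => ⟨h, h.1.1 h.2⟩, fun h => h.1⟩

end SOS

end

noncomputable section

namespace SOS

/-! ### The exponential moment of the number of high sites -/

/-- The number of sites of `Λ` at height at least `ℓ`. -/
def countGE (Λ : Finset Site) (ℓ : ℤ) (η : Site → ℤ) : ℕ := (Λ.filter fun x => ℓ ≤ η x).card

theorem countGE_mono {Λ : Finset Site} {ℓ : ℤ} {η ζ : Site → ℤ} (h : η ≤ ζ) :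
    countGE Λ ℓ η ≤ countGE Λ ℓ ζ :=
  Finset.card_le_card fun x hx => by
    rw [Finset.mem_filter] at hx ⊢
    exact ⟨hx.1, hx.2.trans (h x)⟩

theorem card_box (a : Site) (L : ℕ) : (box a L).card = L ^ 2 := by
  simp [box, Finset.card_product, sq]

theorem eqHeight_nonneg {β : ℝ} (hβ : 1 ≤ β) (L : ℕ) : 0 ≤ eqHeight β L :=
  Int.floor_nonneg.2 (mul_nonneg (by positivity) (Real.log_natCast_nonneg L))

theorem mul_eqHeight_le {β : ℝ} (hβ : 1 ≤ β) (L : ℕ) : 4 * β * eqHeight β L ≤ Real.log L := by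
  have h := Int.floor_le (1 / (4 * β) * Real.log L)
  calc 4 * β * eqHeight β L ≤ 4 * β * (1 / (4 * β) * Real.log L) :=
        mul_le_mul_of_nonneg_left h (by positivity)
    _ = Real.log L := by field_simp

theorem log_le_mul_eqHeight {β : ℝ} (hβ : 1 ≤ β) (L : ℕ) :
    Real.log L ≤ 4 * β * (eqHeight β L + 1) := by
  have h := (Int.lt_floor_add_one (1 / (4 * β) * Real.log L)).le
  calc Real.log L = 4 * β * (1 / (4 * β) * Real.log L) := by field_simp
    _ ≤ _ := mul_le_mul_of_nonneg_left h (by positivity)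

theorem exists_nat_le_exp (x : ℝ) : ∃ m : ℕ, x ≤ Real.exp m := by
  obtain ⟨m, hm⟩ := exists_nat_ge x
  exact ⟨m, hm.trans (by linarith [Real.add_one_le_exp (m : ℝ)])⟩

theorem mass_exp_countGE_le_peel {β γ t : ℝ} {Λ : Finset Site} (hβ : 0 < β) (hΛ : Full Λ)
    (ht : 0 ≤ t) {b : ℕ}
    (hcost : ∀ ℓ : ℤ, b < ℓ → ∀ F, Full F → F ⊆ Λ → W β Λ (Jump F ℓ) ≤ Real.exp (-γ * per F) *
      W β Λ (fun η => ∀ x y, (x, y) ∈ bd F → ℓ - 1 ≤ η x)) (q N : ℕ) :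
    mass β Λ N (fun η => Real.exp (t * countGE Λ (b + q : ℕ) η)) ≤
      peel γ t q Λ * W β Λ (fun _ => True) := by
  have := mass_peel_le hβ hΛ ht hcost 0 q N
  rw [zero_add] at this
  refine (mass_mono fun η _ => Real.exp_le_exp.2 (mul_le_mul_of_nonneg_left ?_ ht)).trans this
  exact_mod_cast Finset.card_le_card (subset_fill (Finset.filter_subset _ _))

theorem exists_mass_exp_le : ∃ (κ C : ℝ) (K : ℕ), 0 < κ ∧ κ ≤ 1 / 8 ∧ 1 ≤ C ∧
    ∀ β : ℝ, 1 ≤ β → ∀ L : ℕ, 2 ≤ L → ∀ (a : Site) (t : ℝ), 0 ≤ t → t * C * L ≤ 2 * κ →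
      ∀ q N : ℕ, mass β (box a L) N
        (fun η => Real.exp (t * countGE (box a L) (eqHeight β L + K + q) η)) ≤
          Real.exp (t * (L ^ 2 * (C * Real.exp (-3 * β * q)))) * W β (box a L) fun _ => True := by
  obtain ⟨θ, C, hθ, hθ1, hC1, hC⟩ := exists_chainSum_le
  -- The gap above `θ` is spent twice: once for the floor, once in `peel_le_exp`.
  set κ : ℝ := (1 - θ) / 2 with hκ
  have hκ0 : 0 < κ := by rw [hκ]; linarith
  have hκ8 : κ ≤ 1 / 8 := by rw [hκ]; linarith
  obtain ⟨m, hm⟩ := exists_nat_le_exp (C / κ)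
  refine ⟨κ, C, m + 1, hκ0, hκ8, hC1, fun β hβ L hL a t ht htL q N => ?_⟩
  have hL0 : (0 : ℝ) < L := by positivity
  have hL2 : (2 : ℝ) ≤ L := by exact_mod_cast hL
  obtain ⟨H, hH⟩ := Int.eq_ofNat_of_zero_le (eqHeight_nonneg hβ L)
  have hlog := log_le_mul_eqHeight hβ L
  rw [hH] at hlog
  -- Since `L ≤ exp (4β(H+1))`, the `m` further levels give `pL ≤ C * exp (-m) ≤ κ`.
  set b : ℕ := H + (m + 1) with hb
  set p : ℝ := C * Real.exp (-4 * β * b) with hp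
  have hp0 : 0 ≤ p := by positivity
  have hpL : p * L ≤ κ := by
    have h1 : Real.exp (-4 * β * b) * L ≤ Real.exp (-m) := by
      rw [← Real.exp_log hL0, ← Real.exp_add]
      refine Real.exp_le_exp.2 ?_
      rw [hb]
      push_cast at hlog ⊢
      have : (0 : ℝ) ≤ m := Nat.cast_nonneg m
      nlinarith
    calc p * L = C * (Real.exp (-4 * β * b) * L) := by rw [hp]; ring
      _ ≤ C * Real.exp (-m) := mul_le_mul_of_nonneg_left h1 (by linarith)
      _ ≤ κ := by
        rw [Real.exp_neg, ← div_eq_mul_inv, div_le_iff₀ (Real.exp_pos _)]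
        rw [div_le_iff₀ hκ0] at hm
        linarith
  have hpl : p ≤ 1 / 2 := by nlinarith
  have hβθ : θ ≤ β - κ - κ := by rw [hκ]; linarith
  have hcost : ∀ ℓ : ℤ, b < ℓ → ∀ F, Full F → F ⊆ box a L → W β (box a L) (Jump F ℓ) ≤
      Real.exp (-(β - κ) * per F) *
        W β (box a L) (fun η => ∀ x y, (x, y) ∈ bd F → ℓ - 1 ≤ η x) := by
    intro ℓ hℓ F hF hFΛ
    refine (W_jump_le (by linarith) hF hFΛ hℓ.le hp0 hpl fun v =>
      hC β (by linarith) v b F).trans (mul_le_mul_of_nonneg_right ?_ (W_nonneg _))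
    refine Real.exp_le_exp.2 (mul_le_mul_of_nonneg_right ?_ (Nat.cast_nonneg _))
    linarith
  have h1 := mass_exp_countGE_le_peel (γ := β - κ) (by linarith : 0 < β) (box_full a L) ht hcost q N
  -- As `κ ≤ 1 / 8` and `β ≥ 1`, one has `4(β - 2κ) ≥ 3β`.
  have hC' : ∀ (v : Site) (q : ℕ) (Y : Finset Site),
      chainSum (β - κ - κ) v q Y ≤ C * Real.exp (-3 * β * q) := by
    intro v q Y
    refine (hC _ hβθ v q Y).trans (mul_le_mul_of_nonneg_left (Real.exp_le_exp.2 ?_) (by linarith))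
    refine mul_le_mul_of_nonneg_right ?_ (Nat.cast_nonneg q)
    linarith
  have h2 := peel_le_exp (γ := β - κ) (κ := κ) (C := C) ht (fun v q Y => (hC' v q Y).trans
    (mul_le_of_le_one_right (by linarith) (Real.exp_le_one_iff.2 (by
      have : (0 : ℝ) ≤ q := Nat.cast_nonneg q
      nlinarith)))) htL q (Finset.Subset.refl (box a L))
  have h3 : ∑ v ∈ box a L, chainSum (β - κ - κ) v q (box a L) ≤
      L ^ 2 * (C * Real.exp (-3 * β * q)) := by
    refine (Finset.sum_le_card_nsmul _ _ _ fun v _ => hC' v q _).trans_eq ?_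
    rw [card_box, nsmul_eq_mul]; push_cast; ring
  have h4 : eqHeight β L + ((m + 1 : ℕ) : ℤ) + q = ((b + q : ℕ) : ℤ) := by
    rw [hH, hb]; push_cast; ring
  rw [h4]
  exact h1.trans (mul_le_mul_of_nonneg_right (h2.trans (Real.exp_le_exp.2
    (mul_le_mul_of_nonneg_left h3 ht))) (W_nonneg _))

/-! ### Consequences of the exponential moment bound -/

section Consequences

variable {β : ℝ} {Λ : Finset Site} {t c m : ℝ} {ℓ : ℤ}

theorem W_countGE_le (ht : 0 ≤ t)
    (h : ∀ N, mass β Λ N (fun η => Real.exp (t * countGE Λ ℓ η)) ≤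
      Real.exp c * W β Λ fun _ => True) :
    W β Λ (fun η => m < countGE Λ ℓ η) ≤ Real.exp (c - t * m) * W β Λ fun _ => True := by
  refine W_le fun N => ?_
  have h1 : Real.exp (t * m) * WN β Λ N (fun η => m < countGE Λ ℓ η) ≤
      mass β Λ N (fun η => Real.exp (t * countGE Λ ℓ η)) := by
    rw [WN, Finset.mul_sum, mass]
    refine (Finset.sum_le_sum fun η hη => ?_).trans (Finset.sum_le_sum_of_subset_of_nonneg
      (Finset.filter_subset _ _) fun η _ _ => mul_nonneg (wt_pos _ _ _).le (Real.exp_pos _).le)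
    rw [mul_comm]
    exact mul_le_mul_of_nonneg_left (Real.exp_le_exp.2 (mul_le_mul_of_nonneg_left
      (Finset.mem_filter.1 hη).2.le ht)) (wt_pos _ _ _).le
  have h2 := mul_le_mul_of_nonneg_left (h1.trans (h N)) (Real.exp_pos (-(t * m))).le
  rw [← mul_assoc, ← Real.exp_add, neg_add_cancel, Real.exp_zero, one_mul, ← mul_assoc,
    ← Real.exp_add] at h2
  rwa [sub_eq_neg_add]

/-- Integrate the inequality `exp (t * count) ≥ 1 + t`, valid whenever some site is high. It remains
useful for small `t`, where Markov's inequality for the exponential would not be. -/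
theorem mul_W_exists_le (hβ : 0 < β) (ht : 0 ≤ t)
    (h : ∀ N, mass β Λ N (fun η => Real.exp (t * countGE Λ ℓ η)) ≤
      Real.exp c * W β Λ fun _ => True) :
    t * W β Λ (fun η => ∃ x ∈ Λ, ℓ ≤ η x) ≤ (Real.exp c - 1) * W β Λ fun _ => True := by
  have h1 : ∀ N, WN β Λ N (fun _ => True) + t * WN β Λ N (fun η => ∃ x ∈ Λ, ℓ ≤ η x) ≤
      Real.exp c * W β Λ fun _ => True := by
    intro N
    refine le_trans ?_ (h N)
    rw [WN, WN, Finset.mul_sum, Finset.sum_filter, Finset.sum_filter, ← Finset.sum_add_distrib,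
      mass]
    refine Finset.sum_le_sum fun η _ => ?_
    have hw := wt_pos β Λ η
    have hexp := Real.add_one_le_exp (t * countGE Λ ℓ η)
    rw [if_pos trivial]
    split_ifs with hx
    · obtain ⟨x, hx, hxℓ⟩ := hx
      have : (1 : ℝ) ≤ countGE Λ ℓ η := by
        exact_mod_cast Finset.card_pos.2 ⟨x, Finset.mem_filter.2 ⟨hx, hxℓ⟩⟩
      have h2 := mul_le_mul_of_nonneg_left this ht
      have h3 := mul_le_mul_of_nonneg_left (by linarith : t + 1 ≤ _) hw.le
      linarith
    · have : 0 ≤ t * countGE Λ ℓ η := by positivity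
      nlinarith
  have h2 := le_of_tendsto' ((tendsto_WN (Λ := Λ) hβ fun _ => True).add
    ((tendsto_WN hβ fun η => ∃ x ∈ Λ, ℓ ≤ η x).const_mul t)) h1
  linarith

end Consequences

end SOS

end

noncomputable section

namespace SOS

/-! ### The number of low sites -/

theorem per_le_four_mul_card (D : Finset Site) : per D ≤ 4 * D.card := by
  unfold per
  have : bd D ⊆ D.biUnion fun x => (nbrs x).image fun y => (x, y) := by
    rintro ⟨x, y⟩ h
    obtain ⟨hx, -, hadj⟩ := mem_bd.1 h
    exact Finset.mem_biUnion.2 ⟨x, hx, Finset.mem_image.2 ⟨y, (mem_nbrs x y).2 hadj, rfl⟩⟩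
  refine (Finset.card_le_card this).trans (Finset.card_biUnion_le.trans ?_)
  refine (Finset.sum_le_card_nsmul D _ 4 fun x _ => Finset.card_image_le.trans ?_).trans_eq ?_
  · exact Finset.card_le_four
  · rw [smul_eq_mul, mul_comm]

theorem per_box_le (a : Site) (L : ℕ) : per (box a L) ≤ 4 * L := by
  set I := Finset.Icc (a.1 + 1) (a.1 + L)
  set J := Finset.Icc (a.2 + 1) (a.2 + L)
  have hsub : bd (box a L) ⊆
      (J.image (fun j => ((a.1 + 1, j), (a.1, j))) ∪
        J.image (fun j => ((a.1 + L, j), (a.1 + L + 1, j)))) ∪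
      (I.image (fun i => ((i, a.2 + 1), (i, a.2))) ∪
        I.image (fun i => ((i, a.2 + L), (i, a.2 + L + 1)))) := by
    rintro ⟨⟨x1, x2⟩, ⟨y1, y2⟩⟩ h
    obtain ⟨hx, hy, hadj⟩ := mem_bd.1 h
    rw [← mem_nbrs] at hadj
    simp only [nbrs, Finset.mem_insert, Finset.mem_singleton, Prod.mk.injEq] at hadj
    simp only [box, Finset.mem_product, Finset.mem_Icc] at hx hy
    simp only [Finset.mem_union, Finset.mem_image, Finset.mem_Icc, Prod.mk.injEq, I, J]
    rcases hadj with h | h | h | h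
    · exact .inl (.inr ⟨x2, by omega, by omega⟩)
    · exact .inl (.inl ⟨x2, by omega, by omega⟩)
    · exact .inr (.inr ⟨x1, by omega, by omega⟩)
    · exact .inr (.inl ⟨x1, by omega, by omega⟩)
  have hI : I.card = L := by simp [I]
  have hJ : J.card = L := by simp [J]
  refine (Finset.card_le_card hsub).trans ((Finset.card_union_le _ _).trans ?_)
  refine (add_le_add (Finset.card_union_le _ _) (Finset.card_union_le _ _)).trans ?_
  have h1 := fun f : ℤ → Site × Site => Finset.card_image_le (s := I) (f := f)
  have h2 := fun f : ℤ → Site × Site => Finset.card_image_le (s := J) (f := f)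
  rw [hI] at h1
  rw [hJ] at h2
  refine (add_le_add (add_le_add (h2 _) (h2 _)) (add_le_add (h1 _) (h1 _))).trans ?_
  omega

/-- The sites of `Λ` at height exactly `h`. -/
def level (Λ : Finset Site) (h : ℤ) (η : Site → ℤ) : Finset Site := Λ.filter fun x => η x = h

/-- Raise the surface by one, and drop the sites of `A` from height `h + 1` to `0`. -/
def puncture (Λ : Finset Site) (h : ℤ) (η : Site → ℤ) (A : Finset Site) : Site → ℤ :=
  η + ind Λ + fun x => -(h + 1) * ind A x

variable {β : ℝ} {Λ : Finset Site} {h : ℤ}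

theorem puncture_apply {η : Site → ℤ} {A : Finset Site} (hA : A ⊆ level Λ h η) (x : Site) :
    puncture Λ h η A x = if x ∈ A then 0 else η x + ind Λ x := by
  simp only [puncture, Pi.add_apply]
  split_ifs with hx
  · obtain ⟨h1, h2⟩ := Finset.mem_filter.1 (hA hx)
    simp only [ind, h1, hx, h2, if_true]; ring
  · simp [ind, hx]

theorem puncture_mem_confs {N : ℕ} {η : Site → ℤ} (hη : η ∈ confs Λ N) {A : Finset Site}
    (hA : A ⊆ level Λ h η) : puncture Λ h η A ∈ confs Λ (N + 1) := by
  rw [mem_confs] at hη ⊢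
  refine ⟨fun x hx => ?_, fun x => ?_⟩
  · rw [puncture_apply hA, hη.1 x hx]; simp [ind, hx]
  · rw [puncture_apply hA]
    have := hη.2 x
    simp only [ind]
    push_cast
    split_ifs <;> omega

/-- After the surface has been raised, only the dropped sites are at the floor, so the new zero set
remembers the choice `A`. -/
theorem level_zero_puncture {N : ℕ} {η : Site → ℤ} (hη : η ∈ confs Λ N) {A : Finset Site}
    (hA : A ⊆ level Λ h η) : level Λ 0 (puncture Λ h η A) = A := by
  ext x
  simp only [level, Finset.mem_filter, puncture_apply hA]
  have := (mem_confs.1 hη).2 x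
  constructor
  · rintro ⟨hx, h0⟩
    by_contra hxA
    simp only [hxA, if_false, ind, hx, if_true] at h0
    omega
  · intro hx
    exact ⟨(Finset.mem_filter.1 (hA hx)).1, by simp [hx]⟩

theorem energy_puncture_le (hh : 0 ≤ h) {η : Site → ℤ} {A : Finset Site}
    (hA : A ⊆ level Λ h η) :
    energy Λ (puncture Λ h η A) ≤ energy Λ η + per Λ + 4 * (h + 1) * A.card := by
  have h1 := energy_add_le Λ (η + ind Λ) fun x => -(h + 1) * ind A x
  have h2 := energy_add_le Λ η (ind Λ)
  have h3 := energy_smul_ind (hA.trans (Finset.filter_subset _ _)) (-(h + 1))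
  have h4 := energy_smul_ind (Finset.Subset.refl Λ) 1
  have h5 : (fun x => 1 * ind Λ x) = ind Λ := by ext; simp
  have h6 : (per A : ℝ) ≤ 4 * A.card := by exact_mod_cast per_le_four_mul_card A
  have h7 : (0 : ℝ) ≤ h := by exact_mod_cast hh
  rw [h5, Int.cast_one, abs_one, one_mul] at h4
  push_cast at h3
  rw [abs_neg, abs_of_nonneg (by linarith)] at h3
  have h8 := mul_le_mul_of_nonneg_left h6 (by linarith : (0 : ℝ) ≤ h + 1)
  unfold puncture
  linarith

theorem exp_half_le {δ : ℝ} (h0 : 0 ≤ δ) (h1 : δ ≤ 1) : Real.exp (δ / 2) ≤ 1 + δ := by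
  rw [← neg_neg (δ / 2), Real.exp_neg, inv_le_comm₀ (Real.exp_pos _) (by linarith)]
  refine le_trans ?_ (Real.add_one_le_exp _)
  rw [inv_le_iff_one_le_mul₀ (by linarith)]
  nlinarith

/-- The pairs of a surface and a punctured set inject into surfaces with ceiling `N + 1`. Summing
over the punctured sets gives `(1 + δ)^|level| ≥ exp (δ * m / 2)`. -/
theorem WN_level_le (hβ : 0 ≤ β) (hh : 0 ≤ h) (N : ℕ) {m : ℝ} :
    WN β Λ N (fun η => m ≤ (level Λ h η).card) ≤
      Real.exp (β * per Λ - Real.exp (-4 * β * (h + 1)) * m / 2) *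
        WN β Λ (N + 1) fun _ => True := by
  set δ := Real.exp (-4 * β * (h + 1)) with hδ
  have hh' : (0 : ℝ) ≤ h := by exact_mod_cast hh
  have hδ1 : δ ≤ 1 := Real.exp_le_one_iff.2 (by nlinarith [mul_nonneg hβ hh'])
  set s := (confs Λ N).filter fun η => m ≤ (level Λ h η).card with hs
  have h1 : ∑ p ∈ s.sigma fun η => (level Λ h η).powerset, wt β Λ (puncture Λ h p.1 p.2) ≤
      WN β Λ (N + 1) fun _ => True := by
    rw [← Finset.sum_image (f := wt β Λ) (g := fun p : (_ : Site → ℤ) × Finset Site =>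
      puncture Λ h p.1 p.2), WN, Finset.filter_true]
    · refine Finset.sum_le_sum_of_subset_of_nonneg ?_ fun _ _ _ => (wt_pos _ _ _).le
      intro ζ hζ
      obtain ⟨⟨η, A⟩, hp, rfl⟩ := Finset.mem_image.1 hζ
      obtain ⟨hη, hA⟩ := Finset.mem_sigma.1 hp
      exact puncture_mem_confs (Finset.mem_filter.1 hη).1 (Finset.mem_powerset.1 hA)
    · rintro ⟨η, A⟩ hp ⟨η', A'⟩ hp' heq
      obtain ⟨hη, hA⟩ := Finset.mem_sigma.1 (Finset.mem_coe.1 hp)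
      obtain ⟨hη', hA'⟩ := Finset.mem_sigma.1 (Finset.mem_coe.1 hp')
      have e1 := level_zero_puncture (Finset.mem_filter.1 hη).1 (Finset.mem_powerset.1 hA)
      have e2 := level_zero_puncture (Finset.mem_filter.1 hη').1 (Finset.mem_powerset.1 hA')
      simp only at heq e1 e2
      rw [heq] at e1
      obtain rfl : A = A' := e1.symm.trans e2
      obtain rfl : η = η' := by
        simp only [puncture] at heq
        exact add_right_cancel (add_right_cancel heq)
      rfl
  have h2 : ∀ η ∈ s, Real.exp (-(β * per Λ - δ * m / 2)) * wt β Λ η ≤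
      ∑ A ∈ (level Λ h η).powerset, wt β Λ (puncture Λ h η A) := by
    intro η hη
    have hm := (Finset.mem_filter.1 hη).2
    calc _ = Real.exp (-(β * per Λ)) * wt β Λ η * Real.exp (δ / 2 * m) := by
          rw [mul_right_comm, ← Real.exp_add]; congr 2; ring
      _ ≤ Real.exp (-(β * per Λ)) * wt β Λ η * (1 + δ) ^ (level Λ h η).card := by
          refine mul_le_mul_of_nonneg_left ?_ (mul_nonneg (Real.exp_pos _).le (wt_pos _ _ _).le)
          refine le_trans ?_ (pow_le_pow_left₀ (Real.exp_pos _).le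
            (exp_half_le (Real.exp_pos _).le hδ1) _)
          rw [← Real.exp_nat_mul]
          refine Real.exp_le_exp.2 ?_
          have := mul_le_mul_of_nonneg_left hm (Real.exp_pos (-4 * β * (h + 1))).le
          rw [← hδ] at this
          linarith
      _ = ∑ A ∈ (level Λ h η).powerset, Real.exp (-(β * per Λ)) * wt β Λ η * δ ^ A.card := by
          rw [← Finset.mul_sum]
          congr 1
          have := Finset.prod_one_add (s := level Λ h η) (f := fun _ : Site => δ)
          simpa using this
      _ ≤ _ := by
          refine Finset.sum_le_sum fun A hA => ?_
          rw [hδ, wt, wt, ← Real.exp_nat_mul, ← Real.exp_add, ← Real.exp_add]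
          refine Real.exp_le_exp.2 ?_
          have := mul_le_mul_of_nonneg_left
            (energy_puncture_le hh (Finset.mem_powerset.1 hA)) hβ
          linarith
  have h3 : Real.exp (-(β * per Λ - δ * m / 2)) * WN β Λ N (fun η => m ≤ (level Λ h η).card) ≤
      WN β Λ (N + 1) fun _ => True := by
    refine le_trans ?_ h1
    rw [Finset.sum_sigma, WN, Finset.mul_sum]
    exact Finset.sum_le_sum h2
  have h4 := mul_le_mul_of_nonneg_left h3 (Real.exp_pos (β * per Λ - δ * m / 2)).le
  rwa [← mul_assoc, ← Real.exp_add, add_neg_cancel, Real.exp_zero, one_mul] at h4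

/-- A ceiling that is rarely reached can be lowered by one at bounded cost. -/
theorem WN_succ_le (hβ : 0 < β) (n : ℕ)
    (hrare : W β Λ (fun η => ∃ x ∈ Λ, ((n + 1 : ℕ) : ℤ) ≤ η x) ≤ 1 / 2 * W β Λ fun _ => True) :
    WN β Λ (n + 1) (fun _ => True) ≤ 2 * WN β Λ n fun _ => True := by
  -- Reaching the ceiling is an increasing event, hence no likelier under the ceiling `n + 1` than
  -- without one.
  have h1 := WN_mul_W_le (Λ := Λ) hβ (n + 1) (P := fun η => ∃ x ∈ Λ, ((n + 1 : ℕ) : ℤ) ≤ η x)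
    fun η ζ ⟨x, hx, hle⟩ hηζ => ⟨x, hx, hle.trans (hηζ x)⟩
  have hpos := W_pos (Λ := Λ) hβ
  have h2 : WN β Λ (n + 1) (fun η => ∃ x ∈ Λ, ((n + 1 : ℕ) : ℤ) ≤ η x) ≤
      1 / 2 * WN β Λ (n + 1) fun _ => True := by
    refine le_of_mul_le_mul_right (h1.trans ?_) hpos
    have := mul_le_mul_of_nonneg_left hrare (WN_nonneg (β := β) (Λ := Λ) (n + 1) fun _ => True)
    linarith
  have h3 : WN β Λ (n + 1) (fun _ => True) ≤ WN β Λ n (fun _ => True) +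
      WN β Λ (n + 1) (fun η => ∃ x ∈ Λ, ((n + 1 : ℕ) : ℤ) ≤ η x) := by
    obtain ⟨P, hP⟩ : ∃ P : (Site → ℤ) → Prop, P = fun η => ∃ x ∈ Λ, ((n + 1 : ℕ) : ℤ) ≤ η x :=
      ⟨_, rfl⟩
    rw [← hP]
    have hsub : confs Λ (n + 1) ⊆ confs Λ n ∪
        (confs Λ (n + 1)).filter P := by
      intro η hη
      rw [Finset.mem_union, Finset.mem_filter]
      by_cases hx : P η
      · exact .inr ⟨hη, hx⟩
      · rw [hP] at hx
        refine .inl (mem_confs.2 ⟨(mem_confs.1 hη).1, fun x => ⟨((mem_confs.1 hη).2 x).1, ?_⟩⟩)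
        by_cases hxΛ : x ∈ Λ
        · have : ¬ ((n + 1 : ℕ) : ℤ) ≤ η x := fun h' => hx ⟨x, hxΛ, h'⟩
          push_cast at this; omega
        · rw [(mem_confs.1 hη).1 x hxΛ]; positivity
    have := Finset.sum_le_sum_of_subset_of_nonneg (f := wt β Λ) hsub
      fun _ _ _ => (wt_pos _ _ _).le
    simp only [WN, Finset.filter_true]
    refine this.trans ?_
    rw [← Finset.sum_union_inter]
    exact le_add_of_nonneg_right (Finset.sum_nonneg fun _ _ => (wt_pos _ _ _).le)
  linarith

end SOS

end

/-! ### Choice of parameters and summation over the low levels -/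

noncomputable section

namespace SOS

/-- The number of sites of `Λ` at height at most `h`. -/
def countLE (Λ : Finset Site) (h : ℤ) (η : Site → ℤ) : ℕ := (Λ.filter fun x => η x ≤ h).card

theorem card_filter_extend {Λ : Finset Site} {n : ℕ} (η : Config Λ n) (p : ℤ → Prop) :
    (Λ.filter fun x => p (extend η x)).card =
      (Finset.univ.filter fun v : Λ => p (height η v)).card := by
  rw [← Finset.card_map (Function.Embedding.subtype (· ∈ Λ))]
  congr 1
  ext x
  simp only [Finset.mem_filter, Finset.mem_map, Finset.mem_univ, true_and,
    Function.Embedding.coe_subtype]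
  constructor
  · rintro ⟨hx, hp⟩
    exact ⟨⟨x, hx⟩, by rwa [← extend_coe], rfl⟩
  · rintro ⟨v, hp, rfl⟩
    exact ⟨v.2, by rwa [extend_coe]⟩

theorem numGE_eq {Λ : Finset Site} {n : ℕ} (η : Config Λ n) (h : ℤ) :
    numGE η h = countGE Λ h (extend η) := by
  unfold numGE countGE
  convert (card_filter_extend η (h ≤ ·)).symm

theorem numLE_eq {Λ : Finset Site} {n : ℕ} (η : Config Λ n) (h : ℤ) :
    numLE η h = countLE Λ h (extend η) := by
  unfold numLE countLE
  convert (card_filter_extend η (· ≤ h)).symm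

section Bounds

variable {β κ C : ℝ} {L K m : ℕ} {a : Site}

theorem W_countGE_eqHeight_le (hβ : 1 ≤ β) (hL : 2 ≤ L) (hκ : 0 < κ) (hC : 1 ≤ C)
    (hm : 6 * C ≤ Real.exp m)
    (hmass : ∀ t : ℝ, 0 ≤ t → t * C * L ≤ 2 * κ → ∀ q N : ℕ, mass β (box a L) N
        (fun η => Real.exp (t * countGE (box a L) (eqHeight β L + K + q) η)) ≤
          Real.exp (t * (L ^ 2 * (C * Real.exp (-3 * β * q)))) * W β (box a L) fun _ => True)
    {k : ℕ} (hk : 3 * K + m ≤ k) :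
    W β (box a L) (fun η => Real.exp (-2 * β * k) * (L : ℝ) ^ 2 <
        countGE (box a L) (eqHeight β L + k) η) ≤
      Real.exp (-(κ / C * Real.exp (-2 * β * k) * L)) * W β (box a L) fun _ => True := by
  have hL0 : (0 : ℝ) < L := by positivity
  have hC0 : 0 < C := by linarith
  -- The largest admissible parameter.
  set t : ℝ := 2 * κ / (C * L) with ht
  have ht0 : 0 ≤ t := by positivity
  have htL : t * C * L = 2 * κ := by rw [ht]; field_simp
  obtain ⟨q, rfl⟩ : ∃ q, k = K + q := ⟨k - K, by omega⟩
  have hcount : eqHeight β L + ((K + q : ℕ) : ℤ) = eqHeight β L + K + q := by push_cast; ring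
  rw [hcount]
  refine (W_countGE_le ht0 (hmass t ht0 htL.le q)).trans
    (mul_le_mul_of_nonneg_right (Real.exp_le_exp.2 ?_) (W_nonneg _))
  -- With `q ≥ 2K + m`, the mean term is at most half of the threshold term, so half of the exponent
  -- survives.
  have h1 : C * Real.exp (-3 * β * q) ≤ 1 / 2 * Real.exp (-2 * β * (K + q : ℕ)) := by
    calc C * Real.exp (-3 * β * q) ≤ 1 / 2 * Real.exp m * Real.exp (-3 * β * q) :=
          mul_le_mul_of_nonneg_right (by linarith) (Real.exp_pos _).le
      _ = 1 / 2 * Real.exp (m + -3 * β * q) := by rw [mul_assoc, ← Real.exp_add]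
      _ ≤ _ := by
          refine mul_le_mul_of_nonneg_left (Real.exp_le_exp.2 ?_) (by norm_num)
          have h2 : (3 * K + m : ℝ) ≤ K + q := by exact_mod_cast hk
          have h3 := mul_le_mul_of_nonneg_left h2 (by linarith : 0 ≤ β)
          have h4 : (m : ℝ) ≤ β * m := le_mul_of_one_le_left (Nat.cast_nonneg m) hβ
          push_cast
          linarith
  have h2 := mul_le_mul_of_nonneg_left h1 (by positivity : 0 ≤ t * (L : ℝ) ^ 2)
  have h3 : t * (L : ℝ) ^ 2 = 2 * (κ / C * L) := by rw [ht]; field_simp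
  have h4 : t * (L ^ 2 * (C * Real.exp (-3 * β * q))) -
      t * (Real.exp (-2 * β * (K + q : ℕ)) * (L : ℝ) ^ 2) =
      t * (L : ℝ) ^ 2 * (C * Real.exp (-3 * β * q)) -
      t * (L : ℝ) ^ 2 * Real.exp (-2 * β * (K + q : ℕ)) := by ring
  rw [h4]
  have h5 : t * (L : ℝ) ^ 2 * (1 / 2 * Real.exp (-2 * β * (K + q : ℕ))) -
      t * (L : ℝ) ^ 2 * Real.exp (-2 * β * (K + q : ℕ)) =
      -(κ / C * Real.exp (-2 * β * (K + q : ℕ)) * L) := by rw [h3]; ring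
  linarith

theorem W_exists_ceiling_le (hβ : 1 ≤ β) (hL : 2 ≤ L) (hκ : 0 < κ) (hκ1 : κ ≤ 1 / 8) (hC : 1 ≤ C)
    (hm : 6 * C ≤ Real.exp m)
    (hmass : ∀ t : ℝ, 0 ≤ t → t * C * L ≤ 2 * κ → ∀ q N : ℕ, mass β (box a L) N
        (fun η => Real.exp (t * countGE (box a L) (eqHeight β L + K + q) η)) ≤
          Real.exp (t * (L ^ 2 * (C * Real.exp (-3 * β * q)))) * W β (box a L) fun _ => True)
    (hKL : 4 * (3 * K + m : ℝ) ≤ Real.log L) {n : ℕ} (hn : Real.log L ≤ n) :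
    W β (box a L) (fun η => ∃ x ∈ box a L, ((n + 1 : ℕ) : ℤ) ≤ η x) ≤
      1 / 2 * W β (box a L) fun _ => True := by
  have hL0 : (0 : ℝ) < L := by positivity
  have hL2 : (2 : ℝ) ≤ L := by exact_mod_cast hL
  have hC0 : 0 < C := by linarith
  have hK0 : (0 : ℝ) ≤ K := Nat.cast_nonneg K
  have hm0 : (0 : ℝ) ≤ m := Nat.cast_nonneg m
  set t : ℝ := 2 * κ / (C * L) with ht
  have ht0 : 0 < t := by positivity
  have htL : t * C * L = 2 * κ := by rw [ht]; field_simp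
  have ht1 : t ≤ 1 := by
    rw [ht, div_le_one (by positivity)]
    nlinarith
  have hH0 : (0 : ℝ) ≤ eqHeight β L := by exact_mod_cast eqHeight_nonneg hβ L
  have hH4 := mul_eqHeight_le hβ L
  have hH1 : 4 * (eqHeight β L : ℝ) ≤ Real.log L := by nlinarith
  obtain ⟨q, hq⟩ : ∃ q : ℕ, ((n + 1 : ℕ) : ℤ) = eqHeight β L + K + q := by
    refine ⟨(n + 1 - eqHeight β L - K).toNat, ?_⟩
    have : (0 : ℤ) ≤ n + 1 - eqHeight β L - K := by
      have : (0 : ℝ) ≤ n + 1 - eqHeight β L - K := by linarith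
      exact_mod_cast this
    rw [Int.toNat_of_nonneg this]; push_cast; ring
  have hqR : (n : ℝ) + 1 = eqHeight β L + K + q := by exact_mod_cast hq
  -- Here `H` is at most a quarter of `log L`, so `n ≥ log L` forces `3q ≥ 2 log L + m`, which
  -- absorbs the area `L ^ 2` and the constant.
  have hρ : (L : ℝ) ^ 2 * (C * Real.exp (-3 * β * q)) ≤ 1 / 6 := by
    have h1 : (L : ℝ) ^ 2 = Real.exp (2 * Real.log L) := by
      rw [mul_comm, Real.exp_mul, Real.exp_log hL0]; norm_cast
    have h2 : Real.exp (2 * Real.log L) * (Real.exp m * Real.exp (-3 * β * q)) ≤ 1 := by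
      rw [← Real.exp_add, ← Real.exp_add, Real.exp_le_one_iff]
      have h3 : (q : ℝ) = n + 1 - eqHeight β L - K := by linarith
      have h4 : 0 ≤ (β - 1) * (Real.log L - K) := mul_nonneg (by linarith) (by linarith)
      have h5 := mul_le_mul_of_nonneg_left hn (by linarith : 0 ≤ β)
      rw [h3]
      linarith
    have h3 : C * Real.exp (-3 * β * q) ≤ 1 / 6 * (Real.exp m * Real.exp (-3 * β * q)) := by
      have := mul_le_mul_of_nonneg_right hm (Real.exp_pos (-3 * β * q)).le
      linarith
    have h4 := mul_le_mul_of_nonneg_left h3 (Real.exp_pos (2 * Real.log L)).le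
    rw [h1]
    linarith
  have h1 := mul_W_exists_le (ℓ := eqHeight β L + K + q) (by linarith : 0 < β) ht0.le
    (hmass t ht0.le htL.le q)
  rw [← hq] at h1
  set c := t * (L ^ 2 * (C * Real.exp (-3 * β * q))) with hc
  have hc0 : 0 ≤ c := by positivity
  have hct : c ≤ t * (1 / 6) := mul_le_mul_of_nonneg_left hρ ht0.le
  have h2 : Real.exp c - 1 ≤ t * (1 / 2) := by
    have h3 : Real.exp c ≤ 3 := by
      refine (Real.exp_le_exp.2 (by linarith : c ≤ 1)).trans ?_
      linarith [Real.exp_one_lt_d9]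
    have h4 := mul_le_mul_of_nonneg_left h3 hc0
    linarith [exp_sub_one_le c]
  refine le_of_mul_le_mul_left (h1.trans ?_) ht0
  rw [← mul_assoc]
  exact mul_le_mul_of_nonneg_right h2 (W_nonneg _)

theorem exp_neg_one_le_half : Real.exp (-1) ≤ 1 / 2 := by
  rw [Real.exp_neg, inv_le_comm₀ (Real.exp_pos _) (by norm_num)]
  linarith [Real.add_one_le_exp (1 : ℝ)]

theorem exp_neg_le_half_pow (i : ℕ) : Real.exp (-i) ≤ (1 / 2 : ℝ) ^ i := by
  rw [← mul_neg_one (i : ℝ), Real.exp_nat_mul]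
  exact pow_le_pow_left₀ (Real.exp_pos _).le exp_neg_one_le_half i

/-- Pigeonhole over the levels below `H - k`: the thresholds decay at least as fast as `2 ^ (-i)`
and so sum to at most the given total. -/
theorem exists_level_of_countLE (hβ : 1 ≤ β) {Λ : Finset Site} {H k N : ℕ}
    {η : Site → ℤ} (hη : η ∈ confs Λ N) {V : ℝ} (hV : 0 ≤ V)
    (h : Real.exp (-2 * β * k) * V < countLE Λ (H - k : ℕ) η) :
    ∃ i ∈ Finset.range (H - k + 1), 1 / 2 * Real.exp (-2 * β * (k + i)) * V ≤
      (level Λ ((H - k : ℕ) - i) η).card := by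
  by_contra! hlt
  have h1 : Λ.filter (fun x => η x ≤ (H - k : ℕ)) ⊆
      (Finset.range (H - k + 1)).biUnion fun i => level Λ ((H - k : ℕ) - i) η := by
    intro x hx
    obtain ⟨hxΛ, hxh⟩ := Finset.mem_filter.1 hx
    have h0 := ((mem_confs.1 hη).2 x).1
    refine Finset.mem_biUnion.2 ⟨(((H - k : ℕ) : ℤ) - η x).toNat, Finset.mem_range.2 (by omega),
      Finset.mem_filter.2 ⟨hxΛ, by omega⟩⟩
  have h2 : (countLE Λ (H - k : ℕ) η : ℝ) ≤
      ∑ i ∈ Finset.range (H - k + 1), ((level Λ ((H - k : ℕ) - i) η).card : ℝ) := by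
    exact_mod_cast (Finset.card_le_card h1).trans Finset.card_biUnion_le
  have h3 : ∀ i ∈ Finset.range (H - k + 1), ((level Λ ((H - k : ℕ) - i) η).card : ℝ) ≤
      1 / 2 * Real.exp (-2 * β * k) * V * (1 / 2) ^ i := by
    intro i hi
    refine (hlt i hi).le.trans ?_
    have h4 : Real.exp (-2 * β * (k + i)) ≤ Real.exp (-2 * β * k) * (1 / 2) ^ i := by
      refine le_trans ?_ (mul_le_mul_of_nonneg_left (exp_neg_le_half_pow i) (Real.exp_pos _).le)
      rw [← Real.exp_add]
      refine Real.exp_le_exp.2 ?_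
      have := mul_le_mul_of_nonneg_right hβ (Nat.cast_nonneg (α := ℝ) i)
      have := Nat.cast_nonneg (α := ℝ) i
      linarith
    have := mul_le_mul_of_nonneg_right h4 (by positivity : 0 ≤ 1 / 2 * V)
    linarith
  have h5 := Finset.sum_le_sum h3
  rw [← Finset.mul_sum] at h5
  have h6 := mul_le_mul_of_nonneg_left (sum_geometric_two_le (H - k + 1))
    (by positivity : 0 ≤ 1 / 2 * Real.exp (-2 * β * k) * V)
  linarith

/-- With `j = k + i`, the entropy is at least `L * exp (2βj - 4β) / 4`. As `j ≥ 8`, this is at least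
`6L * exp (βj)`, enough for the perimeter cost, the target exponent, and a summable excess `i + 2`.
-/
theorem level_exponent_le (hβ : 1 ≤ β) {H k i : ℕ} (hk : 8 ≤ k) (hi : k + i ≤ H)
    (hL : Real.exp (4 * β * H) ≤ L) :
    β * (4 * L) - Real.exp (-4 * β * (((H - k : ℕ) : ℝ) - i + 1)) *
        (1 / 2 * Real.exp (-2 * β * (k + i)) * (L : ℝ) ^ 2) / 2 ≤
      -(Real.exp (β * k) * L) - (i + 2 : ℕ) := by
  have hL1 : (1 : ℝ) ≤ L := (Real.one_le_exp (by positivity)).trans hL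
  have hcast : ((H - k : ℕ) : ℝ) = H - k := by
    rw [Nat.cast_sub (by omega)]
  set j : ℝ := k + i with hj
  have hj8 : 8 ≤ j := by
    have : (8 : ℝ) ≤ k := by exact_mod_cast hk
    have := Nat.cast_nonneg (α := ℝ) i
    linarith
  have hβj : 8 * β ≤ β * j := by nlinarith
  have hjβ : j ≤ β * j := by nlinarith
  have h24 : 24 ≤ Real.exp (β * j - 4 * β) := by
    refine le_trans ?_ (Real.exp_le_exp.2 (by linarith : (4 : ℝ) ≤ _))
    have h1 : Real.exp 4 = Real.exp 1 ^ 4 := by rw [← Real.exp_nat_mul]; norm_num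
    rw [h1]
    have h2 : (2.5 : ℝ) ≤ Real.exp 1 := by linarith [Real.exp_one_gt_d9]
    refine le_trans ?_ (pow_le_pow_left₀ (by norm_num) h2 4)
    norm_num
  have h1 : Real.exp (4 * β * j - 4 * β) ≤ Real.exp (-4 * β * (((H - k : ℕ) : ℝ) - i + 1)) * L := by
    refine le_trans (le_of_eq ?_) (mul_le_mul_of_nonneg_left hL (Real.exp_pos _).le)
    rw [← Real.exp_add, hcast, hj]
    congr 1; ring
  have h2 := mul_le_mul_of_nonneg_right h1
    (by positivity : 0 ≤ 1 / 4 * Real.exp (-2 * β * j) * (L : ℝ))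
  have h3 : Real.exp (4 * β * j - 4 * β) * Real.exp (-2 * β * j) =
      Real.exp (β * j - 4 * β) * Real.exp (β * j) := by
    rw [← Real.exp_add, ← Real.exp_add]; congr 1; ring
  have h4 := mul_le_mul_of_nonneg_right h24 (Real.exp_pos (β * j)).le
  have h5 := Real.add_one_le_exp (β * j)
  have h6 : Real.exp (β * k) ≤ Real.exp (β * j) := by
    refine Real.exp_le_exp.2 (mul_le_mul_of_nonneg_left ?_ (by linarith))
    rw [hj]; linarith [Nat.cast_nonneg (α := ℝ) i]
  have h7 : Real.exp (β * k) + 4 * β + (i + 2) ≤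
      1 / 4 * (Real.exp (4 * β * j - 4 * β) * Real.exp (-2 * β * j)) := by
    rw [h3]
    have : (i : ℝ) ≤ j := by rw [hj]; linarith [Nat.cast_nonneg (α := ℝ) k]
    linarith
  have h8 := mul_le_mul_of_nonneg_right h7 (by linarith : (0 : ℝ) ≤ L)
  have h9 : ((i : ℝ) + 2) ≤ (i + 2) * L := le_mul_of_one_le_right (by positivity) hL1
  push_cast
  linarith

/-- The excess `i + 2` gives factors `2 ^ (-i-2)`: their sum is at most `1 / 2`, which compensates
the factor `2` from the ceiling. -/
theorem WN_countLE_le (hβ : 1 ≤ β) {H k n : ℕ} (hk : 8 ≤ k) (hkH : k ≤ H)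
    (hL : Real.exp (4 * β * H) ≤ L)
    (hsucc : WN β (box a L) (n + 1) (fun _ => True) ≤ 2 * WN β (box a L) n fun _ => True) :
    WN β (box a L) n (fun η => Real.exp (-2 * β * k) * (L : ℝ) ^ 2 <
        countLE (box a L) (H - k : ℕ) η) ≤
      Real.exp (-(Real.exp (β * k) * L)) * WN β (box a L) n fun _ => True := by
  set Z := WN β (box a L) n fun _ => True with hZ
  have hZ0 : 0 ≤ Z := WN_nonneg _ _
  clear_value Z
  refine (WN_le_sum (Finset.range (H - k + 1)) (Q := fun i η =>
    1 / 2 * Real.exp (-2 * β * (k + i)) * (L : ℝ) ^ 2 ≤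
      (level (box a L) ((H - k : ℕ) - i) η).card) ?_).trans ?_
  · intro η hη h
    exact exists_level_of_countLE hβ hη (V := (L : ℝ) ^ 2) (sq_nonneg _) h
  have h1 : ∀ i ∈ Finset.range (H - k + 1), WN β (box a L) n (fun η =>
      1 / 2 * Real.exp (-2 * β * (k + i)) * (L : ℝ) ^ 2 ≤
      (level (box a L) ((H - k : ℕ) - i) η).card) ≤
      1 / 2 * Real.exp (-(Real.exp (β * k) * L)) * Z * (1 / 2) ^ i := by
    intro i hi
    rw [Finset.mem_range] at hi
    refine (WN_level_le (by linarith) (by omega) n).trans ?_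
    have hper : β * (per (box a L) : ℝ) ≤ β * (4 * L) :=
      mul_le_mul_of_nonneg_left (by exact_mod_cast per_box_le a L) (by linarith)
    have h2 := level_exponent_le (L := L) hβ hk (by omega : k + i ≤ H) hL
    have h3 : Real.exp (β * per (box a L) - Real.exp (-4 * β * ((((H - k : ℕ) - i : ℤ) : ℝ) + 1)) *
        (1 / 2 * Real.exp (-2 * β * (k + i)) * (L : ℝ) ^ 2) / 2) ≤
        Real.exp (-(Real.exp (β * k) * L)) * (1 / 2) ^ (i + 2) := by
      refine le_trans ?_ (mul_le_mul_of_nonneg_left (exp_neg_le_half_pow (i + 2))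
        (Real.exp_pos _).le)
      rw [← Real.exp_add]
      refine Real.exp_le_exp.2 ?_
      push_cast at h2 ⊢
      linarith
    refine (mul_le_mul h3 hsucc (WN_nonneg _ _) (by positivity)).trans_eq ?_
    ring
  refine (Finset.sum_le_sum h1).trans ?_
  rw [← Finset.mul_sum]
  have h4 := mul_le_mul_of_nonneg_left (sum_geometric_two_le (H - k + 1))
    (by positivity : 0 ≤ 1 / 2 * Real.exp (-(Real.exp (β * k) * L)) * Z)
  linarith

end Bounds

end SOS

end

theorem theorem3p1 :
    ∃ (C : ℝ) (K : ℕ), 0 < C ∧ 0 < K ∧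
      ∀ (β : ℝ), 1 ≤ β →
      ∀ (L : ℕ), 2 ≤ L →
      ∀ (n : ℕ), Real.log L ≤ n → n ≤ L →
      ∀ (a : SOS.Site) (k : ℕ), K ≤ k →
        SOS.gibbsProb β (SOS.box a L) n (fun _ => 0)
            {η | Real.exp (-2 * β * k) * (L : ℝ) ^ 2
                  < (SOS.numLE η (SOS.eqHeight β L - k) : ℝ)}
          ≤ Real.exp (-(Real.exp (β * k) * L)) ∧
        SOS.gibbsProb β (SOS.box a L) n (fun _ => 0)
            {η | Real.exp (-2 * β * k) * (L : ℝ) ^ 2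
                  < (SOS.numGE η (SOS.eqHeight β L + k) : ℝ)}
          ≤ Real.exp (-(C * Real.exp (-2 * β * k) * L *
              min 1 (Real.exp (-2 * β * k) * L / Real.log L ^ 8))) := by
  obtain ⟨κ, C, K, hκ, hκ1, hC, hmass⟩ := SOS.exists_mass_exp_le
  obtain ⟨m, hm⟩ := SOS.exists_nat_le_exp (6 * C)
  refine ⟨κ / C, 3 * K + m + 8, by positivity, by omega, fun β hβ L hL n hn _ a k hk => ⟨?_, ?_⟩⟩
  · simp only [SOS.numLE_eq]
    rw [SOS.gibbsProb_eq β (SOS.box a L) n fun η => Real.exp (-2 * β * k) * (L : ℝ) ^ 2 <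
      SOS.countLE (SOS.box a L) (SOS.eqHeight β L - k) η,
      div_le_iff₀ (SOS.WN_true_pos _ _ _)]
    obtain ⟨H, hH⟩ := Int.eq_ofNat_of_zero_le (SOS.eqHeight_nonneg hβ L)
    -- For `k > H` no height lies below the threshold. Otherwise `log L ≥ 4βH ≥ 4k`, which supplies
    -- the largeness of `L` needed for the ceiling.
    rcases lt_or_ge H k with hkH | hkH
    · have : SOS.WN β (SOS.box a L) n (fun η => Real.exp (-2 * β * k) * (L : ℝ) ^ 2 <
          SOS.countLE (SOS.box a L) (SOS.eqHeight β L - k) η) = 0 := by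
        rw [SOS.WN, Finset.sum_filter]
        refine Finset.sum_eq_zero fun η hη => if_neg ?_
        rw [not_lt, SOS.countLE, Finset.filter_false_of_mem, Finset.card_empty, Nat.cast_zero]
        · positivity
        · intro x _
          have := ((SOS.mem_confs.1 hη).2 x).1
          omega
      rw [this]
      exact mul_nonneg (Real.exp_pos _).le (SOS.WN_nonneg _ _)
    · have h4 := SOS.mul_eqHeight_le hβ L
      rw [hH] at h4
      have hkH' : (k : ℝ) ≤ H := by exact_mod_cast hkH
      have hk' : (3 * K + m + 8 : ℝ) ≤ k := by exact_mod_cast hk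
      have hH4 : Real.exp (4 * β * H) ≤ L := by
        rw [← Real.exp_log (by positivity : (0 : ℝ) < L)]
        exact Real.exp_le_exp.2 (by simpa using h4)
      have hKL : 4 * (3 * K + m : ℝ) ≤ Real.log L := by
        refine le_trans ?_ h4
        have : (0 : ℝ) ≤ (β - 1) * H := mul_nonneg (by linarith) (Nat.cast_nonneg H)
        simp only [Int.cast_natCast]
        linarith
      have hHk : SOS.eqHeight β L - k = ((H - k : ℕ) : ℤ) := by
        rw [hH, Nat.cast_sub hkH]
      rw [hHk]
      exact SOS.WN_countLE_le hβ (by omega) hkH hH4 (SOS.WN_succ_le (by linarith) n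
        (SOS.W_exists_ceiling_le hβ hL hκ hκ1 hC hm (hmass β hβ L hL a) hKL hn))
  · simp only [SOS.numGE_eq]
    rw [SOS.gibbsProb_eq β (SOS.box a L) n fun η => Real.exp (-2 * β * k) * (L : ℝ) ^ 2 <
      SOS.countGE (SOS.box a L) (SOS.eqHeight β L + k) η,
      div_le_iff₀ (SOS.WN_true_pos _ _ _)]
    have hβ0 : 0 < β := by linarith
    have h1 := SOS.WN_mul_W_le (Λ := SOS.box a L) hβ0 n
      (P := fun η => Real.exp (-2 * β * k) * (L : ℝ) ^ 2 <
        SOS.countGE (SOS.box a L) (SOS.eqHeight β L + k) η) fun η ζ h hηζ =>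
        h.trans_le (by exact_mod_cast SOS.countGE_mono hηζ)
    have h2 := SOS.W_countGE_eqHeight_le hβ hL hκ hC hm (hmass β hβ L hL a)
      (by omega : 3 * K + m ≤ k)
    have hZ := SOS.WN_true_pos β (SOS.box a L) n
    have h3 := h1.trans (mul_le_mul_of_nonneg_left h2 hZ.le)
    rw [← mul_assoc] at h3
    refine (le_of_mul_le_mul_right h3 (SOS.W_pos hβ0)).trans ?_
    rw [mul_comm]
    -- The exponent obtained has no minimum; bounding the minimum by `1` gives the stated form.
    refine mul_le_mul_of_nonneg_right (Real.exp_le_exp.2 (neg_le_neg ?_)) hZ.le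
    exact mul_le_of_le_one_right (by positivity) (min_le_left _ _)
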